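/- **Setting.** Let $\mathbb T=\mathbb R/\mathbb Z$ (represented by $[0,1)$), $M=[0,1]\times\mathbb T$, and let $f:M\to M$, $f(x,\theta)=(f_1(x,\theta),f_2(\theta))$, where $$f_1(x,\theta)=\begin{cases}x(1+x^\gamma u(x,\theta)),&0\le x\le \tfrac34,\\ 4x-3,&\tfrac34<x\le 1,\end{cases}\qquad f_2(\theta)=4\theta \bmod 1 .$$ Here $\gamma>0$, and $u:[0,\frac34]\times\mathbb T\to(0,\infty)$ is $C^2$ with $u(0,\theta)\equiv c_0>0$, such that $x(1+x^\gamma u(x,\theta))\le 1$ and $|(Df)_{(x,\theta)}v|\ge|v|$ for all $(x,\theta)\in[0,\frac34]\times\mathbb T$, $v\in\mathbb R^2$, and $f_1(\frac34,\theta)>\frac{15}{16}$ for all $\theta$. Let $X=\bigcup_{i=0}^3\{(x,\theta)\in M: 0\le x\le f_1(\tfrac34,\tfrac{i+\theta}4),\ \theta\in[0,1)\}$ and assume that $X$ is invariant, $f(X)\subset X$. Let $Y=([\frac34,1]\times\mathbb T)\cap X$, regarded as a subset of $\mathbb R^2$ with Euclidean distance $|\cdot|$, let $\varphi:Y\to\mathbb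 Z^+$ be the first return time to $Y$ and $F=f^\varphi:Y\to Y$ the first return map. For $n\ge1$, $1\le j\le 4^n$, let $Y_{n,j}$ be the interior in $\mathbb R^2$ of $\{(y,\theta)\in Y:\varphi(y,\theta)=n,\ (j-1)/4^n<\theta<j/4^n\}$, and let $\alpha^Y=\{Y_{n,j}\}$. For $a\in\alpha^Y$ write $F_a=F|_a:a\to Fa$, and $JF_a^{-1}=\det DF_a^{-1}$. For $A\subset\mathbb R^2$ and $\varepsilon>0$ let $\partial_\varepsilon A=\{x\in A: d(x,\partial A)\le\varepsilon\}$, where $\partial A$ is the boundary in $\mathbb R^2$ and $d(x,\emptyset)=\infty$. $\mathrm{Leb}$ is Lebesgue measure on $\mathbb R^2$, and a rectangle is a nonempty bounded open rectangle with sides parallel to the axes. **Theorem.** Every branch $F_a:a\to Fa$, $a\in\alpha^Y$, is a $C^1$ diffeomorphism between open subsets of $\mathbb R^2$. Moreover, let $\Lambda\in(\frac14,\frac13)$. Then there exist $\varepsilon_0\in(0,1)$ and $C>0$ such that the following hold. 1. *Uniform expansion:* $|F_a^{-1}z_1-F_a^{-1}z_2|\le\Lambda|z_1-z_2|$ for all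 $a\in\alpha^Y$ and all $z_1,z_2\in Fa$ with $|z_1-z_2|<\varepsilon_0$. 2. *Bounded distortion:* $(JF_a^{-1})(z_1)\le e^{C|z_1-z_2|}(JF_a^{-1})(z_2)$ for all $a\in\alpha^Y$ and all $z_1,z_2\in Fa$. 3. *Controlled complexity:* for every (nonempty) open set $I\subset Y$ with $\operatorname{diam}I\le\varepsilon_0$ and all $\varepsilon\in(0,\varepsilon_0)$, $$\sum_{a\in\alpha^Y}\frac{\mathrm{Leb}\big(F_a^{-1}(\partial_\varepsilon F(I\cap a))\setminus\partial_{\varepsilon\Lambda}I\big)}{\mathrm{Leb}\,\partial_{\varepsilon\Lambda}I}<\Lambda^{-1}-1 .$$ 4. *Sets $Z,Z'$:* for all sufficiently small $\delta>0$ there exist rectangles $Z,Z'\subset Y$ with $\mathrm{Leb}\,Z<\mathrm{Leb}\,Z'$ and $\operatorname{diam}Z'\le\delta$ such that, for all sufficiently large $n$, $F(Z\cap\operatorname{Int}\{\varphi=n\})$ is contained in $Y$, contains $\operatorname{Int}Y$, and is equal to $Y$ up to a Lebesgue null set; and there exist $a_1,a_2\in\alpha^Y$ with $a_i\subset Z$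 and $Fa_i\supset Z'$ for $i=1,2$, and $\varphi|_{a_2}-\varphi|_{a_1}=1$. -/

import Mathlib

open Set MeasureTheory Filter
open scoped ENNReal Topology

noncomputable section

namespace EMV

/-- The plane with its Euclidean metric.  The coordinate `z 0` is the spatial variable and `z 1` is
the angle; the circle `ℝ / ℤ` is represented by its fundamental domain `[0, 1)`. -/
abbrev Plane : Type := EuclideanSpace ℝ (Fin 2)

/-- The curved (left) branch of the first component, `x (1 + x ^ γ u(x, θ))`. -/
def leftFst (γ : ℝ) (u : ℝ → ℝ → ℝ) (x θ : ℝ) : ℝ := x * (1 + x ^ γ * u x θ)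

/-- The first component `f₁` of the intermittent map. -/
def f₁ (γ : ℝ) (u : ℝ → ℝ → ℝ) (x θ : ℝ) : ℝ :=
  if x ≤ 3 / 4 then leftFst γ u x θ else 4 * x - 3

/-- The second component `f₂(θ) = 4 θ mod 1`. -/
def f₂ (θ : ℝ) : ℝ := Int.fract (4 * θ)

/-- The intermittent map `f(x, θ) = (f₁(x, θ), f₂(θ))`. -/
def f (γ : ℝ) (u : ℝ → ℝ → ℝ) (z : Plane) : Plane :=
  !₂[f₁ γ u (z 0) (z 1), f₂ (z 1)]

/-- The lift to `[0, 3/4] × ℝ` of the restriction of `f` to `[0, 3/4] × 𝕋`; it has the same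
derivative as `f`. -/
def leftLift (γ : ℝ) (u : ℝ → ℝ → ℝ) (z : Plane) : Plane :=
  !₂[leftFst γ u (z 0) (z 1), 4 * z 1]

/-- The strip `[0, 3/4] × ℝ`. -/
def leftStrip : Set Plane := {z | z 0 ∈ Icc (0 : ℝ) (3 / 4)}

/-- The standing assumptions on the parameter `γ` and on the function
`u : [0, 3/4] × 𝕋 → (0, ∞)`, which is given as a function that is `1`-periodic in its second
variable (its values for `x ∉ [0, 3/4]` are irrelevant). -/
structure IsAdmissible (γ : ℝ) (u : ℝ → ℝ → ℝ) : Prop where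
  gamma_pos : 0 < γ
  periodic : ∀ x ∈ Icc (0 : ℝ) (3 / 4), ∀ θ, u x (θ + 1) = u x θ
  contDiffOn : ContDiffOn ℝ 2 (fun p : ℝ × ℝ => u p.1 p.2) (Icc (0 : ℝ) (3 / 4) ×ˢ univ)
  pos : ∀ x ∈ Icc (0 : ℝ) (3 / 4), ∀ θ, 0 < u x θ
  const_at_zero : ∃ c₀ : ℝ, 0 < c₀ ∧ ∀ θ, u 0 θ = c₀
  le_one : ∀ x ∈ Icc (0 : ℝ) (3 / 4), ∀ θ, leftFst γ u x θ ≤ 1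
  expanding : ∀ z ∈ leftStrip, ∀ v : Plane,
    ‖v‖ ≤ ‖fderivWithin ℝ (leftLift γ u) leftStrip z v‖
  image_large : ∀ θ, 15 / 16 < leftFst γ u (3 / 4) θ

/-- The phase space `M = [0, 1] × 𝕋`. -/
def M : Set Plane := {z | z 0 ∈ Icc (0 : ℝ) 1 ∧ z 1 ∈ Ico (0 : ℝ) 1}

/-- The image `X_i = f([0, 3/4] × [i/4, (i+1)/4])`. -/
def Xpiece (γ : ℝ) (u : ℝ → ℝ → ℝ) (i : ℕ) : Set Plane :=
  {z | z ∈ M ∧ z 0 ≤ f₁ γ u (3 / 4) ((i + z 1) / 4)}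

/-- The invariant set `X = X_0 ∪ X_1 ∪ X_2 ∪ X_3`. -/
def X (γ : ℝ) (u : ℝ → ℝ → ℝ) : Set Plane := ⋃ i ∈ Finset.range 4, Xpiece γ u i

/-- The inducing set `Y = ([3/4, 1] × 𝕋) ∩ X`. -/
def Y (γ : ℝ) (u : ℝ → ℝ → ℝ) : Set Plane := {z | z 0 ∈ Icc (3 / 4 : ℝ) 1} ∩ X γ u

/-- The first return time `φ` to `Y`. -/
def φ (γ : ℝ) (u : ℝ → ℝ → ℝ) (z : Plane) : ℕ :=
  sInf {n : ℕ | 1 ≤ n ∧ (f γ u)^[n] z ∈ Y γ u}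

/-- The first return map `F = f ^ φ`. -/
def F (γ : ℝ) (u : ℝ → ℝ → ℝ) (z : Plane) : Plane := (f γ u)^[φ γ u z] z

/-- The level set `{φ = n}` in `Y`. -/
def level (γ : ℝ) (u : ℝ → ℝ → ℝ) (n : ℕ) : Set Plane := {z | z ∈ Y γ u ∧ φ γ u z = n}

/-- The partition element `Y_{n,j}`, an open set: the points of `Y` with return time `n` and angle
in `((j-1)/4^n, j/4^n)`, without boundary points.  (Taking the interior removes a null set: the
left edge of each curvilinear rectangle, the right edge of `Y`, and for `n = 1` the segment
`{3/4} × 𝕋`, which lies in `{φ = 1}` because `f` acts on it through the left branch.) -/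
def cell (γ : ℝ) (u : ℝ → ℝ → ℝ) (n j : ℕ) : Set Plane :=
  interior {z | z ∈ level γ u n ∧ z 1 ∈ Ioo (((j : ℝ) - 1) / 4 ^ n) ((j : ℝ) / 4 ^ n)}

/-- The (mod `0`) partition `α^Y = {Y_{n,j} : n ≥ 1, 1 ≤ j ≤ 4^n}` of `Y`. -/
def partitionY (γ : ℝ) (u : ℝ → ℝ → ℝ) : Set (Set Plane) :=
  {a | ∃ n j : ℕ, 1 ≤ n ∧ 1 ≤ j ∧ j ≤ 4 ^ n ∧ a = cell γ u n j}

/-- The inverse `F_a⁻¹ : F a → a` of the branch `F_a = F|_a`. -/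
def branchInv (γ : ℝ) (u : ℝ → ℝ → ℝ) (a : Set Plane) : Plane → Plane :=
  Function.invFunOn (F γ u) a

/-- The Jacobian `J F_a⁻¹ = det D F_a⁻¹`. -/
def jacInv (γ : ℝ) (u : ℝ → ℝ → ℝ) (a : Set Plane) (z : Plane) : ℝ :=
  (fderiv ℝ (branchInv γ u a) z).det

/-- The branch `F_a : a → F a` is a `C¹` diffeomorphism between open sets. -/
def IsDiffeoBranch (γ : ℝ) (u : ℝ → ℝ → ℝ) (a : Set Plane) : Prop :=
  IsOpen a ∧ InjOn (F γ u) a ∧ IsOpen (F γ u '' a) ∧ ContDiffOn ℝ 1 (F γ u) a ∧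
    ContDiffOn ℝ 1 (branchInv γ u a) (F γ u '' a)

/-- `∂_ε A = {x ∈ A : d(x, ∂A) ≤ ε}`, where the distance to the empty set is infinite. -/
def innerBoundary (ε : ℝ) (A : Set Plane) : Set Plane :=
  {x | x ∈ A ∧ Metric.infEDist x (frontier A) ≤ ENNReal.ofReal ε}

/-- Nondegenerate bounded open rectangles with sides parallel to the axes. -/
def IsRectangle (R : Set Plane) : Prop :=
  ∃ p q r s : ℝ, p < q ∧ r < s ∧ R = {z | z 0 ∈ Ioo p q ∧ z 1 ∈ Ioo r s}

/-- Uniform expansion with constant `Λ` at scale `ε₀`. -/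
def UniformExpansion (γ : ℝ) (u : ℝ → ℝ → ℝ) (Λ ε₀ : ℝ) : Prop :=
  ∀ a ∈ partitionY γ u, ∀ z₁ ∈ F γ u '' a, ∀ z₂ ∈ F γ u '' a, dist z₁ z₂ < ε₀ →
    dist (branchInv γ u a z₁) (branchInv γ u a z₂) ≤ Λ * dist z₁ z₂

/-- Bounded distortion with constant `C`. -/
def BoundedDistortion (γ : ℝ) (u : ℝ → ℝ → ℝ) (C : ℝ) : Prop :=
  ∀ a ∈ partitionY γ u, ∀ z₁ ∈ F γ u '' a, ∀ z₂ ∈ F γ u '' a,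
    jacInv γ u a z₁ ≤ Real.exp (C * dist z₁ z₂) * jacInv γ u a z₂

/-- Controlled complexity.  The sum is taken in `[0, ∞]`; for nonempty `I` the denominator is
positive and finite. -/
def ControlledComplexity (γ : ℝ) (u : ℝ → ℝ → ℝ) (Λ ε₀ : ℝ) : Prop :=
  ∀ I : Set Plane, IsOpen I → I ⊆ Y γ u → Metric.diam I ≤ ε₀ → ∀ ε : ℝ, 0 < ε → ε < ε₀ →
    ∑' a : partitionY γ u,
      volume (branchInv γ u a '' innerBoundary ε (F γ u '' (I ∩ a)) \ innerBoundary (ε * Λ) I) /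
        volume (innerBoundary (ε * Λ) I) < ENNReal.ofReal (Λ⁻¹ - 1)

/-- Existence of arbitrarily small suitable rectangles `Z, Z'`.  The image of
`Z ∩ Int {φ = n}` is `Y` up to boundary points of `Y`, hence up to a null set. -/
def SmallRectangles (γ : ℝ) (u : ℝ → ℝ → ℝ) : Prop :=
  ∃ δ₀ : ℝ, 0 < δ₀ ∧ ∀ δ : ℝ, 0 < δ → δ < δ₀ →
    ∃ Z Z' : Set Plane, IsRectangle Z ∧ IsRectangle Z' ∧ Z ⊆ Y γ u ∧ Z' ⊆ Y γ u ∧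
      volume Z < volume Z' ∧ Metric.diam Z' ≤ δ ∧
      (∀ᶠ n : ℕ in atTop,
        F γ u '' (Z ∩ interior (level γ u n)) ⊆ Y γ u ∧
        interior (Y γ u) ⊆ F γ u '' (Z ∩ interior (level γ u n)) ∧
        F γ u '' (Z ∩ interior (level γ u n)) =ᵐ[volume] Y γ u) ∧
      ∃ a₁ ∈ partitionY γ u, ∃ a₂ ∈ partitionY γ u,
        a₁ ⊆ Z ∧ a₂ ⊆ Z ∧ Z' ⊆ F γ u '' a₁ ∧ Z' ⊆ F γ u '' a₂ ∧
        ∀ w₁ ∈ a₁, ∀ w₂ ∈ a₂, (φ γ u w₂ : ℤ) - φ γ u w₁ = 1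

end EMV

end

/-! The return map is explicit enough that every property follows from elementary estimates on the
left branch `x ↦ x (1 + x ^ γ u)`.

A point `(y, θ)` of `Y` with `y > 3/4` first jumps to `4y - 3` and then follows the left branch
until it passes `3/4`.  The total functions `orb k y θ` extend this orbit, with the angle lifted to
`ℝ`, so that it is continuous and increasing in `y`.  The return time is `k + 1` exactly when
`orb k` is the first to reach `3/4`, and on each cell `F` is `(orb k y θ, 4 ^ (k + 1) θ - const)`.

*Expansion.*  The second component of the lifted left branch is linear, so the scalar mean value
theorem writes the increment of the branch between two points as its derivative at one intermediate
point.  The pointwise hypothesis `|Df v| ≥ |v|` therefore gives `leftLift_expanding` for any two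
points of the strip, and the first step makes `F` expand by a factor at least `4` on each cell
(`four_mul_dist_le`).  Hence `F` is injective on cells, and the inverse function theorem yields
the diffeomorphisms.

*Distortion.*  The Jacobian is `4 ^ (k + 1)` times a product of the derivatives `dx` along the
orbit.  In the coordinate `x ^ (-β)` with `0 < β < γ` the left branch does not contract near the
neutral boundary `x = 0`, so the distance of two orbits in this coordinate is controlled by their
final distance (`exists_rpow_neg_orb_bound`), while the factors `x ^ (γ + β)` that
turn it into increments of `dx` are summable along the orbit, since they are dominated by the
increments of `x ^ β`.  This is `exists_dorb_distortion`.

*Complexity.*  If the image of `w ∈ I ∩ a` is `ε`-close to the boundary of `F (I ∩ a)`, then either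
`w` is `ε / 4`-close to the boundary of `I`, hence in the boundary layer that is discarded, or the
nearby boundary point comes from a side of the cell `a` (`near_side_of_mem_innerBoundary`).  The
latter points form two bad sets, for the curved and for the horizontal sides of the cells.  On each
horizontal line the first set has length at most `5ε/8` inside a short interval: finitely many
levels contribute one interval of length `ε/2`, because images are expanded at least by `4` and
different short-time sides are far apart, and all later levels together contribute `ε/8` by bounded
distortion.  Similarly for the second set on vertical lines; there the cells are not stacked
monotonically, but by `exists_shadow` angles that agree to the precision `4 ^ (-k)` have
nearly the same return time, so that the relevant `4`-adic intervals have bounded overlap.  The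
boundary layer of width `εΛ` has length at least `2εΛ` on every line that meets its complement in
`I`.  Integration over lines bounds the complexity by `2 · (5/8) / (2Λ) = 5 / (8Λ)`, which is less
than `Λ⁻¹ - 1` because `Λ < 3/8`.

*Rectangles.*  Points of long return time lie close to `x = 3/4` (`exists_lt_of_return`), and on
each line such points cover the whole image of the last step (`exists_orb_preimage`).  Small squares
at the corner `(3/4, 1/4)` therefore have the required images. -/


open Set MeasureTheory Filter
open scoped ENNReal Topology

noncomputable section

namespace EMV

/-! ### Bounds on `u` and its derivatives -/

/-- The closed strip `[0, 3/4] × ℝ`, as a subset of `ℝ × ℝ`. -/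
def strip : Set (ℝ × ℝ) := Icc (0 : ℝ) (3 / 4) ×ˢ univ

lemma mem_strip {p : ℝ × ℝ} : p ∈ strip ↔ p.1 ∈ Icc (0 : ℝ) (3 / 4) := by
  simp [strip]

lemma convex_strip : Convex ℝ strip := (convex_Icc _ _).prod convex_univ

lemma uniqueDiffOn_strip : UniqueDiffOn ℝ strip :=
  (uniqueDiffOn_Icc (by norm_num)).prod uniqueDiffOn_univ

open scoped Pointwise in
lemma vadd_strip : ((0, 1) : ℝ × ℝ) +ᵥ strip = strip := by
  ext ⟨x, y⟩
  rw [Set.mem_vadd_set]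
  constructor
  · rintro ⟨⟨a, b⟩, h, h'⟩
    rw [mem_strip] at h ⊢
    simp only [vadd_eq_add, Prod.mk_add_mk, zero_add, Prod.mk.injEq] at h'
    rw [← h'.1]; exact h
  · intro h
    exact ⟨(x, y - 1), mem_strip.2 (mem_strip.1 h), by simp⟩

lemma strip_mem_nhds {x : ℝ} (hx : x ∈ Ioo (0 : ℝ) (3 / 4)) (θ : ℝ) : strip ∈ 𝓝 (x, θ) :=
  prod_mem_nhds (Icc_mem_nhds hx.1 hx.2) univ_mem

/-- The derivative of a function on the strip that is periodic in the angle is periodic too. -/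
lemma fderivWithin_strip_periodic {E : Type*} [NormedAddCommGroup E] [NormedSpace ℝ E]
    {g : ℝ × ℝ → E} (hp : ∀ p ∈ strip, g (p + (0, 1)) = g p) {p : ℝ × ℝ} (h : p ∈ strip) :
    fderivWithin ℝ g strip (p + (0, 1)) = fderivWithin ℝ g strip p := by
  have h1 := fderivWithin_comp_add_right (𝕜 := ℝ) (f := g) (s := strip) (x := p) (0, 1)
  rw [vadd_strip] at h1
  rw [← h1]
  exact fderivWithin_congr hp (hp p h)

/-- A continuous function on the strip that is periodic in the angle is bounded. -/
lemma exists_bound_of_periodic {E : Type*} [NormedAddCommGroup E] {g : ℝ × ℝ → E}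
    (hg : ContinuousOn g strip) (hp : ∀ p ∈ strip, g (p + (0, 1)) = g p) :
    ∃ K, ∀ p ∈ strip, ‖g p‖ ≤ K := by
  have hc : IsCompact (Icc (0 : ℝ) (3 / 4) ×ˢ Icc (0 : ℝ) 1) := isCompact_Icc.prod isCompact_Icc
  obtain ⟨K, hK⟩ := hc.exists_bound_of_continuousOn
    (hg.mono (prod_mono le_rfl (subset_univ _)))
  refine ⟨K, fun p h => ?_⟩
  have hper : Function.Periodic (fun t => g (p.1, t)) 1 := by
    intro t
    have := hp (p.1, t) (mem_strip.2 (mem_strip.1 h))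
    simpa using this
  have h2 := hper.sub_zsmul_eq ⌊p.2⌋ (x := p.2)
  simp only [zsmul_eq_mul, mul_one] at h2
  have h3 : g p = g (p.1, Int.fract p.2) := by rw [Int.fract, h2]
  rw [h3]
  exact hK _ ⟨mem_strip.1 h, Int.fract_nonneg _, (Int.fract_lt_one _).le⟩

lemma exists_lipschitz_of_periodic {E : Type*} [NormedAddCommGroup E] [NormedSpace ℝ E]
    {g : ℝ × ℝ → E} (hg : ContDiffOn ℝ 1 g strip) (hp : ∀ p ∈ strip, g (p + (0, 1)) = g p) :
    ∃ K, 0 ≤ K ∧ ∀ p ∈ strip, ‖g p‖ ≤ K ∧ ∀ q ∈ strip, ‖g p - g q‖ ≤ K * ‖p - q‖ := by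
  obtain ⟨K₁, h₁⟩ := exists_bound_of_periodic hg.continuousOn hp
  obtain ⟨K₂, h₂⟩ := exists_bound_of_periodic
    (hg.continuousOn_fderivWithin uniqueDiffOn_strip le_rfl)
    (fun p h => fderivWithin_strip_periodic hp h)
  refine ⟨max K₁ (max K₂ 0), by simp, fun p h => ⟨(h₁ p h).trans (le_max_left _ _), fun q hq => ?_⟩⟩
  refine ((convex_strip.norm_image_sub_le_of_norm_fderivWithin_le
    (hg.differentiableOn one_ne_zero) h₂ hq h)).trans ?_
  gcongr
  exact (le_max_left _ _).trans (le_max_right _ _)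

/-- The partial derivative `∂ₓ u`. -/
def ux (u : ℝ → ℝ → ℝ) (x θ : ℝ) : ℝ :=
  fderivWithin ℝ (fun p : ℝ × ℝ => u p.1 p.2) strip (x, θ) (1, 0)

/-- The partial derivative `∂_θ u`. -/
def uθ (u : ℝ → ℝ → ℝ) (x θ : ℝ) : ℝ :=
  fderivWithin ℝ (fun p : ℝ × ℝ => u p.1 p.2) strip (x, θ) (0, 1)

/-- The partial derivative `∂ₓ f₁` on the left strip, for `x > 0`. -/
def dx (γ : ℝ) (u : ℝ → ℝ → ℝ) (x θ : ℝ) : ℝ :=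
  1 + (1 + γ) * (x ^ γ * u x θ) + x ^ γ * x * ux u x θ

/-- The partial derivative `∂_θ f₁` on the left strip, for `x > 0`. -/
def dθ (γ : ℝ) (u : ℝ → ℝ → ℝ) (x θ : ℝ) : ℝ := x ^ γ * x * uθ u x θ

/-- Constants `0 < c` and `K ≥ 1` with `c ≤ u ≤ K`, such that `K` bounds `∂ₓ u` and is a Lipschitz
constant of `u` and of `∂ₓ u`. -/
structure Bounds (u : ℝ → ℝ → ℝ) (c K : ℝ) : Prop where
  c_pos : 0 < c
  one_le : 1 ≤ K
  le_u : ∀ x ∈ Icc (0 : ℝ) (3 / 4), ∀ θ, c ≤ u x θ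
  u_le : ∀ x ∈ Icc (0 : ℝ) (3 / 4), ∀ θ, u x θ ≤ K
  abs_ux_le : ∀ x ∈ Icc (0 : ℝ) (3 / 4), ∀ θ, |ux u x θ| ≤ K
  u_lip : ∀ x ∈ Icc (0 : ℝ) (3 / 4), ∀ x' ∈ Icc (0 : ℝ) (3 / 4), ∀ θ θ',
    |u x θ - u x' θ'| ≤ K * (|x - x'| + |θ - θ'|)
  ux_lip : ∀ x ∈ Icc (0 : ℝ) (3 / 4), ∀ x' ∈ Icc (0 : ℝ) (3 / 4), ∀ θ θ',
    |ux u x θ - ux u x' θ'| ≤ K * (|x - x'| + |θ - θ'|)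

lemma norm_prod_le (p : ℝ × ℝ) : ‖p‖ ≤ |p.1| + |p.2| := by
  rw [Prod.norm_def, Real.norm_eq_abs, Real.norm_eq_abs]
  exact max_le (by linarith [abs_nonneg p.2]) (by linarith [abs_nonneg p.1])

variable {γ : ℝ} {u : ℝ → ℝ → ℝ}

lemma IsAdmissible.exists_bounds (hu : IsAdmissible γ u) : ∃ c K, Bounds u c K := by
  have hper : ∀ p ∈ strip, (fun p : ℝ × ℝ => u p.1 p.2) (p + (0, 1))
      = (fun p : ℝ × ℝ => u p.1 p.2) p := by
    intro p h
    simpa using hu.periodic p.1 (mem_strip.1 h) p.2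
  have hcd : ContDiffOn ℝ 2 (fun p : ℝ × ℝ => u p.1 p.2) strip := hu.contDiffOn
  obtain ⟨K₁, hK₁, h₁⟩ := exists_lipschitz_of_periodic (hcd.of_le one_le_two) hper
  obtain ⟨K₂, hK₂, h₂⟩ := exists_lipschitz_of_periodic
    (hcd.fderivWithin (m := 1) uniqueDiffOn_strip (by norm_num))
    (fun p h => fderivWithin_strip_periodic hper h)
  have hinv : ∃ K, ∀ p ∈ strip, ‖(u p.1 p.2)⁻¹‖ ≤ K := by
    refine exists_bound_of_periodic (g := fun p => (u p.1 p.2)⁻¹)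
      (hcd.continuousOn.inv₀ fun p h => (hu.pos _ (mem_strip.1 h) _).ne') ?_
    intro p h
    have := hper p h
    simp only at this
    simp only [this]
  obtain ⟨K₃, h₃⟩ := hinv
  have e1 : ‖((1, 0) : ℝ × ℝ)‖ = 1 := by simp
  have ms : ∀ {x : ℝ}, x ∈ Icc (0 : ℝ) (3 / 4) → ∀ θ, ((x, θ) : ℝ × ℝ) ∈ strip :=
    fun hx θ => mem_strip.2 hx
  refine ⟨(max K₃ 1)⁻¹, max 1 (max K₁ K₂), by positivity, by simp, ?_, ?_, ?_, ?_, ?_⟩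
  · intro x hx θ
    have hp := hu.pos x hx θ
    have h := h₃ (x, θ) (ms hx θ)
    rw [Real.norm_of_nonneg (by positivity)] at h
    exact inv_le_of_inv_le₀ hp (h.trans (le_max_left _ _))
  · intro x hx θ
    have := (h₁ (x, θ) (ms hx θ)).1
    exact (le_abs_self _).trans (this.trans (by simp))
  · intro x hx θ
    have := (h₂ (x, θ) (ms hx θ)).1
    have h4 := (fderivWithin ℝ (fun p : ℝ × ℝ => u p.1 p.2) strip (x, θ)).le_opNorm (1, 0)
    rw [e1, mul_one] at h4
    exact h4.trans (this.trans (by simp))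
  · intro x hx x' hx' θ θ'
    refine ((h₁ (x, θ) (ms hx θ)).2 (x', θ') (ms hx' θ')).trans ?_
    gcongr
    · simp
    · exact norm_prod_le ((x, θ) - (x', θ'))
  · intro x hx x' hx' θ θ'
    have := (h₂ (x, θ) (ms hx θ)).2 (x', θ') (ms hx' θ')
    have h4 : |ux u x θ - ux u x' θ'| ≤ ‖fderivWithin ℝ (fun p : ℝ × ℝ => u p.1 p.2) strip (x, θ)
        - fderivWithin ℝ (fun p : ℝ × ℝ => u p.1 p.2) strip (x', θ')‖ := by
      have := ContinuousLinearMap.le_opNorm (fderivWithin ℝ (fun p : ℝ × ℝ => u p.1 p.2) strip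
        (x, θ) - fderivWithin ℝ (fun p : ℝ × ℝ => u p.1 p.2) strip (x', θ')) (1, 0)
      rw [e1, mul_one] at this
      exact this
    refine (h4.trans this).trans ?_
    gcongr
    · simp
    · exact norm_prod_le ((x, θ) - (x', θ'))

/-! ### The left branch and its derivative -/

lemma hasFDerivAt_leftFst (hu : IsAdmissible γ u) {x : ℝ} (hx : x ∈ Ioo (0 : ℝ) (3 / 4)) (θ : ℝ) :
    HasFDerivAt (fun p : ℝ × ℝ => leftFst γ u p.1 p.2)
      (dx γ u x θ • ContinuousLinearMap.fst ℝ ℝ ℝ + dθ γ u x θ • ContinuousLinearMap.snd ℝ ℝ ℝ)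
      (x, θ) := by
  have hcd : ContDiffOn ℝ 2 (fun p : ℝ × ℝ => u p.1 p.2) strip := hu.contDiffOn
  have hU : HasFDerivAt (fun p : ℝ × ℝ => u p.1 p.2)
      (fderivWithin ℝ (fun p : ℝ × ℝ => u p.1 p.2) strip (x, θ)) (x, θ) :=
    ((hcd.differentiableOn two_ne_zero) (x, θ)
      (mem_of_mem_nhds (strip_mem_nhds hx θ))).hasFDerivWithinAt.hasFDerivAt (strip_mem_nhds hx θ)
  have hpow : HasFDerivAt (fun p : ℝ × ℝ => p.1 ^ γ)
      ((γ * x ^ (γ - 1)) • ContinuousLinearMap.fst ℝ ℝ ℝ) (x, θ) := by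
    have h := (Real.hasDerivAt_rpow_const (x := x) (p := γ) (Or.inl hx.1.ne')).comp_hasFDerivAt
      (x, θ) (hasFDerivAt_fst (𝕜 := ℝ) (E := ℝ) (F := ℝ) (p := (x, θ)))
    exact h
  have h := (hasFDerivAt_fst (𝕜 := ℝ) (E := ℝ) (F := ℝ) (p := (x, θ))).mul
    ((hpow.mul hU).const_add 1)
  refine h.congr_fderiv ?_
  have hdec : ∀ v : ℝ × ℝ, fderivWithin ℝ (fun p : ℝ × ℝ => u p.1 p.2) strip (x, θ) v
      = v.1 * ux u x θ + v.2 * uθ u x θ := by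
    intro v
    have : v = v.1 • ((1, 0) : ℝ × ℝ) + v.2 • ((0, 1) : ℝ × ℝ) := by ext <;> simp
    conv_lhs => rw [this]
    rw [map_add, map_smul, map_smul]
    rfl
  have hx0 : x * x ^ (γ - 1) = x ^ γ := by
    rw [Real.rpow_sub_one hx.1.ne']; field_simp [hx.1.ne']
  ext
  · simp [hdec, dx]
    linear_combination (γ * u x θ) * hx0
  · simp [hdec, dθ]
    ring

lemma contDiffAt_leftFst (hu : IsAdmissible γ u) {x : ℝ} (hx : x ∈ Ioo (0 : ℝ) (3 / 4)) (θ : ℝ) :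
    ContDiffAt ℝ 1 (fun p : ℝ × ℝ => leftFst γ u p.1 p.2) (x, θ) := by
  have hcd : ContDiffAt ℝ 1 (fun p : ℝ × ℝ => u p.1 p.2) (x, θ) :=
    (hu.contDiffOn.contDiffAt (strip_mem_nhds hx θ)).of_le one_le_two
  have hp : ContDiffAt ℝ 1 (fun p : ℝ × ℝ => p.1 ^ γ) (x, θ) :=
    contDiffAt_fst.rpow_const_of_ne hx.1.ne'
  exact contDiffAt_fst.mul (contDiffAt_const.add (hp.mul hcd))

lemma hasDerivAt_leftFst (hu : IsAdmissible γ u) {x : ℝ} (hx : x ∈ Ioo (0 : ℝ) (3 / 4)) (θ : ℝ) :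
    HasDerivAt (fun s => leftFst γ u s θ) (dx γ u x θ) x := by
  have h1 : HasDerivAt (fun s : ℝ => ((s, θ) : ℝ × ℝ)) (1, 0) x :=
    (hasDerivAt_id x).prodMk (hasDerivAt_const x θ)
  have h := (hasFDerivAt_leftFst hu hx θ).comp_hasDerivAt x h1
  refine (h.congr_deriv ?_)
  simp

/-- The coordinate functions of the plane, as continuous linear maps. -/
def coord (i : Fin 2) : Plane →L[ℝ] ℝ := EuclideanSpace.proj i

@[simp] lemma coord_apply (i : Fin 2) (v : Plane) : coord i v = v i := rfl

/-- The derivative of the lifted left branch does not contract, in coordinates. -/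
lemma expanding_coord (hu : IsAdmissible γ u) {x : ℝ} (hx : x ∈ Ioo (0 : ℝ) (3 / 4)) (θ a b : ℝ) :
    a ^ 2 + b ^ 2 ≤ (dx γ u x θ * a + dθ γ u x θ * b) ^ 2 + 16 * b ^ 2 := by
  have hpair : HasFDerivAt (fun z : Plane => ((z 0, z 1) : ℝ × ℝ))
      ((coord 0).prod (coord 1)) !₂[x, θ] := ((coord 0).prod (coord 1)).hasFDerivAt
  have hfst := HasFDerivAt.comp (g := fun p : ℝ × ℝ => leftFst γ u p.1 p.2) !₂[x, θ]
    (hasFDerivAt_leftFst hu hx θ) hpair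
  have hnd : leftStrip ∈ 𝓝 (!₂[x, θ] : Plane) := by
    have hc : Continuous (fun z : Plane => z 0) := by fun_prop
    exact hc.continuousAt.preimage_mem_nhds (Icc_mem_nhds (by simpa using hx.1) (by simpa using hx.2))
  have hd0 : HasFDerivAt (leftLift γ u) (fderiv ℝ (leftLift γ u) !₂[x, θ]) !₂[x, θ] := by
    apply DifferentiableAt.hasFDerivAt
    rw [differentiableAt_euclidean]
    intro i
    fin_cases i
    · exact hfst.differentiableAt
    · change DifferentiableAt ℝ (fun z : Plane => 4 * z 1) _
      fun_prop
  have h0 : ∀ v : Plane, (fderiv ℝ (leftLift γ u) !₂[x, θ] v) 0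
      = dx γ u x θ * v 0 + dθ γ u x θ * v 1 := by
    intro v
    have h1 := (coord 0).hasFDerivAt.comp
      !₂[x, θ] hd0
    have h2 := h1.unique (f := fun z : Plane => leftFst γ u (z 0) (z 1)) hfst
    have h3 := congrArg (fun T => T v) h2
    simpa using h3
  have h1 : ∀ v : Plane, (fderiv ℝ (leftLift γ u) !₂[x, θ] v) 1 = 4 * v 1 := by
    intro v
    have h1 := (coord 1).hasFDerivAt.comp
      !₂[x, θ] hd0
    have h4 := ((coord 1).hasFDerivAt
      (x := !₂[x, θ])).const_mul (4 : ℝ)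
    have h2 := h1.unique (f := fun z : Plane => 4 * z 1) h4
    have h3 := congrArg (fun T => T v) h2
    simpa using h3
  have hexp := hu.expanding !₂[x, θ] (mem_of_mem_nhds hnd) !₂[a, b]
  rw [fderivWithin_of_mem_nhds hnd] at hexp
  have hsq := pow_le_pow_left₀ (norm_nonneg _) hexp 2
  rw [EuclideanSpace.norm_sq_eq, EuclideanSpace.norm_sq_eq] at hsq
  simp only [Fin.sum_univ_two, Real.norm_eq_abs, sq_abs, h0, h1] at hsq
  simp only [Fin.isValue, Matrix.cons_val_zero, Matrix.cons_val_one] at hsq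
  linarith

lemma leftFst_continuousOn (hu : IsAdmissible γ u) :
    ContinuousOn (fun p : ℝ × ℝ => leftFst γ u p.1 p.2) strip := by
  have hp : Continuous (fun p : ℝ × ℝ => p.1 ^ γ) :=
    continuous_fst.rpow_const fun _ => Or.inr hu.gamma_pos.le
  exact continuousOn_fst.mul
    (continuousOn_const.add (hp.continuousOn.mul hu.contDiffOn.continuousOn))

lemma leftFst_continuousOn_left (hu : IsAdmissible γ u) (θ : ℝ) :
    ContinuousOn (fun x => leftFst γ u x θ) (Icc 0 (3 / 4)) :=
  (leftFst_continuousOn hu).comp (f := fun x : ℝ => (x, θ)) (by fun_prop)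
    fun _ hx => mem_strip.2 hx

lemma rpow_le_one_of_mem (hγ : 0 < γ) {x : ℝ} (hx : x ∈ Icc (0 : ℝ) (3 / 4)) : x ^ γ ≤ 1 :=
  Real.rpow_le_one hx.1 (hx.2.trans (by norm_num)) hγ.le

lemma dx_continuousOn (hu : IsAdmissible γ u) (θ : ℝ) :
    ContinuousOn (fun x => dx γ u x θ) (Icc 0 (3 / 4)) := by
  obtain ⟨c, K, hb⟩ := hu.exists_bounds
  have hp : Continuous (fun x : ℝ => x ^ γ) :=
    continuous_id.rpow_const fun _ => Or.inr hu.gamma_pos.le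
  have h1 : ContinuousOn (fun x => u x θ) (Icc 0 (3 / 4)) := by
    refine LipschitzOnWith.continuousOn (K := K.toNNReal) (LipschitzOnWith.of_dist_le_mul ?_)
    intro x hx y hy
    have := hb.u_lip x hx y hy θ θ
    rw [Real.coe_toNNReal _ (by linarith [hb.one_le]), Real.dist_eq, Real.dist_eq]
    simpa using this
  have h2 : ContinuousOn (fun x => ux u x θ) (Icc 0 (3 / 4)) := by
    refine LipschitzOnWith.continuousOn (K := K.toNNReal) (LipschitzOnWith.of_dist_le_mul ?_)
    intro x hx y hy
    have := hb.ux_lip x hx y hy θ θ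
    rw [Real.coe_toNNReal _ (by linarith [hb.one_le]), Real.dist_eq, Real.dist_eq]
    simpa using this
  unfold dx
  fun_prop

/-- The left branch is increasing in `x`: its partial derivative has modulus at least `1`, is
continuous, and equals `1` at `x = 0`. -/
lemma one_le_dx (hu : IsAdmissible γ u) {x : ℝ} (hx : x ∈ Ioo (0 : ℝ) (3 / 4)) (θ : ℝ) :
    1 ≤ dx γ u x θ := by
  have hsq : ∀ y ∈ Ioo (0 : ℝ) (3 / 4), 1 ≤ dx γ u y θ ^ 2 := by
    intro y hy
    have := expanding_coord hu hy θ 1 0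
    simpa using this
  by_contra! h
  have hneg : dx γ u x θ ≤ 0 := by nlinarith [hsq x hx]
  have h0 : dx γ u 0 θ = 1 := by simp [dx, Real.zero_rpow hu.gamma_pos.ne']
  have hiv := intermediate_value_Icc' hx.1.le
    ((dx_continuousOn hu θ).mono (Icc_subset_Icc_right hx.2.le))
  obtain ⟨y, hy, hy0⟩ := hiv ⟨hneg, by rw [h0]; norm_num⟩
  simp only at hy0
  have hy1 : 0 < y := by
    rcases hy.1.eq_or_lt with h | h
    · rw [← h, h0] at hy0; norm_num at hy0
    · exact h
  have := hsq y ⟨hy1, hy.2.trans_lt hx.2⟩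
  rw [hy0] at this
  norm_num at this

lemma dx_le {c K : ℝ} (hu : IsAdmissible γ u) (hb : Bounds u c K) {x : ℝ}
    (hx : x ∈ Icc (0 : ℝ) (3 / 4)) (θ : ℝ) : dx γ u x θ ≤ 1 + (2 + γ) * K := by
  have h1 := rpow_le_one_of_mem hu.gamma_pos hx
  have h0 := Real.rpow_nonneg hx.1 γ
  have h2 := hb.u_le x hx θ
  have h3 := hb.abs_ux_le x hx θ
  have h4 := hu.pos x hx θ
  have h5 : x ^ γ * u x θ ≤ K := by nlinarith
  have h6 : x ^ γ * x * ux u x θ ≤ K := by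
    have : x ^ γ * x ≤ 1 := by nlinarith [hx.1, hx.2]
    have h7 : 0 ≤ x ^ γ * x := mul_nonneg h0 hx.1
    nlinarith [le_abs_self (ux u x θ), hb.one_le]
  unfold dx
  nlinarith [hu.gamma_pos]

lemma sub_le_leftFst_sub (hu : IsAdmissible γ u) {x x' : ℝ} (hx : x ∈ Icc (0 : ℝ) (3 / 4))
    (hx' : x' ∈ Icc (0 : ℝ) (3 / 4)) (h : x ≤ x') (θ : ℝ) :
    x' - x ≤ leftFst γ u x' θ - leftFst γ u x θ := by
  have hmono : MonotoneOn (fun s => leftFst γ u s θ - s) (Icc 0 (3 / 4)) := by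
    refine monotoneOn_of_hasDerivWithinAt_nonneg (f' := fun s => dx γ u s θ - 1) (convex_Icc _ _)
      ((leftFst_continuousOn_left hu θ).sub continuousOn_id) ?_ ?_
    · intro s hs
      rw [interior_Icc] at hs
      exact ((hasDerivAt_leftFst hu hs θ).sub (hasDerivAt_id s)).hasDerivWithinAt
    · intro s hs
      rw [interior_Icc] at hs
      linarith [one_le_dx hu hs θ]
  have := hmono hx hx' h
  simp only at this
  linarith

lemma leftFst_sub_le {c K : ℝ} (hu : IsAdmissible γ u) (hb : Bounds u c K) {x x' : ℝ}
    (hx : x ∈ Icc (0 : ℝ) (3 / 4)) (hx' : x' ∈ Icc (0 : ℝ) (3 / 4)) (h : x ≤ x') (θ : ℝ) :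
    leftFst γ u x' θ - leftFst γ u x θ ≤ (1 + (2 + γ) * K) * (x' - x) := by
  have hmono : MonotoneOn (fun s => (1 + (2 + γ) * K) * s - leftFst γ u s θ) (Icc 0 (3 / 4)) := by
    refine monotoneOn_of_hasDerivWithinAt_nonneg
      (f' := fun s => (1 + (2 + γ) * K) * 1 - dx γ u s θ) (convex_Icc _ _)
      ((continuousOn_const.mul continuousOn_id).sub (leftFst_continuousOn_left hu θ)) ?_ ?_
    · intro s hs
      rw [interior_Icc] at hs
      exact (((hasDerivAt_id s).const_mul _).sub (hasDerivAt_leftFst hu hs θ)).hasDerivWithinAt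
    · intro s hs
      rw [interior_Icc] at hs
      linarith [dx_le hu hb (Ioo_subset_Icc_self hs) θ]
  have := hmono hx hx' h
  simp only at this
  linarith

/-- The lifted left branch does not contract distances on the whole strip.  Its second component
is linear, so the scalar mean value theorem along the segment between two points writes the
increment of the map as its derivative at a *single* intermediate point. -/
lemma leftLift_expanding (hu : IsAdmissible γ u) {x x' : ℝ} (hx : x ∈ Icc (0 : ℝ) (3 / 4))
    (hx' : x' ∈ Icc (0 : ℝ) (3 / 4)) (θ θ' : ℝ) :
    (x' - x) ^ 2 + (θ' - θ) ^ 2 ≤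
      (leftFst γ u x' θ' - leftFst γ u x θ) ^ 2 + (4 * θ' - 4 * θ) ^ 2 := by
  rcases eq_or_ne x x' with rfl | hne
  · nlinarith [sq_nonneg (leftFst γ u x θ' - leftFst γ u x θ), sq_nonneg (θ' - θ)]
  have hmem : ∀ s ∈ Ioo (0 : ℝ) 1, x + s * (x' - x) ∈ Ioo (0 : ℝ) (3 / 4) := by
    intro s hs
    obtain ⟨h0, h1⟩ := hs
    obtain ⟨a, b⟩ := hx
    obtain ⟨a', b'⟩ := hx'
    rcases lt_or_gt_of_ne hne with h | h
    · constructor <;> nlinarith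
    · constructor <;> nlinarith
  have hline : ∀ s : ℝ, HasDerivAt (fun s : ℝ => ((x + s * (x' - x), θ + s * (θ' - θ)) : ℝ × ℝ))
      (x' - x, θ' - θ) s := by
    intro s
    refine HasDerivAt.prodMk ?_ ?_
    · simpa using ((hasDerivAt_id s).mul_const (x' - x)).const_add x
    · simpa using ((hasDerivAt_id s).mul_const (θ' - θ)).const_add θ
  obtain ⟨s, hs, hslope⟩ := exists_hasDerivAt_eq_slope
    (fun s => leftFst γ u (x + s * (x' - x)) (θ + s * (θ' - θ)))
    (fun s => dx γ u (x + s * (x' - x)) (θ + s * (θ' - θ)) * (x' - x)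
      + dθ γ u (x + s * (x' - x)) (θ + s * (θ' - θ)) * (θ' - θ)) zero_lt_one
    ((leftFst_continuousOn hu).comp (f := fun s : ℝ => (x + s * (x' - x), θ + s * (θ' - θ)))
      (by fun_prop) (fun s hs => mem_strip.2 (by
        obtain ⟨h0, h1⟩ := hs
        obtain ⟨a, b⟩ := hx
        obtain ⟨a', b'⟩ := hx'
        constructor <;> simp only <;> nlinarith)))
    (fun s hs => by
      have := (hasFDerivAt_leftFst hu (hmem s hs) (θ + s * (θ' - θ))).comp_hasDerivAt s (hline s)
      refine this.congr_deriv ?_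
      simp)
  have := expanding_coord hu (hmem s hs) (θ + s * (θ' - θ)) (x' - x) (θ' - θ)
  simp only [one_mul, zero_mul, add_zero, sub_zero, div_one] at hslope
  rw [hslope] at this
  simp only [add_sub_cancel] at this
  linarith

/-! ### The extended left branch and the lifted orbit -/

/-- The point of `[0, 3/4]` closest to `x`. -/
def clamp (x : ℝ) : ℝ := max 0 (min x (3 / 4))

lemma clamp_mem (x : ℝ) : clamp x ∈ Icc (0 : ℝ) (3 / 4) :=
  ⟨le_max_left _ _, max_le (by norm_num) (min_le_right _ _)⟩

lemma clamp_of_mem {x : ℝ} (hx : x ∈ Icc (0 : ℝ) (3 / 4)) : clamp x = x := by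
  rw [clamp, min_eq_left hx.2, max_eq_right hx.1]

lemma clamp_of_le {x : ℝ} (hx : 3 / 4 ≤ x) : clamp x = 3 / 4 := by
  rw [clamp, min_eq_right hx]; norm_num

lemma clamp_mono : Monotone clamp := fun _ _ h => max_le_max le_rfl (min_le_min_right _ h)

lemma clamp_sub_le {x x' : ℝ} (h : x ≤ x') : clamp x' - clamp x ≤ x' - x := by
  simp only [clamp, max_def, min_def]
  split_ifs <;> linarith

lemma continuous_clamp : Continuous clamp := by unfold clamp; fun_prop

/-- The left branch, extended to all `x` with slope one outside `[0, 3/4]`.  The extension is a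
convenience: it is continuous and increasing in `x`, and only its values on `[0, 3/4]` describe
`f`. -/
def ext (γ : ℝ) (u : ℝ → ℝ → ℝ) (x θ : ℝ) : ℝ := leftFst γ u (clamp x) θ + (x - clamp x)

lemma ext_of_mem {x : ℝ} (hx : x ∈ Icc (0 : ℝ) (3 / 4)) (θ : ℝ) :
    ext γ u x θ = leftFst γ u x θ := by
  rw [ext, clamp_of_mem hx]; ring

lemma ext_zero (θ : ℝ) : ext γ u 0 θ = 0 := by
  rw [ext_of_mem ⟨le_rfl, by norm_num⟩]; simp [leftFst]

lemma continuous_ext (hu : IsAdmissible γ u) :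
    Continuous (fun p : ℝ × ℝ => ext γ u p.1 p.2) := by
  have h : Continuous (fun p : ℝ × ℝ => leftFst γ u (clamp p.1) p.2) :=
    (leftFst_continuousOn hu).comp_continuous (f := fun p : ℝ × ℝ => (clamp p.1, p.2))
      ((continuous_clamp.comp continuous_fst).prodMk continuous_snd)
      (fun p => mem_strip.2 (clamp_mem p.1))
  exact h.add (continuous_fst.sub (continuous_clamp.comp continuous_fst))

lemma sub_le_ext_sub (hu : IsAdmissible γ u) {x x' : ℝ} (h : x ≤ x') (θ : ℝ) :
    x' - x ≤ ext γ u x' θ - ext γ u x θ := by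
  have := sub_le_leftFst_sub hu (clamp_mem x) (clamp_mem x') (clamp_mono h) θ
  unfold ext
  linarith

lemma ext_mono (hu : IsAdmissible γ u) {x x' : ℝ} (h : x ≤ x') (θ : ℝ) :
    ext γ u x θ ≤ ext γ u x' θ := by
  linarith [sub_le_ext_sub hu h θ]

lemma ext_sub_le {c K : ℝ} (hu : IsAdmissible γ u) (hb : Bounds u c K) {x x' : ℝ} (h : x ≤ x')
    (θ : ℝ) : ext γ u x' θ - ext γ u x θ ≤ (1 + (2 + γ) * K) * (x' - x) := by
  have h1 := leftFst_sub_le hu hb (clamp_mem x) (clamp_mem x') (clamp_mono h) θ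
  have h2 := clamp_sub_le h
  have h3 : 0 ≤ (2 + γ) * K := by have := hu.gamma_pos; have := hb.one_le; positivity
  unfold ext
  nlinarith

lemma le_leftFst {c K : ℝ} (hb : Bounds u c K) {x : ℝ} (hx : x ∈ Icc (0 : ℝ) (3 / 4)) (θ : ℝ) :
    x + c * (x ^ γ * x) ≤ leftFst γ u x θ := by
  have h1 := mul_nonneg (Real.rpow_nonneg hx.1 γ) hx.1
  have h2 := hb.le_u x hx θ
  unfold leftFst
  nlinarith

lemma leftFst_le {c K : ℝ} (hu : IsAdmissible γ u) (hb : Bounds u c K) {x : ℝ}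
    (hx : x ∈ Icc (0 : ℝ) (3 / 4)) (θ : ℝ) : leftFst γ u x θ ≤ (1 + K) * x := by
  have h1 := rpow_le_one_of_mem hu.gamma_pos hx
  have h0 := Real.rpow_nonneg hx.1 γ
  have h2 := hb.u_le x hx θ
  have h4 := hu.pos x hx θ
  have h5 : x ^ γ * u x θ ≤ K := by nlinarith
  unfold leftFst
  nlinarith [hx.1]

lemma lt_ext_of_le (hu : IsAdmissible γ u) {x : ℝ} (hx : 3 / 4 ≤ x) (θ : ℝ) :
    15 / 16 + (x - 3 / 4) < ext γ u x θ := by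
  rw [ext, clamp_of_le hx]
  linarith [hu.image_large θ]

lemma le_ext (hu : IsAdmissible γ u) {x : ℝ} (hx : 0 ≤ x) (θ : ℝ) : x ≤ ext γ u x θ := by
  have := sub_le_ext_sub hu hx θ
  rw [ext_zero] at this
  linarith

/-- Each step of the extended branch moves a point of `[r, 3/4]` to the right by a definite
amount. -/
lemma add_le_ext {c K : ℝ} (hu : IsAdmissible γ u) (hb : Bounds u c K) {r x : ℝ} (hr : 0 ≤ r)
    (hrx : r ≤ x) (hx : x ≤ 3 / 4) (θ : ℝ) : x + c * (r ^ γ * r) ≤ ext γ u x θ := by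
  have hm : x ∈ Icc (0 : ℝ) (3 / 4) := ⟨hr.trans hrx, hx⟩
  rw [ext_of_mem hm]
  refine le_trans ?_ (le_leftFst hb hm θ)
  have h1 : r ^ γ ≤ x ^ γ := Real.rpow_le_rpow hr hrx hu.gamma_pos.le
  have h2 : r ^ γ * r ≤ x ^ γ * x :=
    mul_le_mul h1 hrx hr (Real.rpow_nonneg hm.1 γ)
  nlinarith [hb.c_pos]

/-- The first coordinates of the orbit that starts at `(y, θ)`, with `y > 3/4`: `orb k y θ` is the
first coordinate of `f^(k+1) (y, θ)` as long as the orbit has not returned before. -/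
def orb (γ : ℝ) (u : ℝ → ℝ → ℝ) : ℕ → ℝ → ℝ → ℝ
  | 0, y, _ => 4 * y - 3
  | k + 1, y, θ => ext γ u (orb γ u k y θ) (4 ^ (k + 1) * θ)

lemma orb_succ (k : ℕ) (y θ : ℝ) :
    orb γ u (k + 1) y θ = ext γ u (orb γ u k y θ) (4 ^ (k + 1) * θ) := rfl

lemma continuous_orb (hu : IsAdmissible γ u) (k : ℕ) :
    Continuous (fun p : ℝ × ℝ => orb γ u k p.1 p.2) := by
  induction k with
  | zero => simp only [orb]; fun_prop
  | succ k ih =>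
    exact (continuous_ext hu).comp (f := fun p : ℝ × ℝ => (orb γ u k p.1 p.2, 4 ^ (k + 1) * p.2))
      (ih.prodMk (by fun_prop))

lemma continuous_orb_plane (hu : IsAdmissible γ u) (k : ℕ) :
    Continuous (fun w : Plane => orb γ u k (w 0) (w 1)) :=
  (continuous_orb hu k).comp (f := fun w : Plane => (w 0, w 1)) (by fun_prop)

lemma le_orb_sub (hu : IsAdmissible γ u) (k : ℕ) {y y' : ℝ} (h : y ≤ y') (θ : ℝ) :
    4 * (y' - y) ≤ orb γ u k y' θ - orb γ u k y θ := by
  induction k with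
  | zero => simp only [orb]; linarith
  | succ k ih =>
    have h1 : orb γ u k y θ ≤ orb γ u k y' θ := by linarith
    have := sub_le_ext_sub hu h1 (4 ^ (k + 1) * θ)
    rw [orb_succ, orb_succ]
    linarith

lemma orb_strictMono (hu : IsAdmissible γ u) (k : ℕ) (θ : ℝ) :
    StrictMono (fun y => orb γ u k y θ) := fun y y' h => by
  have := le_orb_sub hu k h.le θ
  simp only
  linarith

lemma orb_sub_le {c K : ℝ} (hu : IsAdmissible γ u) (hb : Bounds u c K) (k : ℕ) {y y' : ℝ}
    (h : y ≤ y') (θ : ℝ) :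
    orb γ u k y' θ - orb γ u k y θ ≤ 4 * (1 + (2 + γ) * K) ^ k * (y' - y) := by
  induction k with
  | zero => simp only [orb]; linarith
  | succ k ih =>
    have h1 : orb γ u k y θ ≤ orb γ u k y' θ := (orb_strictMono hu k θ).monotone h
    have h2 := ext_sub_le hu hb h1 (4 ^ (k + 1) * θ)
    have h3 : 0 ≤ (2 + γ) * K := by have := hu.gamma_pos; have := hb.one_le; positivity
    rw [orb_succ, orb_succ]
    refine h2.trans ?_
    rw [pow_succ]
    nlinarith

lemma orb_three_quarters (k : ℕ) (θ : ℝ) : orb γ u k (3 / 4) θ = 0 := by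
  induction k with
  | zero => simp only [orb]; norm_num
  | succ k ih => rw [orb_succ, ih, ext_zero]

lemma orb_pos_iff (hu : IsAdmissible γ u) (k : ℕ) {y θ : ℝ} :
    0 < orb γ u k y θ ↔ 3 / 4 < y := by
  rw [← orb_three_quarters (γ := γ) (u := u) k θ]
  exact (orb_strictMono hu k θ).lt_iff_lt

lemma orb_mono (hu : IsAdmissible γ u) {y : ℝ} (hy : 3 / 4 ≤ y) (θ : ℝ) :
    Monotone (fun k => orb γ u k y θ) := by
  refine monotone_nat_of_le_succ fun k => ?_
  have : 0 ≤ orb γ u k y θ := by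
    rw [← orb_three_quarters (γ := γ) (u := u) k θ]
    exact (orb_strictMono hu k θ).monotone hy
  exact le_ext hu this _

lemma lt_orb_of_lt (hu : IsAdmissible γ u) {y θ : ℝ} {i k : ℕ} (hik : i < k)
    (h : 3 / 4 ≤ orb γ u i y θ) : 15 / 16 < orb γ u k y θ := by
  have hy : 3 / 4 < y := (orb_pos_iff hu i).1 (by linarith)
  have h1 : orb γ u (i + 1) y θ ≤ orb γ u k y θ := orb_mono hu hy.le θ hik
  have := lt_ext_of_le hu h (4 ^ (i + 1) * θ)
  rw [orb_succ] at h1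
  linarith

lemma exists_orb_eq (hu : IsAdmissible γ u) (k : ℕ) (θ : ℝ) {v : ℝ} (hv : 0 ≤ v) :
    ∃ y ∈ Icc (3 / 4 : ℝ) (3 / 4 + v / 4), orb γ u k y θ = v := by
  have hc : Continuous (fun y => orb γ u k y θ) :=
    (continuous_orb hu k).comp (f := fun y : ℝ => (y, θ)) (by fun_prop)
  have h := intermediate_value_Icc (a := 3 / 4) (b := 3 / 4 + v / 4)
    (f := fun y => orb γ u k y θ) (by linarith) hc.continuousOn
  have h1 := le_orb_sub hu k (y := 3 / 4) (y' := 3 / 4 + v / 4) (by linarith) θ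
  rw [orb_three_quarters] at h1
  obtain ⟨y, hy, hyv⟩ := h ⟨by simp only [orb_three_quarters]; exact hv, by linarith⟩
  exact ⟨y, hy, hyv⟩

/-- Two lifted orbits that stay in the strip up to time `k` separate monotonically. -/
lemma orb_expanding (hu : IsAdmissible γ u) {y θ y' θ' : ℝ} {i k : ℕ} (hik : i ≤ k)
    (h : ∀ l < k, orb γ u l y θ ∈ Icc (0 : ℝ) (3 / 4))
    (h' : ∀ l < k, orb γ u l y' θ' ∈ Icc (0 : ℝ) (3 / 4)) :
    (orb γ u i y' θ' - orb γ u i y θ) ^ 2 + (4 ^ (i + 1) * θ' - 4 ^ (i + 1) * θ) ^ 2 ≤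
      (orb γ u k y' θ' - orb γ u k y θ) ^ 2 + (4 ^ (k + 1) * θ' - 4 ^ (k + 1) * θ) ^ 2 := by
  induction k, hik using Nat.le_induction with
  | base => exact le_rfl
  | succ k hik ih =>
    refine (ih (fun l hl => h l (by omega)) (fun l hl => h' l (by omega))).trans ?_
    have := leftLift_expanding hu (h k (by omega)) (h' k (by omega)) (4 ^ (k + 1) * θ)
      (4 ^ (k + 1) * θ')
    rw [orb_succ, orb_succ, ext_of_mem (h k (by omega)), ext_of_mem (h' k (by omega))]
    refine this.trans (le_of_eq ?_)
    ring

lemma contDiffAt_orb (hu : IsAdmissible γ u) {y θ : ℝ} {k : ℕ}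
    (h : ∀ l < k, orb γ u l y θ ∈ Ioo (0 : ℝ) (3 / 4)) :
    ContDiffAt ℝ 1 (fun p : ℝ × ℝ => orb γ u k p.1 p.2) (y, θ) := by
  induction k with
  | zero => simp only [orb]; fun_prop
  | succ k ih =>
    have hk := h k (by omega)
    have h1 := ih fun l hl => h l (by omega)
    have h2 : ContDiffAt ℝ 1 (fun p : ℝ × ℝ => ext γ u p.1 p.2)
        (orb γ u k y θ, 4 ^ (k + 1) * θ) := by
      refine (contDiffAt_leftFst hu hk _).congr_of_eventuallyEq ?_
      filter_upwards [strip_mem_nhds hk (4 ^ (k + 1) * θ)] with p hp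
      exact ext_of_mem (mem_strip.1 hp) _
    exact h2.comp (f := fun p : ℝ × ℝ => (orb γ u k p.1 p.2, 4 ^ (k + 1) * p.2)) (y, θ)
      (h1.prodMk (by fun_prop))

/-- The derivative of `orb k` in `y`, for orbits that stay in the open strip. -/
def dorb (γ : ℝ) (u : ℝ → ℝ → ℝ) (k : ℕ) (y θ : ℝ) : ℝ :=
  4 * ∏ i ∈ Finset.range k, dx γ u (orb γ u i y θ) (4 ^ (i + 1) * θ)

lemma hasDerivAt_orb (hu : IsAdmissible γ u) {y θ : ℝ} {k : ℕ}
    (h : ∀ l < k, orb γ u l y θ ∈ Ioo (0 : ℝ) (3 / 4)) :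
    HasDerivAt (fun y => orb γ u k y θ) (dorb γ u k y θ) y := by
  induction k with
  | zero =>
    simp only [orb, dorb, Finset.range_zero, Finset.prod_empty, mul_one]
    simpa using ((hasDerivAt_id y).const_mul 4).sub_const 3
  | succ k ih =>
    have hk := h k (by omega)
    have h2 : HasDerivAt (fun x => ext γ u x (4 ^ (k + 1) * θ))
        (dx γ u (orb γ u k y θ) (4 ^ (k + 1) * θ)) (orb γ u k y θ) := by
      refine (hasDerivAt_leftFst hu hk _).congr_of_eventuallyEq ?_
      filter_upwards [Icc_mem_nhds hk.1 hk.2] with x hx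
      exact ext_of_mem hx _
    refine (h2.comp y (ih fun l hl => h l (by omega))).congr_deriv ?_
    rw [dorb, dorb, Finset.prod_range_succ]
    ring

lemma four_le_dorb (hu : IsAdmissible γ u) {y θ : ℝ} {k : ℕ}
    (h : ∀ l < k, orb γ u l y θ ∈ Ioo (0 : ℝ) (3 / 4)) : 4 ≤ dorb γ u k y θ := by
  have : (1 : ℝ) ≤ ∏ i ∈ Finset.range k, dx γ u (orb γ u i y θ) (4 ^ (i + 1) * θ) := by
    refine Finset.prod_induction _ (fun a => (1 : ℝ) ≤ a) (fun a b ha hb => ?_) le_rfl ?_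
    · nlinarith
    · intro i hi
      exact one_le_dx hu (h i (Finset.mem_range.1 hi)) _
  unfold dorb
  linarith

/-! ### Power inequalities -/

lemma rpow_neg_sub_le {a b m β : ℝ} (hm : 0 < m) (ha : m ≤ a) (hab : a ≤ b) (hβ : 0 < β) :
    a ^ (-β) - b ^ (-β) ≤ β * m ^ (-β - 1) * (b - a) := by
  have ha0 : 0 < a := hm.trans_le ha
  have hb0 : 0 < b := ha0.trans_le hab
  have h1 : b ^ (-β) = a ^ (-β) * (b / a) ^ (-β) := by
    rw [← Real.mul_rpow ha0.le (by positivity)]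
    congr 1; field_simp
  have h2 : 1 - β * (b / a - 1) ≤ (b / a) ^ (-β) := by
    rw [Real.rpow_def_of_pos (by positivity)]
    have h3 := Real.add_one_le_exp (Real.log (b / a) * -β)
    have h4 := Real.log_le_sub_one_of_pos (show 0 < b / a by positivity)
    nlinarith
  have h5 : 0 < a ^ (-β) := Real.rpow_pos_of_pos ha0 _
  have h6 : a ^ (-β - 1) = a ^ (-β) / a := Real.rpow_sub_one ha0.ne' _
  have h7 : a ^ (-β - 1) ≤ m ^ (-β - 1) := Real.rpow_le_rpow_of_nonpos hm ha (by linarith)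
  have h8 : a ^ (-β) - b ^ (-β) ≤ β * a ^ (-β - 1) * (b - a) := by
    rw [h1, h6]
    have : β * (a ^ (-β) / a) * (b - a) = a ^ (-β) * (β * (b / a - 1)) := by
      field_simp
    rw [this]
    nlinarith
  refine h8.trans ?_
  have : 0 ≤ b - a := by linarith
  gcongr

lemma abs_rpow_neg_sub_le {a b m β : ℝ} (hm : 0 < m) (ha : m ≤ a) (hb : m ≤ b) (hβ : 0 < β) :
    |a ^ (-β) - b ^ (-β)| ≤ β * m ^ (-β - 1) * |a - b| := by
  rcases le_total a b with h | h
  · have h1 : b ^ (-β) ≤ a ^ (-β) := Real.rpow_le_rpow_of_nonpos (hm.trans_le ha) h (by linarith)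
    rw [abs_of_nonneg (by linarith), abs_of_nonpos (by linarith)]
    simpa using rpow_neg_sub_le hm ha h hβ
  · have h1 : a ^ (-β) ≤ b ^ (-β) := Real.rpow_le_rpow_of_nonpos (hm.trans_le hb) h (by linarith)
    rw [abs_of_nonpos (by linarith), abs_of_nonneg (by linarith)]
    simpa using rpow_neg_sub_le hm hb h hβ

lemma rpow_sub_le {a b p β : ℝ} (ha : 0 < a) (hab : a ≤ b) (hp : 0 ≤ p) (hβ : 0 < β) :
    b ^ p - a ^ p ≤ p / β * b ^ (p + β) * (a ^ (-β) - b ^ (-β)) := by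
  have hb : 0 < b := ha.trans_le hab
  have hs : 0 < a / b := by positivity
  have hL : Real.log (a / b) ≤ 0 := Real.log_nonpos hs.le ((div_le_one hb).2 hab)
  have e1 : ∀ q : ℝ, a ^ q = b ^ q * (a / b) ^ q := by
    intro q
    rw [← Real.mul_rpow hb.le hs.le]
    congr 1; field_simp
  have h1 : 1 + Real.log (a / b) * p ≤ (a / b) ^ p := by
    rw [Real.rpow_def_of_pos hs]
    linarith [Real.add_one_le_exp (Real.log (a / b) * p)]
  have h2 : 1 + Real.log (a / b) * -β ≤ (a / b) ^ (-β) := by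
    rw [Real.rpow_def_of_pos hs]
    linarith [Real.add_one_le_exp (Real.log (a / b) * -β)]
  have h3 : b ^ (p + β) * b ^ (-β) = b ^ p := by
    rw [← Real.rpow_add hb]; congr 1; ring
  have h4 : 0 < b ^ p := Real.rpow_pos_of_pos hb p
  have h5 : p / β * b ^ (p + β) * (a ^ (-β) - b ^ (-β))
      = b ^ p * (p / β * ((a / b) ^ (-β) - 1)) := by
    rw [e1 (-β), ← h3]; ring
  rw [h5, e1 p]
  have h6 : p / β * (Real.log (a / b) * -β) ≤ p / β * ((a / b) ^ (-β) - 1) := by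
    have : 0 ≤ p / β := by positivity
    apply mul_le_mul_of_nonneg_left _ this
    linarith
  have h7 : p / β * (Real.log (a / b) * -β) = - (Real.log (a / b) * p) := by
    field_simp
  have h8 : 1 - (a / b) ^ p ≤ p / β * ((a / b) ^ (-β) - 1) := by linarith
  calc b ^ p - b ^ p * (a / b) ^ p = b ^ p * (1 - (a / b) ^ p) := by ring
    _ ≤ _ := mul_le_mul_of_nonneg_left h8 h4.le

/-- The increment of `x ^ p` is controlled by the increment of `x ^ (-β)`. -/
lemma abs_rpow_sub_le {a b p β : ℝ} (ha : 0 < a) (hb : 0 < b) (hp : 0 ≤ p) (hβ : 0 < β) :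
    |a ^ p - b ^ p| ≤ p / β * (a ^ (p + β) + b ^ (p + β)) * |a ^ (-β) - b ^ (-β)| := by
  have ha' := Real.rpow_nonneg ha.le (p + β)
  have hb' := Real.rpow_nonneg hb.le (p + β)
  have hpb : 0 ≤ p / β := by positivity
  rcases le_total a b with h | h
  · have h1 : b ^ (-β) ≤ a ^ (-β) := Real.rpow_le_rpow_of_nonpos ha h (by linarith)
    have h2 : a ^ p ≤ b ^ p := Real.rpow_le_rpow ha.le h hp
    rw [abs_of_nonneg (by linarith : 0 ≤ a ^ (-β) - b ^ (-β)), abs_of_nonpos (by linarith)]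
    rw [neg_sub]
    refine (rpow_sub_le ha h hp hβ).trans ?_
    have : 0 ≤ a ^ (-β) - b ^ (-β) := by linarith
    gcongr
    linarith
  · have h1 : a ^ (-β) ≤ b ^ (-β) := Real.rpow_le_rpow_of_nonpos hb h (by linarith)
    have h2 : b ^ p ≤ a ^ p := Real.rpow_le_rpow hb.le h hp
    rw [abs_of_nonpos (by linarith : a ^ (-β) - b ^ (-β) ≤ 0), abs_of_nonneg (by linarith), neg_sub]
    refine (rpow_sub_le hb h hp hβ).trans ?_
    have : 0 ≤ b ^ (-β) - a ^ (-β) := by linarith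
    gcongr
    linarith

/-! ### The left branch in the coordinate `x ^ (-β)` -/

lemma leftFst_pos (hu : IsAdmissible γ u) {x : ℝ} (hx : x ∈ Ioc (0 : ℝ) (3 / 4)) (θ : ℝ) :
    0 < leftFst γ u x θ := by
  have h1 := hu.pos x ⟨hx.1.le, hx.2⟩ θ
  have h2 := Real.rpow_pos_of_pos hx.1 γ
  have h3 := hx.1
  unfold leftFst
  positivity

lemma hasDerivAt_rpow_sub (hu : IsAdmissible γ u) (β : ℝ) {x : ℝ}
    (hx : x ∈ Ioo (0 : ℝ) (3 / 4)) (θ : ℝ) :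
    HasDerivAt (fun s => s ^ (-β) - leftFst γ u s θ ^ (-β))
      (β * x ^ (-β - 1) * ((1 + x ^ γ * u x θ) ^ (-β - 1) * dx γ u x θ - 1)) x := by
  have hS := leftFst_pos hu ⟨hx.1, hx.2.le⟩ θ
  have h1 := Real.hasDerivAt_rpow_const (x := x) (p := -β) (Or.inl hx.1.ne')
  have h2 := (hasDerivAt_leftFst hu hx θ).rpow_const (p := -β) (Or.inl hS.ne')
  refine (h1.sub h2).congr_deriv ?_
  have h3 : 0 ≤ 1 + x ^ γ * u x θ := by
    have := hu.pos x (Ioo_subset_Icc_self hx) θ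
    have := Real.rpow_pos_of_pos hx.1 γ
    positivity
  have h4 : leftFst γ u x θ ^ (-β - 1) = x ^ (-β - 1) * (1 + x ^ γ * u x θ) ^ (-β - 1) := by
    rw [leftFst, Real.mul_rpow hx.1.le h3]
  rw [h4]; ring

lemma continuousOn_rpow_sub (hu : IsAdmissible γ u) (β : ℝ) (θ : ℝ) :
    ContinuousOn (fun s => s ^ (-β) - leftFst γ u s θ ^ (-β)) (Ioc 0 (3 / 4)) := by
  refine ContinuousOn.sub ?_ ?_
  · exact continuousOn_id.rpow_const fun x hx => Or.inl (ne_of_gt hx.1)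
  · exact ((leftFst_continuousOn_left hu θ).mono Ioc_subset_Icc_self).rpow_const
      fun x hx => Or.inl (leftFst_pos hu hx θ).ne'

/-- For `β > γ` the left branch, in the coordinate `x ^ (-β)`, is nonexpanding near `x = 0`. -/
lemma rpow_neg_sub_leftFst_le {c K β : ℝ} (hu : IsAdmissible γ u) (hb : Bounds u c K)
    (hβ : γ < β) {r : ℝ} (hr : r < 3 / 4) (hr' : r * K ≤ (β - γ) * c) {x x' θ : ℝ} (hx : 0 < x)
    (hxx : x ≤ x') (hx' : x' ≤ r) :
    leftFst γ u x θ ^ (-β) - leftFst γ u x' θ ^ (-β) ≤ x ^ (-β) - x' ^ (-β) := by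
  have hanti : AntitoneOn (fun s => s ^ (-β) - leftFst γ u s θ ^ (-β)) (Ioc 0 r) := by
    refine antitoneOn_of_hasDerivWithinAt_nonpos (convex_Ioc _ _)
      ((continuousOn_rpow_sub hu β θ).mono (Ioc_subset_Ioc_right hr.le))
      (fun s hs => (hasDerivAt_rpow_sub hu β ?_ θ).hasDerivWithinAt) ?_
    · rw [interior_Ioc] at hs
      exact ⟨hs.1, hs.2.trans hr⟩
    · intro s hs
      rw [interior_Ioc] at hs
      have hs' : s ∈ Icc (0 : ℝ) (3 / 4) := ⟨hs.1.le, (hs.2.trans hr).le⟩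
      have hp := Real.rpow_pos_of_pos hs.1 γ
      have hu0 := hb.le_u s hs' θ
      have hux := (le_abs_self _).trans (hb.abs_ux_le s hs' θ)
      have hγ := hu.gamma_pos
      have hcp := hb.c_pos
      set t := s ^ γ * u s θ with ht
      have ht0 : 0 < t := by
        have : 0 < u s θ := hcp.trans_le hu0
        positivity
      have hdx : dx γ u s θ ≤ 1 + (1 + β) * t := by
        have h1 : s * ux u s θ ≤ (β - γ) * u s θ := by
          have h2 : s * ux u s θ ≤ s * K := mul_le_mul_of_nonneg_left hux hs.1.le
          have h3 : s * K ≤ r * K := mul_le_mul_of_nonneg_right hs.2.le (by linarith [hb.one_le])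
          have h4 : (β - γ) * c ≤ (β - γ) * u s θ := mul_le_mul_of_nonneg_left hu0 (by linarith)
          linarith
        have h2 := mul_le_mul_of_nonneg_left h1 hp.le
        unfold dx
        rw [← ht]
        have h3 : s ^ γ * ((β - γ) * u s θ) = (β - γ) * t := by rw [ht]; ring
        nlinarith
      have hbern : 1 + (1 + β) * t ≤ (1 + t) ^ (1 + β) :=
        one_add_mul_self_le_rpow_one_add (by linarith) (by linarith)
      have h5 : (1 + t) ^ (-β - 1) * (1 + t) ^ (1 + β) = 1 := by
        rw [← Real.rpow_add (by linarith)]; ring_nf; exact Real.rpow_zero _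
      have h6 : 0 < (1 + t) ^ (-β - 1) := Real.rpow_pos_of_pos (by linarith) _
      have h7 : (1 + t) ^ (-β - 1) * dx γ u s θ ≤ 1 :=
        (mul_le_mul_of_nonneg_left (hdx.trans hbern) h6.le).trans_eq h5
      have h8 : 0 < s ^ (-β - 1) := Real.rpow_pos_of_pos hs.1 _
      have h9 : 0 ≤ β * s ^ (-β - 1) := by
        have : 0 < β := hγ.trans hβ
        positivity
      exact mul_nonpos_of_nonneg_of_nonpos h9 (by linarith)
  have := hanti ⟨hx, hxx.trans hx'⟩ ⟨hx.trans_le hxx, hx'⟩ hxx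
  simp only at this
  linarith

/-- For `0 < β < γ` the left branch, in the coordinate `x ^ (-β)`, is noncontracting near
`x = 0`. -/
lemma exists_le_rpow_neg_sub_leftFst {c K β : ℝ} (hu : IsAdmissible γ u) (hb : Bounds u c K)
    (hβ : 0 < β) (hβγ : β < γ) : ∃ r ∈ Ioo (0 : ℝ) (3 / 4), ∀ x x' θ : ℝ, 0 < x → x ≤ x' →
      x' ≤ r →
      x ^ (-β) - x' ^ (-β) ≤ leftFst γ u x θ ^ (-β) - leftFst γ u x' θ ^ (-β) := by
  have hγ := hu.gamma_pos
  have hcp := hb.c_pos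
  have hK := hb.one_le
  obtain ⟨r, hr0, hr⟩ : ∃ r ∈ Ioo (0 : ℝ) (3 / 4), ∀ x ∈ Ioo 0 r,
      x * K ≤ (γ - β) / 2 * c ∧ (1 + β) ^ 2 * (x ^ γ * K) ≤ (γ - β) / 2
        ∧ (1 + β) * (x ^ γ * K) ≤ 1 := by
    have hpow : Tendsto (fun x : ℝ => x ^ γ) (𝓝[>] 0) (𝓝 0) := by
      have := (Real.continuousAt_rpow_const 0 γ (Or.inr hγ.le)).tendsto
      rw [Real.zero_rpow hγ.ne'] at this
      exact this.mono_left nhdsWithin_le_nhds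
    have hid : Tendsto (fun x : ℝ => x) (𝓝[>] 0) (𝓝 0) := nhdsWithin_le_nhds
    have e1 : ∀ᶠ x : ℝ in 𝓝[>] 0, x * K < (γ - β) / 2 * c := by
      have := hid.mul_const K
      rw [zero_mul] at this
      exact this.eventually_lt_const (by have : 0 < γ - β := by linarith
                                         positivity)
    have e2 : ∀ᶠ x : ℝ in 𝓝[>] 0, (1 + β) ^ 2 * (x ^ γ * K) < (γ - β) / 2 := by
      have := (hpow.mul_const K).const_mul ((1 + β) ^ 2)
      rw [zero_mul, mul_zero] at this
      exact this.eventually_lt_const (by linarith)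
    have e3 : ∀ᶠ x : ℝ in 𝓝[>] 0, (1 + β) * (x ^ γ * K) < 1 := by
      have := (hpow.mul_const K).const_mul (1 + β)
      rw [zero_mul, mul_zero] at this
      exact this.eventually_lt_const (by linarith)
    obtain ⟨r, hr0, hr⟩ := mem_nhdsGT_iff_exists_Ioo_subset.1 ((e1.and e2).and e3)
    refine ⟨min r (1 / 2), ⟨lt_min hr0 (by norm_num), (min_le_right _ _).trans_lt (by norm_num)⟩,
      fun x hx => ?_⟩
    have := hr ⟨hx.1, hx.2.trans_le (min_le_left _ _)⟩
    exact ⟨this.1.1.le, this.1.2.le, this.2.le⟩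
  refine ⟨r, hr0, fun x x' θ hx hxx hx' => ?_⟩
  have hmono : MonotoneOn (fun s => s ^ (-β) - leftFst γ u s θ ^ (-β)) (Ioc 0 r) := by
    refine monotoneOn_of_hasDerivWithinAt_nonneg (convex_Ioc _ _)
      ((continuousOn_rpow_sub hu β θ).mono (Ioc_subset_Ioc_right hr0.2.le))
      (fun s hs => (hasDerivAt_rpow_sub hu β ?_ θ).hasDerivWithinAt) ?_
    · rw [interior_Ioc] at hs
      exact ⟨hs.1, hs.2.trans hr0.2⟩
    · intro s hs
      rw [interior_Ioc] at hs
      obtain ⟨c1, c2, c3⟩ := hr s hs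
      have hs' : s ∈ Icc (0 : ℝ) (3 / 4) := ⟨hs.1.le, (hs.2.trans hr0.2).le⟩
      have hp := Real.rpow_pos_of_pos hs.1 γ
      have hu0 := hb.le_u s hs' θ
      have hu1 := hb.u_le s hs' θ
      have hux := neg_le_of_abs_le (hb.abs_ux_le s hs' θ)
      set t := s ^ γ * u s θ with ht
      have ht0 : 0 < t := by
        have : 0 < u s θ := hcp.trans_le hu0
        positivity
      have htK : t ≤ s ^ γ * K := mul_le_mul_of_nonneg_left hu1 hp.le
      have hdx : 1 + (1 + (γ + β) / 2) * t ≤ dx γ u s θ := by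
        have h1 : -((γ - β) / 2 * u s θ) ≤ s * ux u s θ := by
          have h2 : s * -K ≤ s * ux u s θ := mul_le_mul_of_nonneg_left hux hs.1.le
          have h4 : (γ - β) / 2 * c ≤ (γ - β) / 2 * u s θ :=
            mul_le_mul_of_nonneg_left hu0 (by linarith)
          linarith
        have h2 := mul_le_mul_of_nonneg_left h1 hp.le
        unfold dx
        rw [← ht]
        have h3 : s ^ γ * -((γ - β) / 2 * u s θ) = -((γ - β) / 2 * t) := by rw [ht]; ring
        nlinarith
      have hbern : (1 + t) ^ (1 + β) ≤ 1 + (1 + (γ + β) / 2) * t := by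
        have h1 : (1 + t) ^ (1 + β) ≤ Real.exp ((1 + β) * t) := by
          rw [mul_comm, Real.exp_mul]
          exact Real.rpow_le_rpow (by linarith) (by linarith [Real.add_one_le_exp t])
            (by linarith)
        have h0 : 0 ≤ (1 + β) * t := by positivity
        have h2 : (1 + β) * t ≤ 1 := by nlinarith
        have h3 := Real.abs_exp_sub_one_sub_id_le (x := (1 + β) * t) (by rwa [abs_of_nonneg h0])
        have h4 := (le_abs_self _).trans h3
        have h5 : ((1 + β) * t) ^ 2 ≤ (γ - β) / 2 * t := by
          have : (1 + β) ^ 2 * t ≤ (γ - β) / 2 := by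
            refine le_trans ?_ c2
            gcongr
          nlinarith
        linarith
      have h5 : (1 + t) ^ (-β - 1) * (1 + t) ^ (1 + β) = 1 := by
        rw [← Real.rpow_add (by linarith)]; ring_nf; exact Real.rpow_zero _
      have h6 : 0 < (1 + t) ^ (-β - 1) := Real.rpow_pos_of_pos (by linarith) _
      have h7 : 1 ≤ (1 + t) ^ (-β - 1) * dx γ u s θ :=
        h5.symm.trans_le (mul_le_mul_of_nonneg_left (hbern.trans hdx) h6.le)
      have h8 : 0 < s ^ (-β - 1) := Real.rpow_pos_of_pos hs.1 _
      exact mul_nonneg (by positivity) (by linarith)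
  have := hmono ⟨hx, hxx.trans hx'⟩ ⟨hx.trans_le hxx, hx'⟩ hxx
  simp only at this
  linarith

/-- The effect of the angle on the left branch, in the coordinate `x ^ (-β)`. -/
lemma abs_leftFst_rpow_sub_le {c K β : ℝ} (hu : IsAdmissible γ u) (hb : Bounds u c K)
    (hβ : 0 < β) {x : ℝ} (hx : x ∈ Ioc (0 : ℝ) (3 / 4)) (θ θ' : ℝ) :
    |leftFst γ u x θ ^ (-β) - leftFst γ u x θ' ^ (-β)| ≤ β * K * x ^ (γ - β) * |θ - θ'| := by
  have hx' : x ∈ Icc (0 : ℝ) (3 / 4) := ⟨hx.1.le, hx.2⟩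
  have hp := Real.rpow_pos_of_pos hx.1 γ
  have hle : ∀ θ, x ≤ leftFst γ u x θ := fun θ => by
    have := le_leftFst (γ := γ) hb hx' θ
    have : 0 ≤ c * (x ^ γ * x) := by have := hb.c_pos; have := hx.1; positivity
    linarith
  refine (abs_rpow_neg_sub_le hx.1 (hle θ) (hle θ') hβ).trans ?_
  have h1 : |leftFst γ u x θ - leftFst γ u x θ'| ≤ x * x ^ γ * (K * |θ - θ'|) := by
    have h2 := hb.u_lip x hx' x hx' θ θ'
    rw [sub_self, abs_zero, zero_add] at h2
    have : leftFst γ u x θ - leftFst γ u x θ' = x * x ^ γ * (u x θ - u x θ') := by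
      unfold leftFst; ring
    rw [this, abs_mul, abs_of_pos (mul_pos hx.1 hp)]
    exact mul_le_mul_of_nonneg_left h2 (mul_pos hx.1 hp).le
  have h3 : x ^ (-β - 1) * (x * x ^ γ) = x ^ (γ - β) := by
    rw [← Real.rpow_one_add' hx.1.le (by linarith [hu.gamma_pos]), ← Real.rpow_add hx.1]
    congr 1; ring
  have h4 : 0 < x ^ (-β - 1) := Real.rpow_pos_of_pos hx.1 _
  calc β * x ^ (-β - 1) * |leftFst γ u x θ - leftFst γ u x θ'|
      ≤ β * x ^ (-β - 1) * (x * x ^ γ * (K * |θ - θ'|)) := by gcongr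
    _ = β * K * (x ^ (-β - 1) * (x * x ^ γ)) * |θ - θ'| := by ring
    _ = _ := by rw [h3]

/-- The powers `x ^ (γ + β)` along an orbit are bounded by telescoping increments of `x ^ β`. -/
lemma rpow_add_le_sub {c K β : ℝ} (hu : IsAdmissible γ u) (hb : Bounds u c K)
    (hβ : 0 < β) {x : ℝ} (hx : x ∈ Ioc (0 : ℝ) (3 / 4)) (θ : ℝ) :
    β * c / (1 + c) * x ^ (γ + β) ≤ leftFst γ u x θ ^ β - x ^ β := by
  have hx' : x ∈ Icc (0 : ℝ) (3 / 4) := ⟨hx.1.le, hx.2⟩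
  have hp := Real.rpow_pos_of_pos hx.1 γ
  have hp1 := rpow_le_one_of_mem hu.gamma_pos hx'
  have hc := hb.c_pos
  set t := c * x ^ γ with ht
  have ht0 : 0 < t := by positivity
  have h1 : x * (1 + t) ≤ leftFst γ u x θ := by
    have := le_leftFst (γ := γ) hb hx' θ
    rw [ht]; linarith
  have h2 : x ^ β * (1 + t) ^ β ≤ leftFst γ u x θ ^ β := by
    rw [← Real.mul_rpow hx.1.le (by linarith)]
    exact Real.rpow_le_rpow (mul_nonneg hx.1.le (by linarith)) h1 hβ.le
  have h3 : 1 + β * (t / (1 + c)) ≤ (1 + t) ^ β := by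
    rw [Real.rpow_def_of_pos (by linarith)]
    have h4 := Real.add_one_le_exp (Real.log (1 + t) * β)
    have h5 := Real.one_sub_inv_le_log_of_pos (show 0 < 1 + t by linarith)
    have h6 : t / (1 + c) ≤ 1 - (1 + t)⁻¹ := by
      have : 1 - (1 + t)⁻¹ = t / (1 + t) := by field_simp; ring
      rw [this]
      have : t ≤ c := by rw [ht]; nlinarith
      gcongr
    have h7 : t / (1 + c) * β ≤ Real.log (1 + t) * β :=
      mul_le_mul_of_nonneg_right (h6.trans h5) hβ.le
    linarith
  have h8 : 0 < x ^ β := Real.rpow_pos_of_pos hx.1 β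
  have h9 : x ^ (γ + β) = x ^ γ * x ^ β := Real.rpow_add hx.1 _ _
  have h10 : β * c / (1 + c) * x ^ (γ + β) = x ^ β * (β * (t / (1 + c))) := by
    rw [h9, ht]; ring
  rw [h10]
  nlinarith

/-! ### Hitting times -/

/-- An orbit that starts in `[r, ∞)` passes `3/4` after a bounded number of steps. -/
lemma exists_reach (hu : IsAdmissible γ u) {r : ℝ} (hr : 0 < r) :
    ∃ N : ℕ, ∀ i y θ, r ≤ orb γ u i y θ → 3 / 4 ≤ orb γ u (i + N) y θ := by
  obtain ⟨c, K, hb⟩ := hu.exists_bounds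
  have hstep : 0 < c * (r ^ γ * r) := by
    have := hb.c_pos; have := Real.rpow_pos_of_pos hr γ; positivity
  obtain ⟨N, hN⟩ := exists_nat_gt (3 / 4 / (c * (r ^ γ * r)))
  rw [div_lt_iff₀ hstep] at hN
  refine ⟨N, fun i y θ hi => ?_⟩
  by_contra! hlt
  have hy : 3 / 4 < y := (orb_pos_iff hu i).1 (hr.trans_le hi)
  have hmono := orb_mono hu hy.le θ
  have key : ∀ j ≤ N, r + j * (c * (r ^ γ * r)) ≤ orb γ u (i + j) y θ := by
    intro j
    induction j with
    | zero => intro _; simpa using hi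
    | succ j ih =>
      intro hj
      have h1 := ih (by omega)
      have h2 : orb γ u (i + j) y θ ≤ orb γ u (i + N) y θ := hmono (by omega)
      have h3 : r ≤ orb γ u (i + j) y θ := hi.trans (hmono (by omega))
      have h4 := add_le_ext hu hb hr.le h3 (h2.trans hlt.le) (4 ^ (i + j + 1) * θ)
      rw [← add_assoc, orb_succ]
      push_cast
      linarith
  have := key N le_rfl
  linarith

lemma orb_le_pow_mul {c K : ℝ} (hu : IsAdmissible γ u) (hb : Bounds u c K) {y θ : ℝ} {k : ℕ}
    (h : ∀ l < k, orb γ u l y θ ∈ Icc (0 : ℝ) (3 / 4)) (j i : ℕ) (hij : i + j = k) :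
    orb γ u k y θ ≤ (1 + K) ^ j * orb γ u i y θ := by
  induction j generalizing i with
  | zero => obtain rfl : i = k := by omega
            simp
  | succ j ih =>
    refine (ih (i + 1) (by omega)).trans ?_
    have h1 := h i (by omega)
    have h2 := leftFst_le hu hb h1 (4 ^ (i + 1) * θ)
    rw [orb_succ, ext_of_mem h1, pow_succ (1 + K), mul_assoc]
    have : 0 ≤ (1 + K) ^ j := by have := hb.one_le; positivity
    exact mul_le_mul_of_nonneg_left h2 this

/-- Two orbits with the same initial `y`, whose angles differ by at most `4` at the time `m` at
which the first of them passes `3/4`, pass `3/4` at nearly the same time. -/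
lemma exists_shadow (hu : IsAdmissible γ u) : ∃ N : ℕ, ∀ m y θ θ',
    (∀ i < m, orb γ u i y θ ∈ Ioo (0 : ℝ) (3 / 4)) → 3 / 4 ≤ orb γ u m y θ →
    4 ^ (m + 1) * |θ - θ'| ≤ 4 → 3 / 4 ≤ orb γ u (m + N) y θ' := by
  obtain ⟨c, K, hb⟩ := hu.exists_bounds
  have hγ := hu.gamma_pos
  have hc := hb.c_pos
  have hK := hb.one_le
  -- the exponent `β = γ + η` is chosen so that `(1 + K) ^ η = 2`
  have hlog : 0 < Real.log (1 + K) := Real.log_pos (by linarith)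
  set η := Real.log 2 / Real.log (1 + K) with hη
  have hη0 : 0 < η := div_pos (Real.log_pos one_lt_two) hlog
  have hη2 : (1 + K) ^ η = 2 := by
    rw [Real.rpow_def_of_pos (by linarith), hη, mul_div_cancel₀ _ hlog.ne',
      Real.exp_log two_pos]
  set β := γ + η with hβ
  have hβ0 : 0 < β := by linarith
  set r := min (1 / 2) (η * c / K) with hr
  have hr0 : 0 < r := lt_min (by norm_num) (by positivity)
  have hr1 : r < 3 / 4 := (min_le_left _ _).trans_lt (by norm_num)
  have hrK : r * K ≤ (β - γ) * c := by
    have : r ≤ η * c / K := min_le_right _ _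
    rw [le_div_iff₀ (by linarith)] at this
    rw [hβ]; linarith
  set M := 4 * β * K * r ^ (-η) with hM
  have hrη : 0 < r ^ (-η) := Real.rpow_pos_of_pos hr0 _
  have hM0 : 0 ≤ M := by positivity
  have hrβ : 0 < r ^ (-β) := Real.rpow_pos_of_pos hr0 _
  set ρ := (r ^ (-β) + M) ^ (-β⁻¹) with hρ
  have hρ0 : 0 < ρ := Real.rpow_pos_of_pos (by linarith) _
  obtain ⟨N, hN⟩ := exists_reach hu hρ0
  refine ⟨N, fun m y θ θ' hm hm' hθ => ?_⟩
  have hy : 3 / 4 < y := (orb_pos_iff hu m).1 (by linarith)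
  have hex : ∃ k, r < orb γ u k y θ := ⟨m, by linarith⟩
  classical
  set k₁ := Nat.find hex with hk₁
  have hk₁r : r < orb γ u k₁ y θ := Nat.find_spec hex
  have hk₁m : k₁ ≤ m := Nat.find_min' hex (by linarith)
  have hlt : ∀ k < k₁, orb γ u k y θ ≤ r := fun k hk => not_lt.1 (Nat.find_min hex hk)
  have hpos : ∀ k θ, 0 < orb γ u k y θ := fun k θ => (orb_pos_iff hu k).2 hy
  have key : ∀ k ≤ k₁, orb γ u k y θ' ^ (-β) ≤ orb γ u k y θ ^ (-β) + M * (1 / 2) ^ (m - k) := by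
    intro k
    induction k with
    | zero =>
      intro _
      have : 0 ≤ M * (1 / 2) ^ (m - 0) := by positivity
      simp only [orb] at this ⊢
      linarith
    | succ k ih =>
      intro hk
      have ih := ih (by omega)
      have hkr := hlt k (by omega)
      set x := orb γ u k y θ with hx
      set x' := orb γ u k y θ' with hx'
      have hx0 : 0 < x := hpos k θ
      have hx0' : 0 < x' := hpos k θ'
      have hxI : x ∈ Ioc (0 : ℝ) (3 / 4) := ⟨hx0, hkr.trans hr1.le⟩
      set t := (4 : ℝ) ^ (k + 1) * θ with ht
      set t' := (4 : ℝ) ^ (k + 1) * θ' with ht'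
      have htt : |t' - t| ≤ 4 * (1 / 4) ^ (m - k) := by
        have h1 : |t' - t| = 4 ^ (k + 1) * |θ - θ'| := by
          rw [ht, ht', ← mul_sub, abs_mul, abs_of_pos (by positivity), abs_sub_comm]
        have h2 : (4 : ℝ) ^ (m + 1) = 4 ^ (k + 1) * 4 ^ (m - k) := by
          rw [← pow_add]; congr 1; omega
        rw [h1, one_div, inv_pow, ← div_eq_mul_inv, le_div_iff₀ (by positivity)]
        rw [h2] at hθ
        linarith
      have hxη : x ^ (-η) ≤ r ^ (-η) * 2 ^ (m - k) := by
        have h1 := orb_le_pow_mul hu hb (y := y) (θ := θ) (k := k₁)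
          (fun l hl => ⟨(hpos l θ).le, (hlt l hl).trans hr1.le⟩) (k₁ - k) k (by omega)
        have h2 : r / (1 + K) ^ (k₁ - k) ≤ x := by
          rw [div_le_iff₀ (by positivity)]; rw [← hx] at h1; linarith
        have h3 := Real.rpow_le_rpow_of_nonpos (z := -η) (by positivity) h2 (by linarith)
        refine h3.trans ?_
        rw [Real.div_rpow hr0.le (by positivity), div_eq_mul_inv]
        have h4 : (((1 + K) ^ (k₁ - k)) ^ (-η))⁻¹ = 2 ^ (k₁ - k) := by
          rw [Real.rpow_neg (by positivity), inv_inv, ← Real.rpow_natCast, ← Real.rpow_mul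
            (by linarith), mul_comm, Real.rpow_mul (by linarith), hη2, Real.rpow_natCast]
        rw [h4]
        gcongr
        norm_num
      have hangle : leftFst γ u x t' ^ (-β) ≤ leftFst γ u x t ^ (-β) + M * (1 / 2) ^ (m - k) := by
        have h1 := (le_abs_self _).trans (abs_leftFst_rpow_sub_le hu hb hβ0 hxI t' t)
        have h2 : β * K * x ^ (γ - β) * |t' - t| ≤ M * (1 / 2) ^ (m - k) := by
          have h3 : γ - β = -η := by rw [hβ]; ring
          rw [h3]
          calc β * K * x ^ (-η) * |t' - t|
              ≤ β * K * (r ^ (-η) * 2 ^ (m - k)) * (4 * (1 / 4) ^ (m - k)) := by gcongr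
            _ = M * (2 ^ (m - k) * (1 / 4) ^ (m - k)) := by rw [hM]; ring
            _ = M * (1 / 2) ^ (m - k) := by rw [← mul_pow]; norm_num
        linarith
      have hpow : M * (1 / 2 : ℝ) ^ (m - (k + 1))
          = M * (1 / 2) ^ (m - k) + M * (1 / 2) ^ (m - k) := by
        have : m - k = (m - (k + 1)) + 1 := by omega
        rw [this, pow_succ]; ring
      have hMk : 0 ≤ M * (1 / 2 : ℝ) ^ (m - k) := by positivity
      rw [orb_succ, orb_succ, ← hx, ← hx', ← ht, ← ht', ext_of_mem ⟨hx0.le, hxI.2⟩, hpow]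
      rcases le_total x x' with h | h
      · have h1 : leftFst γ u x t' ≤ ext γ u x' t' := by
          rw [← ext_of_mem ⟨hx0.le, hxI.2⟩]; exact ext_mono hu h _
        have h2 := Real.rpow_le_rpow_of_nonpos (z := -β) (leftFst_pos hu hxI t') h1 (by linarith)
        linarith
      · rw [ext_of_mem ⟨hx0'.le, h.trans hxI.2⟩]
        have h1 := rpow_neg_sub_leftFst_le hu hb (by linarith : γ < β) hr1 hrK (θ := t') hx0' h hkr
        linarith
  have hfin := key k₁ le_rfl
  have h1 : orb γ u k₁ y θ ^ (-β) ≤ r ^ (-β) :=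
    Real.rpow_le_rpow_of_nonpos hr0 hk₁r.le (by linarith)
  have h2 : M * (1 / 2 : ℝ) ^ (m - k₁) ≤ M :=
    mul_le_of_le_one_right hM0 (pow_le_one₀ (by norm_num) (by norm_num))
  have h3 : ρ ≤ orb γ u k₁ y θ' := by
    have h4 := Real.rpow_le_rpow_of_nonpos (z := -β⁻¹)
      (Real.rpow_pos_of_pos (hpos k₁ θ') (-β)) (hfin.trans (add_le_add h1 h2))
      (by rw [neg_nonpos]; positivity)
    rw [← Real.rpow_mul (hpos k₁ θ').le, neg_mul_neg, mul_inv_cancel₀ hβ0.ne',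
      Real.rpow_one] at h4
    exact h4
  exact (hN k₁ y θ' h3).trans (orb_mono hu hy.le θ' (by omega))

/-! ### Distortion along two orbits -/

/-- Along two orbits that stay in the strip until they pass `3/4` together at time `k`, at distance
at most `d`, the coordinates `x ^ (-β)` with `β < γ` differ by at most a constant times `d`. -/
lemma exists_rpow_neg_orb_bound (hu : IsAdmissible γ u) {β : ℝ} (hβ : 0 < β) (hβγ : β < γ) :
    ∃ C, 0 ≤ C ∧ ∀ k y θ y' θ' d, 0 ≤ d →
      (∀ i < k, orb γ u i y θ ∈ Ioo (0 : ℝ) (3 / 4)) →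
      (∀ i < k, orb γ u i y' θ' ∈ Ioo (0 : ℝ) (3 / 4)) →
      3 / 4 ≤ orb γ u k y θ → 3 / 4 ≤ orb γ u k y' θ' →
      (orb γ u k y' θ' - orb γ u k y θ) ^ 2 + (4 ^ (k + 1) * θ' - 4 ^ (k + 1) * θ) ^ 2 ≤ d ^ 2 →
      ∀ j i, i + j = k → |orb γ u i y θ ^ (-β) - orb γ u i y' θ' ^ (-β)| ≤ C * d := by
  obtain ⟨c, K, hb⟩ := hu.exists_bounds
  have hK := hb.one_le
  obtain ⟨r, hr, hmono⟩ := exists_le_rpow_neg_sub_leftFst hu hb hβ hβγ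
  obtain ⟨N, hN⟩ := exists_reach hu hr.1
  -- both points lie above `r₁` at the times at which one of them has passed `r`
  set r₁ := 3 / 4 / (1 + K) ^ N with hr₁
  have hr₁0 : 0 < r₁ := by positivity
  set C₀ := β * r₁ ^ (-β - 1) with hC₀
  have hC₀0 : 0 ≤ C₀ := by have := Real.rpow_nonneg hr₁0.le (-β - 1); positivity
  refine ⟨C₀ + β * K * 2, by positivity, ?_⟩
  intro k y θ y' θ' d hd h h' hk hk' hdist
  have hcl : ∀ l < k, orb γ u l y θ ∈ Icc (0 : ℝ) (3 / 4) := fun l hl => Ioo_subset_Icc_self (h l hl)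
  have hcl' : ∀ l < k, orb γ u l y' θ' ∈ Icc (0 : ℝ) (3 / 4) :=
    fun l hl => Ioo_subset_Icc_self (h' l hl)
  have hdx : ∀ i ≤ k, |orb γ u i y θ - orb γ u i y' θ'| ≤ d := fun i hi => by
    have h1 := orb_expanding hu hi hcl hcl'
    rw [abs_sub_comm]
    refine abs_le_of_sq_le_sq ?_ hd
    nlinarith [sq_nonneg (4 ^ (i + 1) * θ' - 4 ^ (i + 1) * θ)]
  have hθ : 4 ^ (k + 1) * |θ - θ'| ≤ d := by
    have h1 : |4 ^ (k + 1) * θ' - 4 ^ (k + 1) * θ| ≤ d := by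
      refine abs_le_of_sq_le_sq ?_ hd
      nlinarith [sq_nonneg (orb γ u k y' θ' - orb γ u k y θ)]
    rwa [← mul_sub, abs_mul, abs_of_pos (by positivity), abs_sub_comm] at h1
  have hlow : ∀ i j, i + j = k → j ≤ N →
      |orb γ u i y θ ^ (-β) - orb γ u i y' θ' ^ (-β)| ≤ C₀ * d := by
    intro i j hij hj
    have key : ∀ z η, (∀ l < k, orb γ u l z η ∈ Icc (0 : ℝ) (3 / 4)) → 3 / 4 ≤ orb γ u k z η →
        r₁ ≤ orb γ u i z η := by
      intro z η hz hzk
      have h1 := orb_le_pow_mul hu hb hz j i hij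
      have hi0 : 0 ≤ orb γ u i z η := by
        rcases Nat.eq_zero_or_pos j with rfl | hj0
        · rw [show i = k by omega]; linarith
        · exact (hz i (by omega)).1
      have h2 : (1 + K) ^ j ≤ (1 + K) ^ N := pow_le_pow_right₀ (by linarith) hj
      rw [hr₁, div_le_iff₀ (by positivity)]
      nlinarith
    refine (abs_rpow_neg_sub_le hr₁0 (key y θ hcl hk) (key y' θ' hcl' hk') hβ).trans ?_
    exact mul_le_mul_of_nonneg_left (hdx i (by omega)) hC₀0
  have main : ∀ j i, i + j = k →
      |orb γ u i y θ ^ (-β) - orb γ u i y' θ' ^ (-β)|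
        ≤ (C₀ + β * K * (2 - (1 / 4) ^ j)) * d := by
    intro j
    induction j with
    | zero =>
      intro i hi
      refine (hlow i 0 hi (Nat.zero_le _)).trans ?_
      gcongr
      have : 0 < β * K := by positivity
      norm_num
      linarith
    | succ j ih =>
      intro i hi
      have hfac : (0 : ℝ) ≤ 2 - (1 / 4) ^ (j + 1) := by
        have : (1 / 4 : ℝ) ^ (j + 1) ≤ 1 := pow_le_one₀ (by norm_num) (by norm_num)
        linarith
      by_cases hj : j + 1 ≤ N
      · refine (hlow i (j + 1) hi hj).trans ?_
        gcongr
        have : 0 ≤ β * K * (2 - (1 / 4 : ℝ) ^ (j + 1)) := by positivity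
        linarith
      have hsmall : ∀ z η, (∀ l < k, orb γ u l z η ∈ Ioo (0 : ℝ) (3 / 4)) →
          orb γ u i z η ≤ r := by
        intro z η hz
        by_contra! hlt
        have h1 := hN i z η hlt.le
        linarith [(hz (i + N) (by omega)).2]
      have hx := h i (by omega)
      have hx' := h' i (by omega)
      have hxr := hsmall y θ h
      have hxr' := hsmall y' θ' h'
      have ih := ih (i + 1) (by omega)
      rw [orb_succ, orb_succ, ext_of_mem (hcl i (by omega)), ext_of_mem (hcl' i (by omega))] at ih
      set x := orb γ u i y θ
      set x' := orb γ u i y' θ'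
      set t := (4 : ℝ) ^ (i + 1) * θ with ht
      set t' := (4 : ℝ) ^ (i + 1) * θ' with ht'
      have htt : |t - t'| ≤ (1 / 4) ^ (j + 1) * d := by
        have h1 : |t - t'| = 4 ^ (i + 1) * |θ - θ'| := by
          rw [ht, ht', ← mul_sub, abs_mul, abs_of_pos (by positivity)]
        have h2 : (4 : ℝ) ^ (k + 1) = 4 ^ (i + 1) * 4 ^ (j + 1) := by
          rw [← pow_add]; congr 1; omega
        rw [h2] at hθ
        rw [h1, one_div, inv_pow, inv_mul_eq_div, le_div_iff₀ (by positivity)]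
        linarith
      have hangle : ∀ z ∈ Ioo (0 : ℝ) (3 / 4),
          |leftFst γ u z t ^ (-β) - leftFst γ u z t' ^ (-β)| ≤ β * K * ((1 / 4) ^ (j + 1) * d) := by
        intro z hz
        refine (abs_leftFst_rpow_sub_le hu hb hβ ⟨hz.1, hz.2.le⟩ t t').trans ?_
        have h1 : z ^ (γ - β) ≤ 1 :=
          Real.rpow_le_one hz.1.le (hz.2.le.trans (by norm_num)) (by linarith)
        have h2 := Real.rpow_nonneg hz.1.le (γ - β)
        calc β * K * z ^ (γ - β) * |t - t'| ≤ β * K * 1 * ((1 / 4) ^ (j + 1) * d) := by gcongr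
          _ = _ := by ring
      have hstep : |x ^ (-β) - x' ^ (-β)| ≤
          |leftFst γ u x t ^ (-β) - leftFst γ u x' t' ^ (-β)|
            + β * K * ((1 / 4) ^ (j + 1) * d) := by
        rcases le_total x x' with hxx | hxx
        · have h1 := hmono x x' t hx.1 hxx hxr'
          have h2 : x' ^ (-β) ≤ x ^ (-β) := Real.rpow_le_rpow_of_nonpos hx.1 hxx (by linarith)
          have h3 := neg_le_of_abs_le (hangle x' hx')
          have h4 := le_abs_self (leftFst γ u x t ^ (-β) - leftFst γ u x' t' ^ (-β))
          rw [abs_of_nonneg (by linarith)]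
          linarith
        · have h1 := hmono x' x t' hx'.1 hxx hxr
          have h2 : x ^ (-β) ≤ x' ^ (-β) := Real.rpow_le_rpow_of_nonpos hx'.1 hxx (by linarith)
          have h3 := (le_abs_self _).trans (hangle x hx)
          have h4 := neg_abs_le (leftFst γ u x t ^ (-β) - leftFst γ u x' t' ^ (-β))
          rw [abs_of_nonpos (by linarith)]
          linarith
      refine hstep.trans ?_
      have hpow : (1 / 4 : ℝ) ^ (j + 1) + (1 / 4) ^ (j + 1) ≤ (1 / 4) ^ j := by
        have : (0 : ℝ) < (1 / 4) ^ j := by positivity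
        rw [pow_succ]; linarith
      have : β * K * ((2 - (1 / 4 : ℝ) ^ j) + (1 / 4) ^ (j + 1))
          ≤ β * K * (2 - (1 / 4) ^ (j + 1)) := by gcongr; linarith
      nlinarith
  intro j i hij
  refine (main j i hij).trans ?_
  have : (0 : ℝ) < (1 / 4) ^ j := by positivity
  gcongr
  linarith

lemma rpow_mul_abs_sub_le (hγ : 0 < γ) {x x' : ℝ} (hx : 0 < x) (hx' : 0 < x') :
    x' ^ γ * |x - x'| ≤ |x ^ (γ + 1) - x' ^ (γ + 1)| := by
  rw [Real.rpow_add_one hx.ne', Real.rpow_add_one hx'.ne']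
  rcases le_total x x' with h | h
  · have h1 := Real.rpow_le_rpow hx.le h hγ.le
    refine le_trans ?_ (neg_le_abs _)
    rw [abs_of_nonpos (by linarith)]
    nlinarith
  · have h1 := Real.rpow_le_rpow hx'.le h hγ.le
    refine le_trans ?_ (le_abs_self _)
    rw [abs_of_nonneg (by linarith)]
    nlinarith

/-- The increments of `dx` in terms of those of `x ^ (-β)`, with the weights `x ^ (γ + β)` that are
summable along orbits. -/
lemma abs_dx_sub_le {c K β : ℝ} (hu : IsAdmissible γ u) (hb : Bounds u c K) (hβ : 0 < β)
    {x x' : ℝ} (hx : x ∈ Ioo (0 : ℝ) (3 / 4)) (hx' : x' ∈ Ioo (0 : ℝ) (3 / 4)) (θ θ' : ℝ) :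
    |dx γ u x θ - dx γ u x' θ'| ≤ (2 + γ) * K *
      (2 * ((1 + γ) / β * (x ^ (γ + β) + x' ^ (γ + β)) * |x ^ (-β) - x' ^ (-β)|) + |θ - θ'|) := by
  have hγ := hu.gamma_pos
  have hK := hb.one_le
  have hxc := Ioo_subset_Icc_self hx
  have hxc' := Ioo_subset_Icc_self hx'
  have hσ := abs_nonneg (x ^ (-β) - x' ^ (-β))
  set Q := (1 + γ) / β * (x ^ (γ + β) + x' ^ (γ + β)) * |x ^ (-β) - x' ^ (-β)| with hQ
  have hP := Real.rpow_nonneg hx.1.le (γ + β)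
  have hP' := Real.rpow_nonneg hx'.1.le (γ + β)
  have h1 : |x ^ γ - x' ^ γ| ≤ Q := by
    refine (abs_rpow_sub_le hx.1 hx'.1 hγ.le hβ).trans ?_
    rw [hQ]
    gcongr
    linarith
  have h2 : |x ^ (γ + 1) - x' ^ (γ + 1)| ≤ Q := by
    refine (abs_rpow_sub_le hx.1 hx'.1 (by linarith : 0 ≤ γ + 1) hβ).trans ?_
    have e : ∀ z ∈ Ioo (0 : ℝ) (3 / 4), z ^ (γ + 1 + β) ≤ z ^ (γ + β) := fun z hz =>
      Real.rpow_le_rpow_of_exponent_ge hz.1 (hz.2.le.trans (by norm_num)) (by linarith)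
    rw [hQ, add_comm γ 1]
    have e1 := e x hx
    have e2 := e x' hx'
    rw [add_comm γ 1] at e1 e2
    gcongr
  have h3 : x' ^ γ * |x - x'| ≤ Q := (rpow_mul_abs_sub_le hγ hx.1 hx'.1).trans h2
  have hxγ := Real.rpow_nonneg hx'.1.le γ
  have hxγ1 := rpow_le_one_of_mem hγ hxc'
  have hu1 : |u x θ| ≤ K := by
    rw [abs_of_pos (hu.pos x hxc θ)]; exact hb.u_le x hxc θ
  have hT := abs_nonneg (θ - θ')
  have hlip : ∀ D : ℝ, |D| ≤ K * (|x - x'| + |θ - θ'|) → |x' ^ γ * D| ≤ K * (Q + |θ - θ'|) := by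
    intro D hD
    rw [abs_mul, abs_of_nonneg hxγ]
    calc x' ^ γ * |D| ≤ x' ^ γ * (K * (|x - x'| + |θ - θ'|)) := by gcongr
      _ = K * (x' ^ γ * |x - x'| + x' ^ γ * |θ - θ'|) := by ring
      _ ≤ K * (Q + 1 * |θ - θ'|) := by gcongr
      _ = _ := by ring
  have h4 := hlip _ (hb.u_lip x hxc x' hxc' θ θ')
  have h5 := hlip _ (hb.ux_lip x hxc x' hxc' θ θ')
  have h6 : |x' ^ γ * x' * (ux u x θ - ux u x' θ')| ≤ K * (Q + |θ - θ'|) := by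
    rw [mul_assoc, mul_left_comm, abs_mul, abs_of_pos hx'.1]
    have := abs_nonneg (x' ^ γ * (ux u x θ - ux u x' θ'))
    nlinarith [hx'.2]
  have h7 : |(x ^ γ - x' ^ γ) * u x θ| ≤ Q * K := by
    rw [abs_mul]; gcongr
  have h8 : |(x ^ (γ + 1) - x' ^ (γ + 1)) * ux u x θ| ≤ Q * K := by
    rw [abs_mul]; gcongr; exact hb.abs_ux_le x hxc θ
  have hdec : dx γ u x θ - dx γ u x' θ' =
      (1 + γ) * ((x ^ γ - x' ^ γ) * u x θ + x' ^ γ * (u x θ - u x' θ'))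
      + ((x ^ (γ + 1) - x' ^ (γ + 1)) * ux u x θ + x' ^ γ * x' * (ux u x θ - ux u x' θ')) := by
    rw [Real.rpow_add_one hx.1.ne', Real.rpow_add_one hx'.1.ne', dx, dx]; ring
  rw [hdec]
  refine (abs_add_le _ _).trans ?_
  rw [abs_mul, abs_of_pos (by linarith : 0 < 1 + γ)]
  have h9 := (abs_add_le _ _).trans (add_le_add h7 h4)
  have h10 := (abs_add_le _ _).trans (add_le_add h8 h6)
  have h11 := mul_le_mul_of_nonneg_left h9 (by linarith : 0 ≤ 1 + γ)
  refine (add_le_add h11 h10).trans (le_of_eq ?_)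
  ring

lemma sum_rpow_orb_le {c K β : ℝ} (hu : IsAdmissible γ u) (hb : Bounds u c K) (hβ : 0 < β)
    {k : ℕ} {y θ : ℝ} (h : ∀ i < k, orb γ u i y θ ∈ Ioo (0 : ℝ) (3 / 4)) :
    ∑ i ∈ Finset.range k, orb γ u i y θ ^ (γ + β) ≤ (β * c / (1 + c))⁻¹ := by
  have hc := hb.c_pos
  have hpos : 0 < β * c / (1 + c) := by positivity
  rcases Nat.eq_zero_or_pos k with rfl | hk
  · simpa using (inv_pos.2 hpos).le
  have h1 : β * c / (1 + c) * ∑ i ∈ Finset.range k, orb γ u i y θ ^ (γ + β) ≤ 1 := by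
    rw [Finset.mul_sum]
    have h2 : ∀ i ∈ Finset.range k, β * c / (1 + c) * orb γ u i y θ ^ (γ + β)
        ≤ orb γ u (i + 1) y θ ^ β - orb γ u i y θ ^ β := by
      intro i hi
      have hi := h i (Finset.mem_range.1 hi)
      rw [orb_succ, ext_of_mem (Ioo_subset_Icc_self hi)]
      exact rpow_add_le_sub hu hb hβ ⟨hi.1, hi.2.le⟩ _
    refine (Finset.sum_le_sum h2).trans ?_
    rw [Finset.sum_range_sub (fun i => orb γ u i y θ ^ β)]
    have h0 := Real.rpow_nonneg (h 0 hk).1.le β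
    obtain ⟨l, rfl⟩ : ∃ l, k = l + 1 := ⟨k - 1, by omega⟩
    have hl := h l (by omega)
    have hk1 : orb γ u (l + 1) y θ ^ β ≤ 1 := by
      rw [orb_succ, ext_of_mem (Ioo_subset_Icc_self hl)]
      exact Real.rpow_le_one (leftFst_pos hu ⟨hl.1, hl.2.le⟩ _).le
        (hu.le_one _ (Ioo_subset_Icc_self hl) _) hβ.le
    linarith
  rw [← one_div, le_div_iff₀' hpos]
  exact h1

/-- Bounded distortion of the derivative in `y` along orbits that stay in the strip until they
pass `3/4`. -/
lemma exists_dorb_distortion (hu : IsAdmissible γ u) :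
    ∃ C, 0 < C ∧ ∀ k y θ y' θ' d, 0 ≤ d →
      (∀ i < k, orb γ u i y θ ∈ Ioo (0 : ℝ) (3 / 4)) →
      (∀ i < k, orb γ u i y' θ' ∈ Ioo (0 : ℝ) (3 / 4)) →
      3 / 4 ≤ orb γ u k y θ → 3 / 4 ≤ orb γ u k y' θ' →
      (orb γ u k y' θ' - orb γ u k y θ) ^ 2 + (4 ^ (k + 1) * θ' - 4 ^ (k + 1) * θ) ^ 2 ≤ d ^ 2 →
      dorb γ u k y θ ≤ Real.exp (C * d) * dorb γ u k y' θ' := by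
  obtain ⟨c, K, hb⟩ := hu.exists_bounds
  have hγ := hu.gamma_pos
  have hK := hb.one_le
  have hc := hb.c_pos
  set β := γ / 2 with hβ
  have hβ0 : 0 < β := by linarith
  obtain ⟨C₁, hC₁, hσ⟩ := exists_rpow_neg_orb_bound hu hβ0 (by linarith)
  set S := (β * c / (1 + c))⁻¹ with hS
  have hS0 : 0 < S := by positivity
  refine ⟨(2 + γ) * K * (2 * ((1 + γ) / β * (S + S) * C₁) + 1), by positivity, ?_⟩
  intro k y θ y' θ' d hd h h' hk hk' hdist
  have hθ : 4 ^ (k + 1) * |θ - θ'| ≤ d := by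
    have h1 : |4 ^ (k + 1) * θ' - 4 ^ (k + 1) * θ| ≤ d := by
      refine abs_le_of_sq_le_sq ?_ hd
      nlinarith [sq_nonneg (orb γ u k y' θ' - orb γ u k y θ)]
    rwa [← mul_sub, abs_mul, abs_of_pos (by positivity), abs_sub_comm] at h1
  set a : ℕ → ℝ := fun i => dx γ u (orb γ u i y θ) (4 ^ (i + 1) * θ) with ha
  set a' : ℕ → ℝ := fun i => dx γ u (orb γ u i y' θ') (4 ^ (i + 1) * θ') with ha'
  have hterm : ∀ i ∈ Finset.range k, |a i - a' i| ≤ (2 + γ) * K *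
      (2 * ((1 + γ) / β * (orb γ u i y θ ^ (γ + β) + orb γ u i y' θ' ^ (γ + β)) * (C₁ * d))
        + ((1 / 4) ^ (k - (i + 1)) - (1 / 4) ^ (k - i)) * d) := by
    intro i hi
    have hi := Finset.mem_range.1 hi
    refine (abs_dx_sub_le hu hb hβ0 (h i hi) (h' i hi) _ _).trans ?_
    have h1 := hσ k y θ y' θ' d hd h h' hk hk' hdist (k - i) i (by omega)
    have h2 := Real.rpow_nonneg (h i hi).1.le (γ + β)
    have h3 := Real.rpow_nonneg (h' i hi).1.le (γ + β)
    have h4 : |4 ^ (i + 1) * θ - 4 ^ (i + 1) * θ'|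
        ≤ ((1 / 4) ^ (k - (i + 1)) - (1 / 4) ^ (k - i)) * d := by
      have e1 : |4 ^ (i + 1) * θ - 4 ^ (i + 1) * θ'| = 4 ^ (i + 1) * |θ - θ'| := by
        rw [← mul_sub, abs_mul, abs_of_pos (by positivity)]
      have e2 : (4 : ℝ) ^ (k + 1) = 4 ^ (i + 1) * 4 ^ (k - i) := by
        rw [← pow_add]; congr 1; omega
      have e3 : (1 / 4 : ℝ) ^ (k - i) = (1 / 4) ^ (k - (i + 1)) * (1 / 4) := by
        rw [← pow_succ]; congr 1; omega
      have e4 : (4 : ℝ) ^ (k - i) * (1 / 4) ^ (k - i) = 1 := by rw [← mul_pow]; norm_num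
      have e5 : 0 < (1 / 4 : ℝ) ^ (k - i) := by positivity
      rw [e2] at hθ
      have e6 : 4 ^ (i + 1) * |θ - θ'| ≤ (1 / 4) ^ (k - i) * d := by
        have := mul_le_mul_of_nonneg_left hθ e5.le
        calc 4 ^ (i + 1) * |θ - θ'| = 4 ^ (i + 1) * |θ - θ'| * (4 ^ (k - i) * (1 / 4) ^ (k - i)) := by
              rw [e4, mul_one]
          _ ≤ _ := by linarith
      rw [e1]
      refine e6.trans ?_
      gcongr
      linarith
    gcongr
  have hsum : ∑ i ∈ Finset.range k, |a i - a' i| ≤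
      (2 + γ) * K * (2 * ((1 + γ) / β * (S + S) * C₁) + 1) * d := by
    refine (Finset.sum_le_sum hterm).trans ?_
    rw [← Finset.mul_sum, Finset.sum_add_distrib, ← Finset.mul_sum, ← Finset.sum_mul,
      ← Finset.mul_sum, Finset.sum_add_distrib, ← Finset.sum_mul,
      Finset.sum_range_sub (fun i => (1 / 4 : ℝ) ^ (k - i))]
    have h1 := sum_rpow_orb_le hu hb hβ0 h
    have h2 := sum_rpow_orb_le hu hb hβ0 h'
    have h3 : (1 / 4 : ℝ) ^ (k - k) - (1 / 4) ^ (k - 0) ≤ 1 := by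
      have : (0 : ℝ) ≤ (1 / 4) ^ (k - 0) := by positivity
      simp only [Nat.sub_self, pow_zero] at *
      linarith
    calc _ ≤ (2 + γ) * K * (2 * ((1 + γ) / β * (S + S) * (C₁ * d)) + 1 * d) := by gcongr
      _ = _ := by ring
  have ha1 : ∀ i ∈ Finset.range k, 1 ≤ a i := fun i hi =>
    one_le_dx hu (h i (Finset.mem_range.1 hi)) _
  have ha1' : ∀ i ∈ Finset.range k, 1 ≤ a' i := fun i hi =>
    one_le_dx hu (h' i (Finset.mem_range.1 hi)) _
  have hprod : ∏ i ∈ Finset.range k, a i ≤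
      Real.exp (∑ i ∈ Finset.range k, |a i - a' i|) * ∏ i ∈ Finset.range k, a' i := by
    rw [Real.exp_sum, ← Finset.prod_mul_distrib]
    refine Finset.prod_le_prod (fun i hi => by linarith [ha1 i hi]) fun i hi => ?_
    have h1 := Real.add_one_le_exp |a i - a' i|
    have h2 := le_abs_self (a i - a' i)
    have h3 := ha1' i hi
    have h4 := abs_nonneg (a i - a' i)
    nlinarith
  have hprod0 : 0 ≤ ∏ i ∈ Finset.range k, a' i :=
    Finset.prod_nonneg fun i hi => by linarith [ha1' i hi]
  have hexp := Real.exp_le_exp.2 hsum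
  unfold dorb
  have := hprod.trans (mul_le_mul_of_nonneg_right hexp hprod0)
  simp only [ha, ha'] at this
  linarith

/-! ### The return time and the return map -/

lemma X_subset_M : X γ u ⊆ M := by
  intro z hz
  simp only [X, mem_iUnion] at hz
  obtain ⟨i, -, hz⟩ := hz
  exact hz.1

lemma mem_Y_iff {z : Plane} : z ∈ Y γ u ↔ z ∈ X γ u ∧ 3 / 4 ≤ z 0 :=
  ⟨fun h => ⟨h.2, h.1.1⟩, fun h => ⟨⟨h.2, (X_subset_M h.1).1.2⟩, h.1⟩⟩

lemma leftFst_fract (hu : IsAdmissible γ u) {x : ℝ} (hx : x ∈ Icc (0 : ℝ) (3 / 4)) (θ : ℝ) :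
    leftFst γ u x (Int.fract θ) = leftFst γ u x θ := by
  have hper : Function.Periodic (fun t => u x t) 1 := hu.periodic x hx
  have h := hper.sub_zsmul_eq ⌊θ⌋ (x := θ)
  simp only [zsmul_eq_mul, mul_one] at h
  rw [leftFst, leftFst, Int.fract, h]

lemma fract_four_mul_fract (t : ℝ) : Int.fract (4 * Int.fract t) = Int.fract (4 * t) := by
  have : 4 * Int.fract t = 4 * t - ((4 * ⌊t⌋ : ℤ) : ℝ) := by
    rw [Int.fract]; push_cast; ring
  rw [this, Int.fract_sub_intCast]

lemma f_apply (z : Plane) : f γ u z = !₂[f₁ γ u (z 0) (z 1), Int.fract (4 * z 1)] := rfl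

/-- Before the first return, the orbit of `f` is described by the lifted orbit. -/
lemma iterate_f_eq (hu : IsAdmissible γ u) {w : Plane} (hw : 3 / 4 < w 0) {k : ℕ}
    (h : ∀ i < k, orb γ u i (w 0) (w 1) ≤ 3 / 4) :
    (f γ u)^[k + 1] w = !₂[orb γ u k (w 0) (w 1), Int.fract (4 ^ (k + 1) * w 1)] := by
  induction k with
  | zero =>
    rw [zero_add, Function.iterate_one, f_apply, f₁, if_neg (not_le.2 hw)]
    simp [orb]
  | succ k ih =>
    have hk := h k (by omega)
    have hk0 : 0 ≤ orb γ u k (w 0) (w 1) := ((orb_pos_iff hu k).2 hw).le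
    rw [Function.iterate_succ_apply', ih fun i hi => h i (by omega), f_apply]
    simp only [Matrix.cons_val_zero, Matrix.cons_val_one]
    rw [f₁, if_pos hk, leftFst_fract hu ⟨hk0, hk⟩, fract_four_mul_fract, orb_succ,
      ext_of_mem ⟨hk0, hk⟩]
    congr 3
    ring_nf

lemma iterate_mem_X (hX : MapsTo (f γ u) (X γ u) (X γ u)) {w : Plane} (hw : w ∈ Y γ u) (n : ℕ) :
    (f γ u)^[n] w ∈ X γ u := hX.iterate n hw.2

lemma φ_eq (hu : IsAdmissible γ u) (hX : MapsTo (f γ u) (X γ u) (X γ u)) {w : Plane}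
    (hw : w ∈ Y γ u) (hw0 : 3 / 4 < w 0) {k : ℕ} (h : ∀ i < k, orb γ u i (w 0) (w 1) < 3 / 4)
    (hk : 3 / 4 ≤ orb γ u k (w 0) (w 1)) : φ γ u w = k + 1 := by
  have hit : ∀ i ≤ k, ((f γ u)^[i + 1] w ∈ Y γ u ↔ 3 / 4 ≤ orb γ u i (w 0) (w 1)) := by
    intro i hi
    rw [mem_Y_iff, iterate_f_eq hu hw0 fun l hl => (h l (by omega)).le]
    simp only [Matrix.cons_val_zero, and_iff_right_iff_imp]
    intro _
    rw [← iterate_f_eq hu hw0 fun l hl => (h l (by omega)).le]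
    exact iterate_mem_X hX hw _
  apply le_antisymm
  · exact Nat.sInf_le ⟨by omega, (hit k le_rfl).2 hk⟩
  · refine le_csInf ⟨k + 1, by omega, (hit k le_rfl).2 hk⟩ ?_
    rintro n ⟨hn, hnY⟩
    by_contra! hlt
    obtain ⟨i, rfl⟩ : ∃ i, n = i + 1 := ⟨n - 1, by omega⟩
    have := (hit i (by omega)).1 hnY
    linarith [h i (by omega)]

lemma exists_orb_return (hu : IsAdmissible γ u) {y : ℝ} (hy : 3 / 4 < y) (θ : ℝ) :
    ∃ k, (∀ i < k, orb γ u i y θ < 3 / 4) ∧ 3 / 4 ≤ orb γ u k y θ := by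
  obtain ⟨N, hN⟩ := exists_reach hu ((orb_pos_iff (θ := θ) hu 0).2 hy)
  have hex : ∃ k, 3 / 4 ≤ orb γ u k y θ := ⟨_, hN 0 y θ le_rfl⟩
  classical
  exact ⟨Nat.find hex, fun i hi => not_le.1 (Nat.find_min hex hi), Nat.find_spec hex⟩

lemma mem_level_iff (hu : IsAdmissible γ u) (hX : MapsTo (f γ u) (X γ u) (X γ u)) {w : Plane}
    (hw : w ∈ Y γ u) (hw0 : 3 / 4 < w 0) (k : ℕ) :
    w ∈ level γ u (k + 1) ↔
      (∀ i < k, orb γ u i (w 0) (w 1) < 3 / 4) ∧ 3 / 4 ≤ orb γ u k (w 0) (w 1) := by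
  constructor
  · rintro ⟨-, hφ⟩
    obtain ⟨l, hl, hl'⟩ := exists_orb_return hu hw0 (w 1)
    have := φ_eq hu hX hw hw0 hl hl'
    obtain rfl : l = k := by omega
    exact ⟨hl, hl'⟩
  · rintro ⟨h, hk⟩
    exact ⟨hw, φ_eq hu hX hw hw0 h hk⟩

lemma F_eq (hu : IsAdmissible γ u) (hX : MapsTo (f γ u) (X γ u) (X γ u)) {w : Plane}
    (hw : w ∈ Y γ u) (hw0 : 3 / 4 < w 0) {k : ℕ} (h : ∀ i < k, orb γ u i (w 0) (w 1) < 3 / 4)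
    (hk : 3 / 4 ≤ orb γ u k (w 0) (w 1)) :
    F γ u w = !₂[orb γ u k (w 0) (w 1), Int.fract (4 ^ (k + 1) * w 1)] := by
  rw [F, φ_eq hu hX hw hw0 h hk, iterate_f_eq hu hw0 fun i hi => (h i hi).le]

lemma F_mem_Y (hu : IsAdmissible γ u) (hX : MapsTo (f γ u) (X γ u) (X γ u)) {w : Plane}
    (hw : w ∈ Y γ u) (hw0 : 3 / 4 < w 0) : F γ u w ∈ Y γ u := by
  obtain ⟨k, h, hk⟩ := exists_orb_return hu hw0 (w 1)
  rw [mem_Y_iff]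
  refine ⟨iterate_mem_X hX hw _, ?_⟩
  rw [F_eq hu hX hw hw0 h hk]
  simpa using hk

/-! ### The cells of the partition -/

lemma eventually_shift_fst_mem {S : Set Plane} {w : Plane} (h : w ∈ interior S) :
    ∀ᶠ s in 𝓝 (0 : ℝ), (!₂[w 0 + s, w 1] : Plane) ∈ S := by
  have hc : Continuous (fun s : ℝ => (!₂[w 0 + s, w 1] : Plane)) := by fun_prop
  have hw : (!₂[w 0 + 0, w 1] : Plane) = w := by ext i; fin_cases i <;> simp
  have := hc.tendsto 0
  rw [hw] at this
  exact this (mem_interior_iff_mem_nhds.1 h)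

lemma eventually_shift_snd_mem {S : Set Plane} {w : Plane} (h : w ∈ interior S) :
    ∀ᶠ s in 𝓝 (0 : ℝ), (!₂[w 0, w 1 + s] : Plane) ∈ S := by
  have hc : Continuous (fun s : ℝ => (!₂[w 0, w 1 + s] : Plane)) := by fun_prop
  have hw : (!₂[w 0, w 1 + 0] : Plane) = w := by ext i; fin_cases i <;> simp
  have := hc.tendsto 0
  rw [hw] at this
  exact this (mem_interior_iff_mem_nhds.1 h)

lemma exists_neg_of_eventually {P : ℝ → Prop} (h : ∀ᶠ s in 𝓝 (0 : ℝ), P s) : ∃ s < 0, P s := by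
  obtain ⟨s, hs, hs'⟩ := ((h.filter_mono nhdsWithin_le_nhds).and
    (self_mem_nhdsWithin : Iio (0 : ℝ) ∈ 𝓝[<] 0)).exists
  exact ⟨s, hs', hs⟩

lemma exists_pos_of_eventually {P : ℝ → Prop} (h : ∀ᶠ s in 𝓝 (0 : ℝ), P s) : ∃ s > 0, P s := by
  obtain ⟨s, hs, hs'⟩ := ((h.filter_mono nhdsWithin_le_nhds).and
    (self_mem_nhdsWithin : Ioi (0 : ℝ) ∈ 𝓝[>] 0)).exists
  exact ⟨s, hs', hs⟩

lemma lt_fst_of_mem_interior_Y {w : Plane} (h : w ∈ interior (Y γ u)) : 3 / 4 < w 0 := by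
  obtain ⟨s, hs, hsY⟩ := exists_neg_of_eventually (eventually_shift_fst_mem h)
  have := hsY.1.1
  simp only [Matrix.cons_val_zero] at this
  linarith

lemma snd_mem_of_mem_interior_Y {w : Plane} (h : w ∈ interior (Y γ u)) :
    w 1 ∈ Ioo (0 : ℝ) 1 := by
  refine ⟨?_, (X_subset_M (interior_subset h).2).2.2⟩
  obtain ⟨s, hs, hsY⟩ := exists_neg_of_eventually (eventually_shift_snd_mem h)
  have := (X_subset_M hsY.2).2.1
  simp only [Matrix.cons_val_one, Matrix.cons_val_fin_one] at this
  linarith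

/-- The open set of points of `Y` with return time `k + 1`, described by the lifted orbit. -/
lemma mem_interior_level_of (hu : IsAdmissible γ u) (hX : MapsTo (f γ u) (X γ u) (X γ u)) {k : ℕ}
    {w : Plane} (hw : w ∈ interior (Y γ u)) (h : ∀ i < k, orb γ u i (w 0) (w 1) < 3 / 4)
    (hk : 3 / 4 < orb γ u k (w 0) (w 1)) : w ∈ interior (level γ u (k + 1)) := by
  rw [mem_interior_iff_mem_nhds]
  have h1 : ∀ᶠ z in 𝓝 w, ∀ i ∈ Finset.range k, orb γ u i (z 0) (z 1) < 3 / 4 := by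
    rw [Filter.eventually_all_finset]
    intro i hi
    exact (continuous_orb_plane hu i).continuousAt.eventually_lt_const
      (h i (Finset.mem_range.1 hi))
  have h2 : ∀ᶠ z in 𝓝 w, 3 / 4 < orb γ u k (z 0) (z 1) :=
    (continuous_orb_plane hu k).continuousAt.eventually_const_lt hk
  filter_upwards [h1, h2, isOpen_interior.mem_nhds hw] with z hz1 hz2 hz3
  exact (mem_level_iff hu hX (interior_subset hz3) (lt_fst_of_mem_interior_Y hz3) k).2
    ⟨fun i hi => hz1 i (Finset.mem_range.2 hi), hz2.le⟩

lemma mem_interior_level_iff (hu : IsAdmissible γ u) (hX : MapsTo (f γ u) (X γ u) (X γ u))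
    {k : ℕ} {w : Plane} : w ∈ interior (level γ u (k + 1)) ↔
      w ∈ interior (Y γ u) ∧ (∀ i < k, orb γ u i (w 0) (w 1) < 3 / 4) ∧
        3 / 4 < orb γ u k (w 0) (w 1) := by
  refine ⟨fun h => ?_, fun h => mem_interior_level_of hu hX h.1 h.2.1 h.2.2⟩
  have hY : w ∈ interior (Y γ u) := interior_mono (fun z hz => hz.1) h
  have hw0 := lt_fst_of_mem_interior_Y hY
  obtain ⟨h1, h2⟩ := (mem_level_iff hu hX (interior_subset hY) hw0 k).1 (interior_subset h)
  refine ⟨hY, h1, ?_⟩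
  have hev : ∀ᶠ s in 𝓝 (0 : ℝ), 3 / 4 < w 0 + s := by
    have : Continuous fun s : ℝ => w 0 + s := by fun_prop
    exact this.continuousAt.eventually_const_lt (by simpa using hw0)
  obtain ⟨s, hs, hs1, hs2⟩ := exists_neg_of_eventually ((eventually_shift_fst_mem h).and hev)
  have h3 := ((mem_level_iff hu hX hs1.1 (by simpa using hs2) k).1 hs1).2
  simp only [Matrix.cons_val_zero, Matrix.cons_val_one] at h3
  exact h3.trans_lt (orb_strictMono hu k (w 1) (by linarith))

lemma cell_eq (n j : ℕ) : cell γ u n j =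
    interior (level γ u n) ∩ {z | z 1 ∈ Ioo (((j : ℝ) - 1) / 4 ^ n) ((j : ℝ) / 4 ^ n)} := by
  have hc : Continuous (fun z : Plane => z 1) := by fun_prop
  have : IsOpen {z : Plane | z 1 ∈ Ioo (((j : ℝ) - 1) / 4 ^ n) ((j : ℝ) / 4 ^ n)} :=
    isOpen_Ioo.preimage hc
  conv_rhs => rw [← this.interior_eq, ← interior_inter]
  rfl

lemma mem_cell_iff (hu : IsAdmissible γ u) (hX : MapsTo (f γ u) (X γ u) (X γ u)) {k j : ℕ}
    {w : Plane} : w ∈ cell γ u (k + 1) j ↔ w ∈ interior (Y γ u) ∧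
      (∀ i < k, orb γ u i (w 0) (w 1) < 3 / 4) ∧ 3 / 4 < orb γ u k (w 0) (w 1) ∧
      w 1 ∈ Ioo (((j : ℝ) - 1) / 4 ^ (k + 1)) ((j : ℝ) / 4 ^ (k + 1)) := by
  rw [cell_eq, mem_inter_iff, mem_interior_level_iff hu hX]
  simp only [mem_ofPred_eq, and_assoc]

lemma isOpen_cell (n j : ℕ) : IsOpen (cell γ u n j) := isOpen_interior

lemma orb_mem_of_mem_cell (hu : IsAdmissible γ u) (hX : MapsTo (f γ u) (X γ u) (X γ u))
    {k j : ℕ} {w : Plane} (hw : w ∈ cell γ u (k + 1) j) :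
    ∀ i < k, orb γ u i (w 0) (w 1) ∈ Ioo (0 : ℝ) (3 / 4) := fun i hi => by
  have h := (mem_cell_iff hu hX).1 hw
  exact ⟨(orb_pos_iff hu i).2 (lt_fst_of_mem_interior_Y h.1), h.2.1 i hi⟩

/-- The continuous map of the plane that agrees with the return map `F` on the cell
`Y_{k + 1, j}`. -/
def branchMap (γ : ℝ) (u : ℝ → ℝ → ℝ) (k j : ℕ) (w : Plane) : Plane :=
  !₂[orb γ u k (w 0) (w 1), 4 ^ (k + 1) * w 1 - ((j : ℝ) - 1)]

lemma continuous_branchMap (hu : IsAdmissible γ u) (k j : ℕ) :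
    Continuous (branchMap γ u k j) := by
  have := continuous_orb_plane hu k
  unfold branchMap
  fun_prop

lemma F_eq_branchMap (hu : IsAdmissible γ u) (hX : MapsTo (f γ u) (X γ u) (X γ u)) {k j : ℕ}
    {w : Plane} (hw : w ∈ cell γ u (k + 1) j) : F γ u w = branchMap γ u k j w := by
  obtain ⟨hY, h1, h2, h3⟩ := (mem_cell_iff hu hX).1 hw
  rw [F_eq hu hX (interior_subset hY) (lt_fst_of_mem_interior_Y hY) h1 h2.le, branchMap]
  have h4 : (0 : ℝ) < 4 ^ (k + 1) := by positivity
  have h5 : Int.fract (4 ^ (k + 1) * w 1) = 4 ^ (k + 1) * w 1 - ((j : ℝ) - 1) := by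
    rw [Int.fract_eq_iff]
    rw [mem_Ioo, div_lt_iff₀' h4, lt_div_iff₀' h4] at h3
    exact ⟨by linarith, by linarith, (j : ℤ) - 1, by push_cast; ring⟩
  rw [h5]

lemma dist_sq_eq (z w : Plane) : dist z w ^ 2 = (z 0 - w 0) ^ 2 + (z 1 - w 1) ^ 2 := by
  rw [EuclideanSpace.dist_sq_eq, Fin.sum_univ_two, Real.dist_eq, Real.dist_eq, sq_abs, sq_abs]

lemma dist_sq_branchMap (k j : ℕ) (w w' : Plane) :
    dist (branchMap γ u k j w) (branchMap γ u k j w') ^ 2 =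
      (orb γ u k (w 0) (w 1) - orb γ u k (w' 0) (w' 1)) ^ 2 +
        (4 ^ (k + 1) * w 1 - 4 ^ (k + 1) * w' 1) ^ 2 := by
  rw [dist_sq_eq]
  simp only [branchMap, Matrix.cons_val_zero, Matrix.cons_val_one]
  ring

/-- The return map expands distances by a factor at least `4` on every cell: the right branch of
`f` is a similarity of ratio `4`, and the left branch does not contract. -/
lemma four_mul_dist_le (hu : IsAdmissible γ u) {k j : ℕ} {w w' : Plane}
    (h : ∀ i < k, orb γ u i (w 0) (w 1) ∈ Icc (0 : ℝ) (3 / 4))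
    (h' : ∀ i < k, orb γ u i (w' 0) (w' 1) ∈ Icc (0 : ℝ) (3 / 4)) :
    4 * dist w w' ≤ dist (branchMap γ u k j w) (branchMap γ u k j w') := by
  refine abs_le_of_sq_le_sq' ?_ dist_nonneg |>.2
  have := orb_expanding hu (Nat.zero_le k) h' h
  simp only [orb, zero_add, pow_one] at this
  rw [dist_sq_branchMap, mul_pow, dist_sq_eq]
  refine le_trans (le_of_eq ?_) this
  ring

lemma four_mul_dist_le_dist_F (hu : IsAdmissible γ u) (hX : MapsTo (f γ u) (X γ u) (X γ u))
    {k j : ℕ} {w w' : Plane} (hw : w ∈ cell γ u (k + 1) j) (hw' : w' ∈ cell γ u (k + 1) j) :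
    4 * dist w w' ≤ dist (F γ u w) (F γ u w') := by
  rw [F_eq_branchMap hu hX hw, F_eq_branchMap hu hX hw']
  exact four_mul_dist_le hu (fun i hi => Ioo_subset_Icc_self (orb_mem_of_mem_cell hu hX hw i hi))
    fun i hi => Ioo_subset_Icc_self (orb_mem_of_mem_cell hu hX hw' i hi)

lemma injOn_F (hu : IsAdmissible γ u) (hX : MapsTo (f γ u) (X γ u) (X γ u)) (k j : ℕ) :
    InjOn (F γ u) (cell γ u (k + 1) j) := by
  intro w hw w' hw' h
  have := four_mul_dist_le_dist_F hu hX hw hw'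
  rw [h, dist_self] at this
  exact dist_le_zero.1 (by linarith)

lemma branchInv_F (hu : IsAdmissible γ u) (hX : MapsTo (f γ u) (X γ u) (X γ u)) {k j : ℕ}
    {w : Plane} (hw : w ∈ cell γ u (k + 1) j) :
    branchInv γ u (cell γ u (k + 1) j) (F γ u w) = w :=
  (injOn_F hu hX k j).leftInvOn_invFunOn hw

/-! ### Smoothness of the branches -/

lemma contDiffAt_F (hu : IsAdmissible γ u) (hX : MapsTo (f γ u) (X γ u) (X γ u)) {k j : ℕ}
    {w : Plane} (hw : w ∈ cell γ u (k + 1) j) : ContDiffAt ℝ 1 (F γ u) w := by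
  have h1 : ContDiffAt ℝ 1 (branchMap γ u k j) w := by
    rw [contDiffAt_euclidean]
    intro i
    fin_cases i
    · exact (contDiffAt_orb hu (orb_mem_of_mem_cell hu hX hw)).comp
        (f := fun w : Plane => (w 0, w 1)) w (by fun_prop)
    · change ContDiffAt ℝ 1 (fun w : Plane => 4 ^ (k + 1) * w 1 - ((j : ℝ) - 1)) w
      fun_prop
  refine h1.congr_of_eventuallyEq ?_
  filter_upwards [(isOpen_cell (k + 1) j).mem_nhds hw] with z hz
  exact F_eq_branchMap hu hX hz

lemma det_fderiv_F (hu : IsAdmissible γ u) (hX : MapsTo (f γ u) (X γ u) (X γ u)) {k j : ℕ}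
    {w : Plane} (hw : w ∈ cell γ u (k + 1) j) :
    (fderiv ℝ (F γ u) w).det = 4 ^ (k + 1) * dorb γ u k (w 0) (w 1) := by
  have hF : HasFDerivAt (F γ u) (fderiv ℝ (F γ u) w) w :=
    ((contDiffAt_F hu hX hw).differentiableAt one_ne_zero).hasFDerivAt
  have hev : F γ u =ᶠ[𝓝 w] branchMap γ u k j := by
    filter_upwards [(isOpen_cell (k + 1) j).mem_nhds hw] with z hz
    exact F_eq_branchMap hu hX hz
  set T := fderiv ℝ (F γ u) w with hT
  have hB : HasFDerivAt (branchMap γ u k j) T w := hF.congr_of_eventuallyEq hev.symm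
  have h1 : ∀ v : Plane, (T v) 1 = 4 ^ (k + 1) * v 1 := by
    intro v
    have e1 := (coord 1).hasFDerivAt.comp w hB
    have e2 : HasFDerivAt (fun z : Plane => 4 ^ (k + 1) * z 1 - ((j : ℝ) - 1))
        ((4 : ℝ) ^ (k + 1) • coord 1) w :=
      (((coord 1).hasFDerivAt (x := w)).const_mul ((4 : ℝ) ^ (k + 1))).sub_const _
    have e3 := congrArg (fun S => S v) (e1.unique (f := fun z : Plane =>
      4 ^ (k + 1) * z 1 - ((j : ℝ) - 1)) e2)
    simpa using e3
  have h0 : (T !₂[1, 0]) 0 = dorb γ u k (w 0) (w 1) := by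
    have hl : HasDerivAt (fun s : ℝ => (!₂[s, w 1] : Plane)) !₂[1, 0] (w 0) := by
      have e1 : (fun s : ℝ => (!₂[s, w 1] : Plane)) = fun s => w + (s - w 0) • !₂[1, 0] := by
        ext s i; fin_cases i <;> simp
      rw [e1]
      simpa using (((hasDerivAt_id (w 0)).sub_const (w 0)).smul_const
        (!₂[1, 0] : Plane)).const_add w
    have hw' : (!₂[w 0, w 1] : Plane) = w := by ext i; fin_cases i <;> simp
    have e0 : HasFDerivAt (branchMap γ u k j) T (!₂[w 0, w 1]) := by rw [hw']; exact hB
    have e1 := (coord 0).hasFDerivAt.comp_hasDerivAt (w 0) (e0.comp_hasDerivAt (w 0) hl)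
    have e2 := e1.unique (f := fun s => orb γ u k s (w 1))
      (hasDerivAt_orb hu (orb_mem_of_mem_cell hu hX hw))
    simpa using e2
  rw [ContinuousLinearMap.det, ← LinearMap.det_toMatrix (EuclideanSpace.basisFun (Fin 2) ℝ).toBasis,
    Matrix.det_fin_two]
  have hb : (EuclideanSpace.single (0 : Fin 2) (1 : ℝ)) = !₂[1, 0] := by
    ext i; fin_cases i <;> simp
  simp only [LinearMap.toMatrix_apply, OrthonormalBasis.coe_toBasis, OrthonormalBasis.coe_toBasis_repr_apply,
    EuclideanSpace.basisFun_apply, EuclideanSpace.basisFun_repr, ContinuousLinearMap.coe_coe, h1]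
  rw [hb, h0]
  simp
  ring

lemma det_fderiv_F_ne_zero (hu : IsAdmissible γ u) (hX : MapsTo (f γ u) (X γ u) (X γ u))
    {k j : ℕ} {w : Plane} (hw : w ∈ cell γ u (k + 1) j) : (fderiv ℝ (F γ u) w).det ≠ 0 := by
  rw [det_fderiv_F hu hX hw]
  have := four_le_dorb hu (orb_mem_of_mem_cell hu hX hw)
  positivity

lemma hasFDerivAt_F_equiv (hu : IsAdmissible γ u) (hX : MapsTo (f γ u) (X γ u) (X γ u))
    {k j : ℕ} {w : Plane} (hw : w ∈ cell γ u (k + 1) j) :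
    HasFDerivAt (F γ u) (((fderiv ℝ (F γ u) w).toContinuousLinearEquivOfDetNeZero
      (det_fderiv_F_ne_zero hu hX hw) : Plane ≃L[ℝ] Plane) : Plane →L[ℝ] Plane) w := by
  rw [ContinuousLinearMap.coe_toContinuousLinearEquivOfDetNeZero]
  exact ((contDiffAt_F hu hX hw).differentiableAt one_ne_zero).hasFDerivAt

lemma map_nhds_F (hu : IsAdmissible γ u) (hX : MapsTo (f γ u) (X γ u) (X γ u))
    {k j : ℕ} {w : Plane} (hw : w ∈ cell γ u (k + 1) j) :
    map (F γ u) (𝓝 w) = 𝓝 (F γ u w) :=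
  ((contDiffAt_F hu hX hw).hasStrictFDerivAt' (hasFDerivAt_F_equiv hu hX hw)
    one_ne_zero).map_nhds_eq_of_equiv

lemma isOpen_image_F (hu : IsAdmissible γ u) (hX : MapsTo (f γ u) (X γ u) (X γ u)) {k j : ℕ}
    {V : Set Plane} (hV : IsOpen V) (hVc : V ⊆ cell γ u (k + 1) j) : IsOpen (F γ u '' V) := by
  rw [isOpen_iff_mem_nhds]
  rintro _ ⟨w, hw, rfl⟩
  rw [← map_nhds_F hu hX (hVc hw)]
  exact image_mem_map (hV.mem_nhds hw)

/-- The branch of `F` on a cell, with its inverse, as a homeomorphism between open sets. -/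
def branchHomeo (hu : IsAdmissible γ u) (hX : MapsTo (f γ u) (X γ u) (X γ u)) (k j : ℕ) :
    OpenPartialHomeomorph Plane Plane :=
  OpenPartialHomeomorph.ofContinuousOpenRestrict
    ((injOn_F hu hX k j).toPartialEquiv (F γ u) (cell γ u (k + 1) j))
    (fun w hw => (contDiffAt_F (j := j) hu hX hw).continuousAt.continuousWithinAt)
    (fun V hV => by
      rw [domRestrict_eq, image_comp]
      refine isOpen_image_F (k := k) (j := j) hu hX ((isOpen_cell (k + 1) j).isOpenMap_subtype_val V hV) ?_
      rintro _ ⟨w, -, rfl⟩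
      exact w.2)
    (isOpen_cell (k + 1) j)

lemma contDiffAt_branchInv (hu : IsAdmissible γ u) (hX : MapsTo (f γ u) (X γ u) (X γ u))
    {k j : ℕ} {w : Plane} (hw : w ∈ cell γ u (k + 1) j) :
    ContDiffAt ℝ 1 (branchInv γ u (cell γ u (k + 1) j)) (F γ u w) := by
  have hinv : (branchHomeo hu hX k j).symm (F γ u w) = w := branchInv_F hu hX hw
  have := (branchHomeo hu hX k j).contDiffAt_symm (n := 1) (a := F γ u w) (mem_image_of_mem _ hw)
    (f₀' := (fderiv ℝ (F γ u) w).toContinuousLinearEquivOfDetNeZero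
      (det_fderiv_F_ne_zero hu hX hw)) (by rw [hinv]; exact hasFDerivAt_F_equiv hu hX hw)
    (by rw [hinv]; exact contDiffAt_F hu hX hw)
  exact this

lemma jacInv_F (hu : IsAdmissible γ u) (hX : MapsTo (f γ u) (X γ u) (X γ u))
    {k j : ℕ} {w : Plane} (hw : w ∈ cell γ u (k + 1) j) :
    jacInv γ u (cell γ u (k + 1) j) (F γ u w) = (4 ^ (k + 1) * dorb γ u k (w 0) (w 1))⁻¹ := by
  have hd := (contDiffAt_branchInv hu hX hw).differentiableAt one_ne_zero
  have h1 : HasFDerivAt (branchInv γ u (cell γ u (k + 1) j) ∘ F γ u)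
      ((fderiv ℝ (branchInv γ u (cell γ u (k + 1) j)) (F γ u w)).comp (fderiv ℝ (F γ u) w)) w :=
    hd.hasFDerivAt.comp w ((contDiffAt_F hu hX hw).differentiableAt one_ne_zero).hasFDerivAt
  have h2 : HasFDerivAt (branchInv γ u (cell γ u (k + 1) j) ∘ F γ u)
      (ContinuousLinearMap.id ℝ Plane) w := by
    refine (hasFDerivAt_id w).congr_of_eventuallyEq ?_
    filter_upwards [(isOpen_cell (k + 1) j).mem_nhds hw] with z hz
    exact branchInv_F hu hX hz
  have h3 := congrArg ContinuousLinearMap.det (h1.unique h2)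
  rw [ContinuousLinearMap.det, ContinuousLinearMap.toLinearMap_comp, LinearMap.det_comp,
    ContinuousLinearMap.det, ContinuousLinearMap.coe_id, LinearMap.det_id] at h3
  rw [jacInv, ← det_fderiv_F hu hX hw]
  exact eq_inv_of_mul_eq_one_left h3

lemma exists_eq_cell {a : Set Plane} (ha : a ∈ partitionY γ u) :
    ∃ k j : ℕ, a = cell γ u (k + 1) j := by
  obtain ⟨n, j, hn, -, -, rfl⟩ := ha
  exact ⟨n - 1, j, by rw [Nat.sub_add_cancel hn]⟩

theorem isDiffeoBranch (hu : IsAdmissible γ u) (hX : MapsTo (f γ u) (X γ u) (X γ u))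
    {a : Set Plane} (ha : a ∈ partitionY γ u) : IsDiffeoBranch γ u a := by
  obtain ⟨k, j, rfl⟩ := exists_eq_cell ha
  refine ⟨isOpen_cell _ _, injOn_F hu hX k j, isOpen_image_F hu hX (isOpen_cell _ _) le_rfl,
    fun w hw => (contDiffAt_F hu hX hw).contDiffWithinAt, ?_⟩
  rintro _ ⟨w, hw, rfl⟩
  exact (contDiffAt_branchInv hu hX hw).contDiffWithinAt

theorem uniformExpansion (hu : IsAdmissible γ u) (hX : MapsTo (f γ u) (X γ u) (X γ u)) {Λ : ℝ}
    (hΛ : 1 / 4 ≤ Λ) (ε₀ : ℝ) : UniformExpansion γ u Λ ε₀ := by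
  intro a ha z₁ hz₁ z₂ hz₂ _
  obtain ⟨k, j, rfl⟩ := exists_eq_cell ha
  obtain ⟨w₁, hw₁, rfl⟩ := hz₁
  obtain ⟨w₂, hw₂, rfl⟩ := hz₂
  rw [branchInv_F hu hX hw₁, branchInv_F hu hX hw₂]
  have h1 := four_mul_dist_le_dist_F hu hX hw₁ hw₂
  have h2 : 0 ≤ dist (F γ u w₁) (F γ u w₂) := dist_nonneg
  nlinarith

theorem exists_boundedDistortion (hu : IsAdmissible γ u)
    (hX : MapsTo (f γ u) (X γ u) (X γ u)) : ∃ C, 0 < C ∧ BoundedDistortion γ u C := by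
  obtain ⟨C, hC, h⟩ := exists_dorb_distortion hu
  refine ⟨C, hC, ?_⟩
  intro a ha z₁ hz₁ z₂ hz₂
  obtain ⟨k, j, rfl⟩ := exists_eq_cell ha
  obtain ⟨w₁, hw₁, rfl⟩ := hz₁
  obtain ⟨w₂, hw₂, rfl⟩ := hz₂
  have hd := dist_sq_branchMap (γ := γ) (u := u) k j w₁ w₂
  rw [← F_eq_branchMap hu hX hw₁, ← F_eq_branchMap hu hX hw₂] at hd
  have h1 := h k (w₂ 0) (w₂ 1) (w₁ 0) (w₁ 1) (dist (F γ u w₁) (F γ u w₂)) dist_nonneg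
    (orb_mem_of_mem_cell hu hX hw₂) (orb_mem_of_mem_cell hu hX hw₁)
    ((mem_cell_iff hu hX).1 hw₂).2.2.1.le ((mem_cell_iff hu hX).1 hw₁).2.2.1.le hd.ge
  have p1 := four_le_dorb hu (orb_mem_of_mem_cell hu hX hw₁)
  have p2 := four_le_dorb hu (orb_mem_of_mem_cell hu hX hw₂)
  rw [jacInv_F hu hX hw₁, jacInv_F hu hX hw₂, ← div_eq_mul_inv, inv_eq_one_div,
    div_le_div_iff₀ (by positivity) (by positivity)]
  have : (0 : ℝ) < 4 ^ (k + 1) := by positivity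
  nlinarith

/-! ### Bad points on horizontal lines -/

lemma volume_le_of_abs_sub_le {S : Set ℝ} {d : ℝ} (h : ∀ x ∈ S, ∀ y ∈ S, |x - y| ≤ d) :
    volume S ≤ ENNReal.ofReal d := by
  refine (Real.volume_le_diam S).trans (Metric.ediam_le fun x hx y hy => ?_)
  rw [edist_dist, Real.dist_eq]
  exact ENNReal.ofReal_le_ofReal (h x hx y hy)

/-- The points `y` of the horizontal line at height `θ` with return time `k + 1`. -/
def lineLevel (γ : ℝ) (u : ℝ → ℝ → ℝ) (θ : ℝ) (k : ℕ) : Set ℝ :=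
  {y | 3 / 4 < y ∧ (∀ i < k, orb γ u i y θ < 3 / 4) ∧ 3 / 4 ≤ orb γ u k y θ}

/-- The points of `lineLevel` that the return map brings `ε`-close to one of the two curved
vertical sides of the image; closeness to the right side is measured one step earlier, where that
side is the straight line `x = 3/4`. -/
def lineBad (γ : ℝ) (u : ℝ → ℝ → ℝ) (ε θ : ℝ) (k : ℕ) : Set ℝ :=
  {y | y ∈ lineLevel γ u θ k ∧
    (orb γ u k y θ ≤ 3 / 4 + ε ∨ ∃ l, k = l + 1 ∧ 3 / 4 - ε ≤ orb γ u l y θ)}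

lemma pairwise_disjoint_lineLevel (θ : ℝ) :
    Pairwise (Function.onFun Disjoint (lineLevel γ u θ)) := by
  intro k l hkl
  rw [Function.onFun, Set.disjoint_left]
  rintro y ⟨-, h1, h2⟩ ⟨-, h3, h4⟩
  rcases lt_or_gt_of_ne hkl with h | h
  · linarith [h3 k h]
  · linarith [h1 l h]

lemma lineLevel_succ (hu : IsAdmissible γ u) {θ c c' : ℝ} {l : ℕ}
    (hc : orb γ u (l + 1) c θ = 3 / 4) (hc' : orb γ u l c' θ = 3 / 4) :
    lineLevel γ u θ (l + 1) = Ico c c' := by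
  have hm := orb_strictMono hu (l + 1) θ
  have hm' := orb_strictMono hu l θ
  have hc0 : 3 / 4 < c := (orb_pos_iff hu (l + 1)).1 (by rw [hc]; norm_num)
  ext y
  constructor
  · rintro ⟨-, h1, h2⟩
    rw [← hc] at h2
    have h3 := h1 l (by omega)
    rw [← hc'] at h3
    exact ⟨hm.le_iff_le.1 h2, hm'.lt_iff_lt.1 h3⟩
  · rintro ⟨h1, h2⟩
    have hy : 3 / 4 < y := hc0.trans_le h1
    refine ⟨hy, fun i hi => ?_, ?_⟩
    · have h3 : orb γ u l y θ < 3 / 4 := by rw [← hc']; exact hm' h2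
      exact (orb_mono hu hy.le θ (Nat.lt_succ_iff.1 hi)).trans_lt h3
    · rw [← hc]; exact hm.monotone h1

/-- On each level the bad points make up at most a fraction of order `ε`, uniformly in the level:
the return map restricted to the line has bounded distortion and maps onto an interval of definite
length. -/
lemma exists_volume_lineBad_le (hu : IsAdmissible γ u) : ∃ C, 0 < C ∧ ∀ ε θ : ℝ, 0 < ε →
    ∀ k, 0 < k → volume (lineBad γ u ε θ k) ≤ ENNReal.ofReal (C * ε) * volume (lineLevel γ u θ k) := by
  obtain ⟨c₀, K, hb⟩ := hu.exists_bounds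
  obtain ⟨C, hC, hdist⟩ := exists_dorb_distortion hu
  have hγ := hu.gamma_pos
  have hK := hb.one_le
  set A := 1 + (2 + γ) * K with hA
  have hA0 : 0 < A := by positivity
  set E := Real.exp (C * 1) with hE
  have hE0 : 0 < E := Real.exp_pos _
  refine ⟨E * (16 / 3) + E * (16 / 3) * A, by positivity, ?_⟩
  intro ε θ hε k hk
  obtain ⟨l, rfl⟩ : ∃ l, k = l + 1 := ⟨k - 1, by omega⟩
  obtain ⟨c, -, hc⟩ := exists_orb_eq hu (l + 1) θ (v := 3 / 4) (by norm_num)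
  obtain ⟨c', -, hc'⟩ := exists_orb_eq hu l θ (v := 3 / 4) (by norm_num)
  have hset := lineLevel_succ hu hc hc'
  have hcc : c < c' := by
    refine (orb_strictMono hu (l + 1) θ).lt_iff_lt.1 ?_
    rw [hc]
    linarith [lt_orb_of_lt hu (Nat.lt_succ_self l) hc'.ge]
  have hmem : ∀ y ∈ Ioo c c', (∀ i < l + 1, orb γ u i y θ ∈ Ioo (0 : ℝ) (3 / 4)) ∧
      3 / 4 ≤ orb γ u (l + 1) y θ ∧ orb γ u (l + 1) y θ ≤ 1 := by
    intro y hy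
    have h1 : y ∈ lineLevel γ u θ (l + 1) := by rw [hset]; exact Ioo_subset_Ico_self hy
    have h2 : ∀ i < l + 1, orb γ u i y θ ∈ Ioo (0 : ℝ) (3 / 4) :=
      fun i hi => ⟨(orb_pos_iff hu i).2 h1.1, h1.2.1 i hi⟩
    refine ⟨h2, h1.2.2, ?_⟩
    have h3 := Ioo_subset_Icc_self (h2 l (by omega))
    rw [orb_succ, ext_of_mem h3]
    exact hu.le_one _ h3 _
  have hcont : ∀ i, Continuous (fun y => orb γ u i y θ) := fun i =>
    (continuous_orb hu i).comp (f := fun y : ℝ => (y, θ)) (by fun_prop)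
  -- the average slope over the level is definite, and by distortion so is every slope
  obtain ⟨y₀, hy₀, hslope⟩ := exists_hasDerivAt_eq_slope (fun y => orb γ u (l + 1) y θ)
    (fun y => dorb γ u (l + 1) y θ) hcc (hcont _).continuousOn
    fun y hy => hasDerivAt_orb hu (hmem y hy).1
  have hd0 : 3 / 16 ≤ dorb γ u (l + 1) y₀ θ * (c' - c) := by
    rw [hslope, div_mul_cancel₀ _ (by linarith), hc]
    linarith [lt_orb_of_lt hu (Nat.lt_succ_self l) hc'.ge]
  have hd : ∀ y ∈ Ioo c c', 3 / 16 ≤ E * dorb γ u (l + 1) y θ * (c' - c) := by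
    intro y hy
    obtain ⟨a1, a2, a3⟩ := hmem y₀ hy₀
    obtain ⟨b1, b2, b3⟩ := hmem y hy
    have h1 := hdist (l + 1) y₀ θ y θ 1 zero_le_one a1 b1 a2 b2
      (by rw [sub_self]; nlinarith)
    have h2 : 0 < c' - c := by linarith
    exact hd0.trans (mul_le_mul_of_nonneg_right h1 h2.le)
  have hleft : ∀ y ∈ Ioo c c', orb γ u (l + 1) y θ ≤ 3 / 4 + ε →
      y - c ≤ E * (16 / 3) * ε * (c' - c) := by
    intro y hy hyε
    obtain ⟨z, hz, hzs⟩ := exists_hasDerivAt_eq_slope (fun y => orb γ u (l + 1) y θ)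
      (fun y => dorb γ u (l + 1) y θ) hy.1 (hcont _).continuousOn
      fun z hz => hasDerivAt_orb hu (hmem z ⟨hz.1, hz.2.trans hy.2⟩).1
    have h1 := hd z ⟨hz.1, hz.2.trans hy.2⟩
    have h2 : 0 < y - c := sub_pos.2 hy.1
    have h3 : dorb γ u (l + 1) z θ * (y - c) ≤ ε := by
      rw [hzs, div_mul_cancel₀ _ h2.ne', hc]; linarith
    have h4 : 0 < c' - c := by linarith
    have h5 := mul_le_mul_of_nonneg_left h3 (mul_nonneg hE0.le h4.le)
    nlinarith
  have hright : ∀ y ∈ Ioo c c', 3 / 4 - ε ≤ orb γ u l y θ →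
      c' - y ≤ E * (16 / 3) * A * ε * (c' - c) := by
    intro y hy hyε
    obtain ⟨z, hz, hzs⟩ := exists_hasDerivAt_eq_slope (fun y => orb γ u l y θ)
      (fun y => dorb γ u l y θ) hy.2 (hcont _).continuousOn
      fun z hz => hasDerivAt_orb hu fun i hi =>
        (hmem z ⟨hy.1.trans hz.1, hz.2⟩).1 i (by omega)
    have hzc : z ∈ Ioo c c' := ⟨hy.1.trans hz.1, hz.2⟩
    have h1 := hd z hzc
    have h2 : 0 < c' - y := sub_pos.2 hy.2
    have h3 : dorb γ u l z θ * (c' - y) ≤ ε := by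
      rw [hzs, div_mul_cancel₀ _ h2.ne', hc']; linarith
    have h4 : 0 < c' - c := by linarith
    have h6 : dorb γ u (l + 1) z θ ≤ dorb γ u l z θ * A := by
      have e1 : dorb γ u (l + 1) z θ
          = dorb γ u l z θ * dx γ u (orb γ u l z θ) (4 ^ (l + 1) * θ) := by
        rw [dorb, dorb, Finset.prod_range_succ]; ring
      have e2 := four_le_dorb hu (k := l) (y := z) (θ := θ)
        fun i hi => (hmem z hzc).1 i (by omega)
      rw [e1]
      exact mul_le_mul_of_nonneg_left
        (dx_le hu hb (Ioo_subset_Icc_self ((hmem z hzc).1 l (by omega))) _) (by linarith)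
    have h7 : dorb γ u (l + 1) z θ * (c' - y) ≤ A * ε := by
      have := mul_le_mul_of_nonneg_right h6 h2.le
      have := mul_le_mul_of_nonneg_left h3 hA0.le
      linarith
    have h5 := mul_le_mul_of_nonneg_left h7 (mul_nonneg hE0.le h4.le)
    nlinarith
  have hlen : 0 < c' - c := by linarith
  set δ₁ := E * (16 / 3) * ε * (c' - c) with hδ₁
  set δ₂ := E * (16 / 3) * A * ε * (c' - c) with hδ₂
  have hδ₁0 : 0 ≤ δ₁ := by positivity
  have hδ₂0 : 0 ≤ δ₂ := by positivity
  have hsub : lineBad γ u ε θ (l + 1) ⊆ Icc c (c + δ₁) ∪ Icc (c' - δ₂) c' := by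
    rintro y ⟨hy, hbad⟩
    rw [hset] at hy
    rcases hy.1.eq_or_lt with h | h
    · left; exact ⟨hy.1, by linarith⟩
    have hy' : y ∈ Ioo c c' := ⟨h, hy.2⟩
    rcases hbad with hbad | ⟨l', hl', hbad⟩
    · left; exact ⟨hy.1, by linarith [hleft y hy' hbad]⟩
    · obtain rfl : l' = l := by omega
      right; exact ⟨by linarith [hright y hy' hbad], hy.2.le⟩
  refine (measure_mono hsub).trans ((measure_union_le _ _).trans ?_)
  rw [Real.volume_Icc, Real.volume_Icc, hset, Real.volume_Ico, ← ENNReal.ofReal_mul (by positivity),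
    ← ENNReal.ofReal_add (by linarith) (by linarith)]
  apply ENNReal.ofReal_le_ofReal
  rw [hδ₁, hδ₂]
  exact le_of_eq (by ring)

/-- A short piece of a horizontal line contains bad points of total length at most `5ε/8`: it meets
at most one of the curves that separate the finitely many low levels, around which there is length
at most `ε/2`, and the high levels contribute little because they have small total length. -/
lemma exists_volume_lineBad_iUnion_le (hu : IsAdmissible γ u) : ∃ ε₁ : ℝ, 0 < ε₁ ∧ ∀ ε₀ ε θ : ℝ,
    ε₀ ≤ ε₁ → 0 < ε → ε < ε₀ → ∀ J : Set ℝ, (∀ y ∈ J, ∀ y' ∈ J, |y - y'| ≤ ε₀) →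
    volume (J ∩ ⋃ k, lineBad γ u ε θ k) ≤ ENNReal.ofReal (5 / 8 * ε) := by
  obtain ⟨c₀, K, hb⟩ := hu.exists_bounds
  obtain ⟨C, hC, hvol⟩ := exists_volume_lineBad_le hu
  have hγ := hu.gamma_pos
  have hK := hb.one_le
  -- all levels above `N` lie within `δ` of `3/4`, so together they contribute at most `C * ε * δ`
  set δ := 1 / (8 * C) with hδ
  have hδ0 : 0 < δ := by positivity
  obtain ⟨N, hN⟩ := exists_reach hu (r := 4 * δ) (by positivity)
  set L := 4 * (1 + (2 + γ) * K) ^ N with hL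
  have hL0 : 0 < L := by positivity
  -- `s` bounds from below the step of the left branch on `[1/2, 3/4]`
  set s := c₀ * ((1 / 2 : ℝ) ^ γ * (1 / 2)) with hs
  have hs0 : 0 < s := by
    have := hb.c_pos
    have : (0 : ℝ) < (1 / 2 : ℝ) ^ γ := Real.rpow_pos_of_pos (by norm_num) _
    positivity
  set ε₁ := min (1 / 4) (min s (3 / 16) / (2 * (2 + L))) with hε₁
  have hm0 : 0 < min s (3 / 16 : ℝ) := lt_min hs0 (by norm_num)
  refine ⟨ε₁, lt_min (by norm_num) (by positivity), ?_⟩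
  intro ε₀ ε θ hε₀ hε hεε J hJ
  have hε14 : ε ≤ 1 / 4 := hεε.le.trans (hε₀.trans (min_le_left _ _))
  have hsmall : (2 + L) * ε₀ < min s (3 / 16) := by
    have : ε₀ ≤ min s (3 / 16) / (2 * (2 + L)) := hε₀.trans (min_le_right _ _)
    rw [le_div_iff₀ (by positivity)] at this
    nlinarith
  set Q : ℕ → Set ℝ := fun m => {y | |orb γ u m y θ - 3 / 4| ≤ ε} with hQ
  have hQm : ∀ m y, y ∈ Q m ↔ |orb γ u m y θ - 3 / 4| ≤ ε := fun _ _ => Iff.rfl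
  -- an orbit that is `ε`-close to `3/4` is at a definite distance from it one step later, and `J` is
  -- too short for another of its points to make up for this before time `N`
  have hsep : ∀ m m' : ℕ, m < m' → m' ≤ N → ∀ y ∈ J, ∀ y' ∈ J, y ∈ Q m → y' ∈ Q m' → False := by
    intro m m' hmm hm' y hy y' hy' h1 h2
    have h1 := abs_le.1 ((hQm _ _).1 h1)
    have h2 := abs_le.1 ((hQm _ _).1 h2)
    have hypos : 3 / 4 < y := (orb_pos_iff hu m).1 (by linarith [h1.1])
    have h3 : orb γ u (m + 1) y θ ≤ orb γ u m' y θ := orb_mono hu hypos.le θ hmm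
    have h4 : 3 / 4 - ε + min s (3 / 16) ≤ orb γ u (m + 1) y θ := by
      rw [orb_succ]
      rcases le_or_gt (orb γ u m y θ) (3 / 4) with h | h
      · have := add_le_ext hu hb (r := 1 / 2) (by norm_num) (by linarith) h (4 ^ (m + 1) * θ)
        linarith [min_le_left s (3 / 16)]
      · have := lt_ext_of_le hu h.le (4 ^ (m + 1) * θ)
        linarith [min_le_right s (3 / 16)]
    have h5 : orb γ u m' y θ - orb γ u m' y' θ ≤ L * ε₀ := by
      have hyy := hJ y hy y' hy'
      rcases le_total y' y with h | h
      · have h6 := orb_sub_le hu hb m' h θ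
        have h7 : 4 * (1 + (2 + γ) * K) ^ m' ≤ L := by
          rw [hL]
          have : 1 ≤ 1 + (2 + γ) * K := by
            have : 0 ≤ (2 + γ) * K := by positivity
            linarith
          gcongr
        have h8 : y - y' ≤ ε₀ := (le_abs_self _).trans hyy
        refine h6.trans (mul_le_mul h7 h8 (by linarith) hL0.le)
      · have := (orb_strictMono hu m' θ).monotone h
        have : 0 ≤ L * ε₀ := mul_nonneg hL0.le (hε.trans hεε).le
        linarith
    linarith
  have hlow : volume (J ∩ ⋃ m ∈ Finset.range (N + 1), Q m) ≤ ENNReal.ofReal (ε / 2) := by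
    refine volume_le_of_abs_sub_le ?_
    rintro y ⟨hyJ, hy⟩ y' ⟨hyJ', hy'⟩
    simp only [mem_iUnion, Finset.mem_range] at hy hy'
    obtain ⟨m, hm, hy⟩ := hy
    obtain ⟨m', hm', hy'⟩ := hy'
    obtain rfl : m = m' := by
      rcases lt_trichotomy m m' with h | h | h
      · exact (hsep m m' h (by omega) y hyJ y' hyJ' hy hy').elim
      · exact h
      · exact (hsep m' m h (by omega) y' hyJ' y hyJ hy' hy).elim
    have h1 := abs_le.1 ((hQm _ _).1 hy)
    have h2 := abs_le.1 ((hQm _ _).1 hy')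
    rw [abs_le]
    rcases le_total y y' with h | h
    · have := le_orb_sub hu m h θ
      constructor <;> linarith
    · have := le_orb_sub hu m h θ
      constructor <;> linarith
  have hhigh : volume (⋃ k, lineBad γ u ε θ (N + 1 + k)) ≤ ENNReal.ofReal (ε / 8) := by
    have hdisj : Pairwise (Function.onFun Disjoint fun k => lineLevel γ u θ (N + 1 + k)) :=
      fun k l hkl => pairwise_disjoint_lineLevel θ (by omega)
    have hmeas : ∀ k, MeasurableSet (lineLevel γ u θ (N + 1 + k)) := by
      intro k
      obtain ⟨c, -, hc⟩ := exists_orb_eq hu (N + k + 1) θ (v := 3 / 4) (by norm_num)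
      obtain ⟨c', -, hc'⟩ := exists_orb_eq hu (N + k) θ (v := 3 / 4) (by norm_num)
      rw [show N + 1 + k = N + k + 1 by ring, lineLevel_succ hu hc hc']
      exact measurableSet_Ico
    have hsub : ⋃ k, lineLevel γ u θ (N + 1 + k) ⊆ Ioo (3 / 4) (3 / 4 + δ) := by
      refine iUnion_subset fun k y hy => ⟨hy.1, ?_⟩
      by_contra! h
      have h1 := hN 0 y θ (by simp only [orb]; linarith)
      rw [zero_add] at h1
      linarith [hy.2.1 N (by omega)]
    calc volume (⋃ k, lineBad γ u ε θ (N + 1 + k))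
        ≤ ∑' k, volume (lineBad γ u ε θ (N + 1 + k)) := measure_iUnion_le _
      _ ≤ ∑' k, ENNReal.ofReal (C * ε) * volume (lineLevel γ u θ (N + 1 + k)) :=
          ENNReal.tsum_le_tsum fun k => hvol ε θ hε _ (by omega)
      _ = ENNReal.ofReal (C * ε) * volume (⋃ k, lineLevel γ u θ (N + 1 + k)) := by
          rw [ENNReal.tsum_mul_left, measure_iUnion hdisj hmeas]
      _ ≤ ENNReal.ofReal (C * ε) * ENNReal.ofReal δ := by
          gcongr
          refine (measure_mono hsub).trans ?_
          rw [Real.volume_Ioo]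
          exact ENNReal.ofReal_le_ofReal (by linarith)
      _ = ENNReal.ofReal (ε / 8) := by
          rw [← ENNReal.ofReal_mul (by positivity), hδ]
          congr 1
          field_simp
  have hsub : J ∩ ⋃ k, lineBad γ u ε θ k ⊆
      (J ∩ ⋃ m ∈ Finset.range (N + 1), Q m) ∪ ⋃ k, lineBad γ u ε θ (N + 1 + k) := by
    rintro y ⟨hyJ, hy⟩
    obtain ⟨k, hk⟩ := mem_iUnion.1 hy
    rcases le_or_gt k N with hkN | hkN
    · left
      refine ⟨hyJ, ?_⟩
      simp only [mem_iUnion, Finset.mem_range]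
      obtain ⟨⟨-, h1, h2⟩, h3 | ⟨l, rfl, h3⟩⟩ := hk
      · exact ⟨k, by omega, (hQm _ _).2 <| abs_le.2 ⟨by linarith, by linarith⟩⟩
      · exact ⟨l, by omega, (hQm _ _).2 <| abs_le.2 ⟨by linarith, by linarith [h1 l (by omega)]⟩⟩
    · right
      exact mem_iUnion.2 ⟨k - (N + 1), by rwa [Nat.add_sub_cancel' hkN]⟩
  refine (measure_mono hsub).trans ((measure_union_le _ _).trans ((add_le_add hlow hhigh).trans ?_))
  rw [← ENNReal.ofReal_add (by positivity) (by positivity)]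
  exact ENNReal.ofReal_le_ofReal (by linarith)

/-! ### Bad points on vertical lines -/

/-- The angles `θ` on the vertical line through `y` with return time `k + 1` that the return map
brings `ε`-close to the horizontal sides of the image. -/
def angleBad (γ : ℝ) (u : ℝ → ℝ → ℝ) (ε y : ℝ) (k : ℕ) : Set ℝ :=
  {θ | (∀ i < k, orb γ u i y θ < 3 / 4) ∧ 3 / 4 ≤ orb γ u k y θ ∧
    ∃ q : ℤ, |4 ^ (k + 1) * θ - q| ≤ ε}

/-- The `4`-adic intervals of generation `k + 1` whose left end point is close to a bad angle
in `J` of return time `k + 1`. -/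
def gridCover (γ : ℝ) (u : ℝ → ℝ → ℝ) (ε y : ℝ) (J : Set ℝ) (k : ℕ) : Set ℝ :=
  ⋃ q ∈ {q : ℤ | ∃ θ ∈ J, (∀ i < k, orb γ u i y θ < 3 / 4) ∧ 3 / 4 ≤ orb γ u k y θ ∧
    |4 ^ (k + 1) * θ - q| ≤ ε}, Ico ((q : ℝ) / 4 ^ (k + 1)) (((q : ℝ) + 1) / 4 ^ (k + 1))

lemma measurableSet_gridCover (ε y : ℝ) (J : Set ℝ) (k : ℕ) :
    MeasurableSet (gridCover γ u ε y J k) :=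
  MeasurableSet.biUnion (to_countable _) fun _ _ => measurableSet_Ico

/-- The bad angles in `J` lie in bands of half-width `ε` around grid points, which are a fraction
`2ε` of the grid intervals that start there. -/
lemma volume_angleBad_le {ε y : ℝ} (hε : 0 < ε) (J : Set ℝ) (k : ℕ) :
    volume (J ∩ angleBad γ u ε y k) ≤
      ENNReal.ofReal (2 * ε) * volume (gridCover γ u ε y J k) := by
  have h4 : (0 : ℝ) < 4 ^ (k + 1) := by positivity
  set G : Set ℤ := {q : ℤ | ∃ θ ∈ J, (∀ i < k, orb γ u i y θ < 3 / 4) ∧ 3 / 4 ≤ orb γ u k y θ ∧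
    |4 ^ (k + 1) * θ - q| ≤ ε} with hG
  have hsub : J ∩ angleBad γ u ε y k ⊆
      ⋃ q ∈ G, Icc (((q : ℝ) - ε) / 4 ^ (k + 1)) (((q : ℝ) + ε) / 4 ^ (k + 1)) := by
    rintro θ ⟨hθJ, h1, h2, q, hq⟩
    refine mem_iUnion₂.2 ⟨q, ⟨θ, hθJ, h1, h2, hq⟩, ?_⟩
    rw [abs_le] at hq
    rw [mem_Icc, div_le_iff₀' h4, le_div_iff₀' h4]
    constructor <;> linarith
  have hdisj : G.PairwiseDisjoint
      fun q : ℤ => Ico ((q : ℝ) / 4 ^ (k + 1)) (((q : ℝ) + 1) / 4 ^ (k + 1)) := by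
    intro q _ q' _ hqq
    rw [Function.onFun, Set.disjoint_left]
    rintro θ ⟨h1, h2⟩ ⟨h3, h5⟩
    rw [div_le_iff₀' h4] at h1 h3
    rw [lt_div_iff₀' h4] at h2 h5
    apply hqq
    have e1 : (q : ℝ) < q' + 1 := by linarith
    have e2 : (q' : ℝ) < q + 1 := by linarith
    norm_cast at e1 e2
    omega
  rw [gridCover, measure_biUnion (to_countable _) hdisj fun _ _ => measurableSet_Ico,
    ← ENNReal.tsum_mul_left]
  refine (measure_mono hsub).trans ((measure_biUnion_le _ (to_countable G) _).trans ?_)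
  refine ENNReal.tsum_le_tsum fun q => ?_
  rw [Real.volume_Icc, Real.volume_Ico, ← ENNReal.ofReal_mul (by positivity)]
  apply ENNReal.ofReal_le_ofReal
  apply le_of_eq
  field_simp
  ring

/-- The sets `gridCover`, for different return times, have bounded overlap. -/
lemma exists_tsum_indicator_gridCover_le (hu : IsAdmissible γ u) : ∃ N : ℕ, ∀ (ε y : ℝ) (J : Set ℝ),
    ε ≤ 1 → 3 / 4 < y → ∀ θ, ∑' k, (gridCover γ u ε y J k).indicator (1 : ℝ → ℝ≥0∞) θ ≤ N := by
  obtain ⟨N, hN⟩ := exists_shadow hu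
  refine ⟨N + 1, fun ε y J hε hy θ => ?_⟩
  by_cases hne : ∃ k, θ ∈ gridCover γ u ε y J k
  swap
  · push Not at hne
    simp [hne]
  have hnear : ∀ k, θ ∈ gridCover γ u ε y J k → ∃ θ', (∀ i < k, orb γ u i y θ' < 3 / 4) ∧
      3 / 4 ≤ orb γ u k y θ' ∧ 4 ^ (k + 1) * |θ - θ'| ≤ 2 := by
    intro k hk
    obtain ⟨q, ⟨θ', -, h1, h2, hq⟩, hθ⟩ := mem_iUnion₂.1 hk
    refine ⟨θ', h1, h2, ?_⟩
    have h4 : (0 : ℝ) < 4 ^ (k + 1) := by positivity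
    rw [mem_Ico, div_le_iff₀' h4, lt_div_iff₀' h4] at hθ
    rw [abs_le] at hq
    rw [show (4 : ℝ) ^ (k + 1) * |θ - θ'| = |4 ^ (k + 1) * θ - 4 ^ (k + 1) * θ'| by
      rw [← mul_sub, abs_mul, abs_of_pos h4], abs_le]
    constructor <;> linarith
  classical
  set k₀ := Nat.find hne with hk₀
  have hk₀θ : θ ∈ gridCover γ u ε y J k₀ := Nat.find_spec hne
  have hout : ∀ k ∉ Finset.Icc k₀ (k₀ + N),
      (gridCover γ u ε y J k).indicator (1 : ℝ → ℝ≥0∞) θ = 0 := by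
    intro k hk
    apply indicator_of_notMem
    intro hkθ
    apply hk
    have hk₀k : k₀ ≤ k := Nat.find_min' hne hkθ
    refine Finset.mem_Icc.2 ⟨hk₀k, ?_⟩
    by_contra! hlt
    obtain ⟨θ', h1, h2, h3⟩ := hnear k₀ hk₀θ
    obtain ⟨θ'', h1', h2', h3'⟩ := hnear k hkθ
    have h4 : (4 : ℝ) ^ (k₀ + 1) * |θ - θ''| ≤ 2 := by
      refine le_trans ?_ h3'
      gcongr
      norm_num
    have h5 : (4 : ℝ) ^ (k₀ + 1) * |θ' - θ''| ≤ 4 := by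
      have h6 : |θ' - θ''| ≤ |θ - θ'| + |θ - θ''| := by
        rw [abs_sub_comm θ θ']; exact abs_sub_le _ _ _
      have := mul_le_mul_of_nonneg_left h6 (show (0 : ℝ) ≤ 4 ^ (k₀ + 1) by positivity)
      linarith
    have h7 := hN k₀ y θ' θ'' (fun i hi => ⟨(orb_pos_iff hu i).2 hy, h1 i hi⟩) h2 h5
    linarith [h1' (k₀ + N) hlt]
  rw [tsum_eq_sum hout]
  calc ∑ k ∈ Finset.Icc k₀ (k₀ + N), (gridCover γ u ε y J k).indicator (1 : ℝ → ℝ≥0∞) θ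
      ≤ ∑ k ∈ Finset.Icc k₀ (k₀ + N), 1 :=
        Finset.sum_le_sum fun k _ => indicator_le_self' (fun _ _ => zero_le) θ
    _ = _ := by
        rw [Finset.sum_const, Nat.card_Icc, show k₀ + N + 1 - k₀ = N + 1 by omega]
        simp

/-- A short piece of a vertical line contains bad angles of total length at most `5ε/8`: at most
one grid point of low generation matters, and the bands of high generation are a fraction of order
`ε` of the grid intervals that start at them, which have bounded overlap. -/
lemma exists_volume_angleBad_iUnion_le (hu : IsAdmissible γ u) : ∃ ε₁ : ℝ, 0 < ε₁ ∧
    ∀ ε₀ ε y : ℝ, ε₀ ≤ ε₁ → 0 < ε → ε < ε₀ → 3 / 4 < y → ∀ J : Set ℝ,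
    (∀ θ ∈ J, ∀ θ' ∈ J, |θ - θ'| ≤ ε₀) →
    volume (J ∩ ⋃ k, angleBad γ u ε y k) ≤ ENNReal.ofReal (5 / 8 * ε) := by
  obtain ⟨R, hR⟩ := exists_tsum_indicator_gridCover_le hu
  obtain ⟨N, hN⟩ : ∃ N : ℕ, (R + 1 : ℝ) * 256 < 4 ^ N :=
    pow_unbounded_of_one_lt _ (by norm_num)
  have h4N : (0 : ℝ) < 4 ^ N := by positivity
  refine ⟨1 / (2 * 4 ^ N), by positivity, ?_⟩
  intro ε₀ ε y hε₀ hε hεε hy J hJ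
  rw [le_div_iff₀ (by positivity)] at hε₀
  have hR0 : (0 : ℝ) ≤ R := Nat.cast_nonneg R
  have hε1 : ε ≤ 1 := by nlinarith
  rcases J.eq_empty_or_nonempty with rfl | ⟨θ₀, hθ₀⟩
  · simp
  have hlow : volume (J ∩ ⋃ k ∈ Finset.range N, angleBad γ u ε y k) ≤
      ENNReal.ofReal (ε / 2) := by
    have hnear : ∀ θ ∈ ⋃ k ∈ Finset.range N, angleBad γ u ε y k,
        ∃ q : ℤ, |θ - q / 4 ^ N| ≤ ε / 4 := by
      intro θ hθ
      simp only [mem_iUnion, Finset.mem_range] at hθ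
      obtain ⟨k, hk, -, -, q, hq⟩ := hθ
      refine ⟨q * 4 ^ (N - (k + 1)), ?_⟩
      have h1 : (4 : ℝ) ^ N = 4 ^ (k + 1) * 4 ^ (N - (k + 1)) := by
        rw [← pow_add]; congr 1; omega
      have h2 : θ - ((q * 4 ^ (N - (k + 1)) : ℤ) : ℝ) / 4 ^ N
          = (4 ^ (k + 1) * θ - q) / 4 ^ (k + 1) := by
        rw [h1]; push_cast; field_simp
      rw [h2, abs_div, abs_of_pos (by positivity : (0 : ℝ) < 4 ^ (k + 1)), div_le_iff₀ (by positivity)]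
      have h3 : (4 : ℝ) ^ 1 ≤ 4 ^ (k + 1) := pow_le_pow_right₀ (by norm_num) (by omega)
      nlinarith
    refine volume_le_of_abs_sub_le ?_
    rintro θ ⟨hθJ, hθ⟩ θ' ⟨hθJ', hθ'⟩
    obtain ⟨q, hq⟩ := hnear θ hθ
    obtain ⟨q', hq'⟩ := hnear θ' hθ'
    have h1 := abs_le.1 (hJ θ hθJ θ' hθJ')
    have h2 := abs_le.1 hq
    have h3 := abs_le.1 hq'
    obtain rfl : q = q' := by
      have e1 : |(q : ℝ) / 4 ^ N - q' / 4 ^ N| ≤ 3 / 2 * ε₀ := by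
        rw [abs_le]; constructor <;> linarith
      rw [← sub_div, abs_div, abs_of_pos h4N, div_le_iff₀ h4N] at e1
      have e2 : |((q - q' : ℤ) : ℝ)| < 1 := by
        push_cast
        linarith
      rw [← Int.cast_abs] at e2
      norm_cast at e2
      have := Int.abs_lt_one_iff.1 e2
      omega
    rw [abs_le]
    constructor <;> linarith
  -- the grid intervals of high generation that belong to bad angles in `J` lie in `W`
  set W := Icc (θ₀ - (ε₀ + 2 / 4 ^ N)) (θ₀ + (ε₀ + 2 / 4 ^ N)) with hW
  have hcover : ∀ k, N ≤ k → gridCover γ u ε y J k ⊆ W := by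
    intro k hk θ hθ
    obtain ⟨q, ⟨θ', hθ'J, -, -, hq⟩, hθ⟩ := mem_iUnion₂.1 hθ
    have h4 : (0 : ℝ) < 4 ^ (k + 1) := by positivity
    rw [mem_Ico, div_le_iff₀' h4, lt_div_iff₀' h4] at hθ
    rw [abs_le] at hq
    have h5 : |θ - θ'| ≤ 2 / 4 ^ (k + 1) := by
      rw [le_div_iff₀' h4,
        show (4 : ℝ) ^ (k + 1) * |θ - θ'| = |4 ^ (k + 1) * θ - 4 ^ (k + 1) * θ'| by
          rw [← mul_sub, abs_mul, abs_of_pos h4], abs_le]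
      constructor <;> linarith
    have h6 : (2 : ℝ) / 4 ^ (k + 1) ≤ 2 / 4 ^ N := by
      gcongr
      · norm_num
      · omega
    have h7 := abs_le.1 h5
    have h8 := abs_le.1 (hJ θ' hθ'J θ₀ hθ₀)
    constructor <;> linarith
  have hhigh : volume (J ∩ ⋃ k, angleBad γ u ε y (N + k)) ≤ ENNReal.ofReal (ε / 8) := by
    have hind : ∀ θ, ∑' k, (gridCover γ u ε y J (N + k)).indicator (1 : ℝ → ℝ≥0∞) θ ≤
        W.indicator (fun _ => (R : ℝ≥0∞)) θ := by
      intro θ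
      by_cases hθ : θ ∈ W
      · rw [indicator_of_mem hθ]
        refine le_trans ?_ (hR ε y J hε1 hy θ)
        exact ENNReal.tsum_comp_le_tsum_of_injective (add_right_injective N)
          (fun k => (gridCover γ u ε y J k).indicator (1 : ℝ → ℝ≥0∞) θ)
      · have : ∀ k, θ ∉ gridCover γ u ε y J (N + k) :=
          fun k hk => hθ (hcover _ (Nat.le_add_right N k) hk)
        simp [this]
    calc volume (J ∩ ⋃ k, angleBad γ u ε y (N + k))
        ≤ ∑' k, volume (J ∩ angleBad γ u ε y (N + k)) := by
          rw [inter_iUnion]; exact measure_iUnion_le _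
      _ ≤ ∑' k, ENNReal.ofReal (2 * ε) * volume (gridCover γ u ε y J (N + k)) :=
          ENNReal.tsum_le_tsum fun k => volume_angleBad_le hε J _
      _ = ENNReal.ofReal (2 * ε) *
            ∫⁻ θ, ∑' k, (gridCover γ u ε y J (N + k)).indicator (1 : ℝ → ℝ≥0∞) θ := by
          rw [ENNReal.tsum_mul_left, lintegral_tsum fun k =>
            (measurable_one.indicator (measurableSet_gridCover ε y J (N + k))).aemeasurable]
          congr 2
          ext k
          rw [lintegral_indicator_one (measurableSet_gridCover ε y J (N + k))]
      _ ≤ ENNReal.ofReal (2 * ε) * ∫⁻ θ, W.indicator (fun _ => (R : ℝ≥0∞)) θ := by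
          gcongr with θ
          exact hind θ
      _ = ENNReal.ofReal (2 * ε) * (R * ENNReal.ofReal (2 * (ε₀ + 2 / 4 ^ N))) := by
          rw [lintegral_indicator_const measurableSet_Icc, Real.volume_Icc]
          congr 3
          ring
      _ ≤ ENNReal.ofReal (ε / 8) := by
          rw [← ENNReal.ofReal_natCast, ← ENNReal.ofReal_mul (by positivity),
            ← ENNReal.ofReal_mul (by positivity)]
          apply ENNReal.ofReal_le_ofReal
          have h1 : ε₀ + 2 / 4 ^ N ≤ 4 / 4 ^ N := by
            have : ε₀ ≤ 1 / (2 * 4 ^ N) := by rw [le_div_iff₀ (by positivity)]; exact hε₀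
            have h2 : (1 : ℝ) / (2 * 4 ^ N) + 2 / 4 ^ N ≤ 4 / 4 ^ N := by
              rw [div_add_div _ _ (by positivity) (by positivity), div_le_div_iff₀ (by positivity)
                (by positivity)]
              nlinarith
            linarith
          have h2 : (R : ℝ) * (4 / 4 ^ N) ≤ 1 / 64 := by
            rw [mul_div_assoc', div_le_iff₀ h4N]
            linarith
          have h3 : (R : ℝ) * (2 * (ε₀ + 2 / 4 ^ N)) ≤ 1 / 32 := by nlinarith
          nlinarith
  have hsub : J ∩ ⋃ k, angleBad γ u ε y k ⊆ (J ∩ ⋃ k ∈ Finset.range N, angleBad γ u ε y k) ∪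
      (J ∩ ⋃ k, angleBad γ u ε y (N + k)) := by
    rintro θ ⟨hθJ, hθ⟩
    obtain ⟨k, hk⟩ := mem_iUnion.1 hθ
    rcases lt_or_ge k N with hkN | hkN
    · exact Or.inl ⟨hθJ, mem_iUnion₂.2 ⟨k, Finset.mem_range.2 hkN, hk⟩⟩
    · exact Or.inr ⟨hθJ, mem_iUnion.2 ⟨k - N, by rwa [Nat.add_sub_cancel' hkN]⟩⟩
  refine (measure_mono hsub).trans ((measure_union_le _ _).trans ((add_le_add hlow hhigh).trans ?_))
  rw [← ENNReal.ofReal_add (by positivity) (by positivity)]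
  exact ENNReal.ofReal_le_ofReal (by linarith)

/-! ### Points that the return map brings close to the boundary of an image -/

lemma isBounded_Y : Bornology.IsBounded (Y γ u) := by
  refine (Metric.isBounded_closedBall (x := (0 : Plane)) (r := 2)).subset fun z hz => ?_
  have h0 := hz.1
  have h1 := (X_subset_M hz.2).2
  rw [Metric.mem_closedBall]
  refine abs_le_of_sq_le_sq' ?_ (by norm_num) |>.2
  rw [dist_sq_eq]
  simp only [PiLp.zero_apply, sub_zero]
  nlinarith [h0.1, h0.2, h1.1, h1.2]

/-- If the image of `w` is `ε`-close to the boundary of `F (I ∩ a)` but `w` is not `εΛ`-close to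
the boundary of `I`, then the nearby boundary point of the image comes from a boundary point `p` of
the cell `a` that lies inside `I`.  Since `F` expands by a factor `4 ≥ Λ⁻¹`, the orbit of `w` stays
`ε`-close to the orbit of `p`, which meets one of the sides of `a`. -/
lemma near_side_of_mem_innerBoundary (hu : IsAdmissible γ u)
    (hX : MapsTo (f γ u) (X γ u) (X γ u)) {Λ ε : ℝ} (hΛ : 1 / 4 ≤ Λ) (hε : 0 < ε) {I : Set Plane}
    (hI : IsOpen I) (hIY : I ⊆ Y γ u) {k j : ℕ} {w : Plane} (hwI : w ∈ I)
    (hw : w ∈ cell γ u (k + 1) j)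
    (hF : F γ u w ∈ innerBoundary ε (F γ u '' (I ∩ cell γ u (k + 1) j)))
    (hwΛ : w ∉ innerBoundary (ε * Λ) I) :
    (orb γ u k (w 0) (w 1) ≤ 3 / 4 + ε ∨
      ∃ l, k = l + 1 ∧ 3 / 4 - ε ≤ orb γ u l (w 0) (w 1)) ∨
    ∃ q : ℤ, |4 ^ (k + 1) * w 1 - q| ≤ ε := by
  set V := I ∩ cell γ u (k + 1) j with hV
  have hVo : IsOpen (F γ u '' V) :=
    isOpen_image_F hu hX (hI.inter (isOpen_cell _ _)) inter_subset_right
  have hFB : F γ u '' V = branchMap γ u k j '' V :=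
    image_congr fun z hz => F_eq_branchMap hu hX hz.2
  have hne : (frontier (F γ u '' V)).Nonempty := by
    rw [nonempty_iff_ne_empty]
    intro h
    have := hF.2
    rw [h, Metric.infEDist_empty] at this
    exact absurd this (by simp)
  obtain ⟨b, hb, hbd⟩ := isClosed_frontier.exists_infDist_eq_dist hne (F γ u w)
  have hbε : dist (F γ u w) b ≤ ε := by
    rw [← hbd, Metric.infDist]
    exact ENNReal.toReal_le_of_le_ofReal hε.le hF.2
  -- pull the boundary point `b` back to a point `p` of the closed cell
  have hcpt : IsCompact (closure V) :=
    (isBounded_Y.subset ((inter_subset_left).trans hIY)).isCompact_closure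
  obtain ⟨p, hp, hpb⟩ : b ∈ branchMap γ u k j '' closure V := by
    rw [image_closure_of_isCompact hcpt (continuous_branchMap hu k j).continuousOn, ← hFB]
    exact frontier_subset_closure hb
  have hbV : b ∉ F γ u '' V := by
    rw [hVo.frontier_eq] at hb
    exact hb.2
  have hpc : p ∈ closure (cell γ u (k + 1) j) := closure_mono inter_subset_right hp
  have horb : ∀ i < k, orb γ u i (p 0) (p 1) ∈ Icc (0 : ℝ) (3 / 4) := by
    intro i hi
    have hcl : IsClosed {z : Plane | orb γ u i (z 0) (z 1) ∈ Icc (0 : ℝ) (3 / 4)} :=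
      isClosed_Icc.preimage (continuous_orb_plane hu i)
    have hsub : cell γ u (k + 1) j ⊆ {z | orb γ u i (z 0) (z 1) ∈ Icc (0 : ℝ) (3 / 4)} :=
      fun z hz => mem_ofPred_eq ▸ Ioo_subset_Icc_self (orb_mem_of_mem_cell hu hX hz i hi)
    exact closure_minimal hsub hcl hpc
  have hk : 3 / 4 ≤ orb γ u k (p 0) (p 1) := by
    have hcl : IsClosed {z : Plane | orb γ u k (z 0) (z 1) ∈ Ici (3 / 4 : ℝ)} :=
      isClosed_Ici.preimage (continuous_orb_plane hu k)
    exact closure_minimal (fun z hz => ((mem_cell_iff hu hX).1 hz).2.2.1.le) hcl hpc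
  have hang : p 1 ∈ Icc (((j : ℝ) - 1) / 4 ^ (k + 1)) ((j : ℝ) / 4 ^ (k + 1)) := by
    have hcl : IsClosed {z : Plane |
        z 1 ∈ Icc (((j : ℝ) - 1) / 4 ^ (k + 1)) ((j : ℝ) / 4 ^ (k + 1))} :=
      isClosed_Icc.preimage (by fun_prop : Continuous fun z : Plane => z 1)
    have hsub : cell γ u (k + 1) j ⊆
        {z | z 1 ∈ Icc (((j : ℝ) - 1) / 4 ^ (k + 1)) ((j : ℝ) / 4 ^ (k + 1))} :=
      fun z hz => mem_ofPred_eq ▸ Ioo_subset_Icc_self ((mem_cell_iff hu hX).1 hz).2.2.2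
    exact closure_minimal hsub hcl hpc
  have hworb := fun i hi => Ioo_subset_Icc_self (orb_mem_of_mem_cell hu hX hw i hi)
  have hdB : dist (branchMap γ u k j w) (branchMap γ u k j p) ≤ ε := by
    rwa [hpb, ← F_eq_branchMap hu hX hw]
  have hdwp : dist w p ≤ ε * Λ := by
    have := four_mul_dist_le (j := j) hu hworb horb
    nlinarith
  have hpI : p ∈ I := by
    by_contra hpI
    refine hwΛ ⟨hwI, ?_⟩
    have hpf : p ∈ frontier I := by
      rw [hI.frontier_eq]
      exact ⟨closure_mono inter_subset_left hp, hpI⟩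
    refine (Metric.infEDist_le_edist_of_mem hpf).trans ?_
    rw [edist_dist]
    exact ENNReal.ofReal_le_ofReal hdwp
  have hpY : p ∈ interior (Y γ u) := interior_maximal hIY hI hpI
  have hsq : ∀ i ≤ k, (orb γ u i (w 0) (w 1) - orb γ u i (p 0) (p 1)) ^ 2 +
      (4 ^ (i + 1) * w 1 - 4 ^ (i + 1) * p 1) ^ 2 ≤ ε ^ 2 := by
    intro i hi
    refine (orb_expanding hu hi horb hworb).trans ?_
    rw [← dist_sq_branchMap (j := j)]
    exact pow_le_pow_left₀ dist_nonneg hdB 2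
  have hside : ∀ i ≤ k, |orb γ u i (w 0) (w 1) - orb γ u i (p 0) (p 1)| ≤ ε := fun i hi =>
    abs_le_of_sq_le_sq (by nlinarith [hsq i hi]) hε.le
  have hangle : |4 ^ (k + 1) * w 1 - 4 ^ (k + 1) * p 1| ≤ ε :=
    abs_le_of_sq_le_sq (by nlinarith [hsq k le_rfl]) hε.le
  by_contra hcon
  push Not at hcon
  obtain ⟨⟨c1, c2⟩, c3⟩ := hcon
  have h4 : (0 : ℝ) < 4 ^ (k + 1) := by positivity
  rw [mem_Icc, div_le_iff₀' h4, le_div_iff₀' h4] at hang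
  have hpcell : p ∈ cell γ u (k + 1) j := by
    refine (mem_cell_iff hu hX).2 ⟨hpY, fun i hi => ?_, ?_, ?_⟩
    · refine lt_of_le_of_ne (horb i hi).2 fun h => ?_
      -- only the last orbit point before the return can lie on the line `x = 3/4`
      obtain rfl : k = i + 1 := by
        by_contra hne
        have := lt_orb_of_lt hu (Nat.lt_succ_self i) h.ge
        linarith [(horb (i + 1) (by omega)).2]
      have h1 := (abs_le.1 (hside i (by omega))).1
      linarith [c2 i rfl]
    · refine lt_of_le_of_ne hk fun h => ?_
      have h1 := (abs_le.1 (hside k le_rfl)).2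
      linarith
    · rw [mem_Ioo, div_lt_iff₀' h4, lt_div_iff₀' h4]
      constructor
      · refine lt_of_le_of_ne hang.1 fun h => ?_
        have h1 := c3 ((j : ℤ) - 1)
        push_cast at h1
        rw [h] at h1
        linarith
      · refine lt_of_le_of_ne hang.2 fun h => ?_
        have h1 := c3 (j : ℤ)
        push_cast at h1
        rw [← h] at h1
        linarith
  exact hbV ⟨p, ⟨hpI, hpcell⟩, by rw [F_eq_branchMap hu hX hpcell, hpb]⟩

/-! ### Lines through an open set -/

/-- A unit speed line through a point of a bounded open set `I` at distance more than `r` from the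
boundary runs through the boundary layer of width `r` before it leaves `I`. -/
lemma exists_Ico_subset_innerBoundary {I : Set Plane} (hI : IsOpen I)
    (hIb : Bornology.IsBounded I) {ℓ : ℝ → Plane} (hℓ : Isometry ℓ) {s₀ r : ℝ}
    (hs₀ : ℓ s₀ ∈ I) (hfar : ENNReal.ofReal r < Metric.infEDist (ℓ s₀) (frontier I)) :
    ∃ b, s₀ + r < b ∧ ∀ s ∈ Ico (b - r) b, ℓ s ∈ innerBoundary r I := by
  set S := Ici s₀ ∩ ℓ ⁻¹' Iᶜ with hS
  have hScl : IsClosed S := isClosed_Ici.inter (hI.isClosed_compl.preimage hℓ.continuous)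
  have hSne : S.Nonempty := by
    obtain ⟨R, hR⟩ := hIb.subset_closedBall (ℓ s₀)
    refine ⟨s₀ + (|R| + 1), by rw [mem_Ici]; linarith [abs_nonneg R], fun h => ?_⟩
    have h1 := Metric.mem_closedBall.1 (hR h)
    rw [hℓ.dist_eq, Real.dist_eq, add_sub_cancel_left, abs_of_nonneg (by positivity)] at h1
    linarith [le_abs_self R]
  have hSb : BddBelow S := ⟨s₀, fun s hs => hs.1⟩
  set b := sInf S with hb
  have hbS : b ∈ S := hScl.csInf_mem hSne hSb
  have hin : ∀ s ∈ Ico s₀ b, ℓ s ∈ I := by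
    intro s hs
    by_contra h
    exact absurd (csInf_le hSb ⟨hs.1, h⟩) (not_le.2 hs.2)
  have hsb : s₀ < b := lt_of_le_of_ne hbS.1 fun h => hbS.2 (h ▸ hs₀)
  have hbf : ℓ b ∈ frontier I := by
    rw [hI.frontier_eq]
    refine ⟨?_, hbS.2⟩
    have h1 : b ∈ closure (Ico s₀ b) := by
      rw [closure_Ico hsb.ne]; exact right_mem_Icc.2 hsb.le
    exact closure_mono (image_subset_iff.2 hin)
      (image_closure_subset_closure_image hℓ.continuous (mem_image_of_mem _ h1))
  have hdist : ∀ s ≤ b, Metric.infEDist (ℓ s) (frontier I) ≤ ENNReal.ofReal (b - s) := by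
    intro s hs
    refine (Metric.infEDist_le_edist_of_mem hbf).trans ?_
    rw [hℓ.edist_eq, edist_dist, Real.dist_eq, abs_sub_comm, abs_of_nonneg (sub_nonneg.2 hs)]
  have hfar' : s₀ + r < b := by
    have h1 := hfar.trans_le (hdist s₀ hsb.le)
    rw [ENNReal.ofReal_lt_ofReal_iff (sub_pos.2 hsb)] at h1
    linarith
  refine ⟨b, hfar', fun s hs => ⟨hin s ⟨by linarith [hs.1], hs.2⟩, ?_⟩⟩
  exact (hdist s hs.2.le).trans (ENNReal.ofReal_le_ofReal (by linarith [hs.1]))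

lemma ofReal_le_volume_preimage_innerBoundary {I : Set Plane} (hI : IsOpen I)
    (hIb : Bornology.IsBounded I) {ℓ : ℝ → Plane} (hℓ : Isometry ℓ) {s₀ r : ℝ} (hr : 0 < r)
    (hs₀ : ℓ s₀ ∈ I) (hfar : ENNReal.ofReal r < Metric.infEDist (ℓ s₀) (frontier I)) :
    ENNReal.ofReal (2 * r) ≤ volume (ℓ ⁻¹' innerBoundary r I) := by
  obtain ⟨b, hb, hb'⟩ := exists_Ico_subset_innerBoundary hI hIb hℓ hs₀ hfar
  obtain ⟨c, hc, hc'⟩ := exists_Ico_subset_innerBoundary (s₀ := -s₀) hI hIb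
    (hℓ.comp (isometry_neg (G := ℝ))) (by simpa using hs₀) (by simpa using hfar)
  have hsub : Ico (b - r) b ∪ Ioc (-c) (-c + r) ⊆ ℓ ⁻¹' innerBoundary r I := by
    rintro s (hs | hs)
    · exact hb' s hs
    · have := hc' (-s) ⟨by linarith [hs.2], by linarith [hs.1]⟩
      simpa using this
  have hdisj : Disjoint (Ico (b - r) b) (Ioc (-c) (-c + r)) := by
    rw [Set.disjoint_left]
    intro s hs hs'
    linarith [hs.1, hs'.2]
  refine le_trans ?_ (measure_mono hsub)
  rw [measure_union hdisj measurableSet_Ioc, Real.volume_Ico, Real.volume_Ioc,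
    ← ENNReal.ofReal_add (by linarith) (by linarith)]
  exact ENNReal.ofReal_le_ofReal (by linarith)

lemma measurePreserving_mk : MeasurePreserving fun p : ℝ × ℝ => (!₂[p.1, p.2] : Plane) := by
  have h := (PiLp.volume_preserving_toLp (Fin 2)).comp (volume_preserving_finTwoArrow ℝ).symm
  convert! h using 1

lemma measurableSet_preimage_mk {S : Set Plane} (hS : MeasurableSet S) :
    MeasurableSet ((fun p : ℝ × ℝ => (!₂[p.1, p.2] : Plane)) ⁻¹' S) :=
  measurePreserving_mk.measurable hS

lemma volume_eq_lintegral_horizontal {S : Set Plane} (hS : MeasurableSet S) :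
    volume S = ∫⁻ θ, volume ((fun y : ℝ => (!₂[y, θ] : Plane)) ⁻¹' S) := by
  rw [← measurePreserving_mk.measure_preimage hS.nullMeasurableSet, Measure.volume_eq_prod,
    Measure.prod_apply_symm (measurableSet_preimage_mk hS)]
  rfl

lemma volume_eq_lintegral_vertical {S : Set Plane} (hS : MeasurableSet S) :
    volume S = ∫⁻ y, volume ((fun θ : ℝ => (!₂[y, θ] : Plane)) ⁻¹' S) := by
  rw [← measurePreserving_mk.measure_preimage hS.nullMeasurableSet, Measure.volume_eq_prod,
    Measure.prod_apply (measurableSet_preimage_mk hS)]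
  rfl

lemma isometry_horizontal (θ : ℝ) : Isometry fun y : ℝ => (!₂[y, θ] : Plane) := by
  refine Isometry.of_dist_eq fun y y' => ?_
  refine (pow_left_inj₀ dist_nonneg dist_nonneg two_ne_zero).1 ?_
  rw [dist_sq_eq, Real.dist_eq, sq_abs]
  simp

lemma isometry_vertical (y : ℝ) : Isometry fun θ : ℝ => (!₂[y, θ] : Plane) := by
  refine Isometry.of_dist_eq fun θ θ' => ?_
  refine (pow_left_inj₀ dist_nonneg dist_nonneg two_ne_zero).1 ?_
  rw [dist_sq_eq, Real.dist_eq, sq_abs]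
  simp

/-! ### Controlled complexity -/

lemma measurableSet_innerBoundary {I : Set Plane} (hI : IsOpen I) (r : ℝ) :
    MeasurableSet (innerBoundary r I) :=
  hI.measurableSet.inter
    (isClosed_Iic.preimage (Metric.continuous_infEDist (s := frontier I))).measurableSet

/-- The part of `I` outside its boundary layer of width `r`. -/
def innerCore (r : ℝ) (I : Set Plane) : Set Plane := I \ innerBoundary r I

lemma lt_infEDist_of_mem_innerCore {I : Set Plane} {r : ℝ} {w : Plane} (hw : w ∈ innerCore r I) :
    ENNReal.ofReal r < Metric.infEDist w (frontier I) :=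
  not_le.1 fun h => hw.2 ⟨hw.1, h⟩

/-- The points of the plane that the return map brings `ε`-close to a curved side of an image. -/
def planeLineBad (γ : ℝ) (u : ℝ → ℝ → ℝ) (ε : ℝ) : Set Plane :=
  ⋃ k, {w | w 0 ∈ lineBad γ u ε (w 1) k}

/-- The points of the plane that the return map brings `ε`-close to a horizontal side of an
image. -/
def planeAngleBad (γ : ℝ) (u : ℝ → ℝ → ℝ) (ε : ℝ) : Set Plane :=
  ⋃ k, {w | w 1 ∈ angleBad γ u ε (w 0) k}

lemma measurableSet_planeLineBad (hu : IsAdmissible γ u) (ε : ℝ) :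
    MeasurableSet (planeLineBad γ u ε) := by
  refine MeasurableSet.iUnion fun k => ?_
  have ho : ∀ i, Measurable fun w : Plane => orb γ u i (w 0) (w 1) :=
    fun i => (continuous_orb_plane hu i).measurable
  have h0 : Measurable fun w : Plane => w 0 := by fun_prop
  have h1 : MeasurableSet {w : Plane | w 0 ∈ lineLevel γ u (w 1) k} := by
    refine (measurableSet_lt measurable_const h0).inter (MeasurableSet.inter ?_ ?_)
    · have : {w : Plane | ∀ i < k, orb γ u i (w 0) (w 1) < 3 / 4} =
          ⋂ i, ⋂ _ : i < k, {w : Plane | orb γ u i (w 0) (w 1) < 3 / 4} := by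
        ext w; simp
      change MeasurableSet {w : Plane | ∀ i < k, orb γ u i (w 0) (w 1) < 3 / 4}
      rw [this]
      exact MeasurableSet.iInter fun i => MeasurableSet.iInter fun _ =>
        measurableSet_lt (ho i) measurable_const
    · exact measurableSet_le measurable_const (ho k)
  refine h1.inter (MeasurableSet.union (measurableSet_le (ho k) measurable_const) ?_)
  have : {w : Plane | ∃ l, k = l + 1 ∧ 3 / 4 - ε ≤ orb γ u l (w 0) (w 1)} =
      ⋃ l, ⋃ _ : k = l + 1, {w : Plane | 3 / 4 - ε ≤ orb γ u l (w 0) (w 1)} := by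
    ext w; simp
  change MeasurableSet {w : Plane | ∃ l, k = l + 1 ∧ 3 / 4 - ε ≤ orb γ u l (w 0) (w 1)}
  rw [this]
  exact MeasurableSet.iUnion fun l => MeasurableSet.iUnion fun _ =>
    measurableSet_le measurable_const (ho l)

lemma measurableSet_planeAngleBad (hu : IsAdmissible γ u) (ε : ℝ) :
    MeasurableSet (planeAngleBad γ u ε) := by
  refine MeasurableSet.iUnion fun k => ?_
  have ho : ∀ i, Measurable fun w : Plane => orb γ u i (w 0) (w 1) :=
    fun i => (continuous_orb_plane hu i).measurable
  refine MeasurableSet.inter ?_ (MeasurableSet.inter ?_ ?_)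
  · have : {w : Plane | ∀ i < k, orb γ u i (w 0) (w 1) < 3 / 4} =
        ⋂ i, ⋂ _ : i < k, {w : Plane | orb γ u i (w 0) (w 1) < 3 / 4} := by
      ext w; simp
    change MeasurableSet {w : Plane | ∀ i < k, orb γ u i (w 0) (w 1) < 3 / 4}
    rw [this]
    exact MeasurableSet.iInter fun i => MeasurableSet.iInter fun _ =>
      measurableSet_lt (ho i) measurable_const
  · exact measurableSet_le measurable_const (ho k)
  · have : {w : Plane | ∃ q : ℤ, |4 ^ (k + 1) * w 1 - q| ≤ ε} =
        ⋃ q : ℤ, {w : Plane | |4 ^ (k + 1) * w 1 - q| ≤ ε} := by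
      ext w; simp
    change MeasurableSet {w : Plane | ∃ q : ℤ, |4 ^ (k + 1) * w 1 - q| ≤ ε}
    rw [this]
    refine MeasurableSet.iUnion fun q => measurableSet_le (Continuous.measurable ?_)
      measurable_const
    fun_prop

lemma measurableSet_innerCore {I : Set Plane} (hI : IsOpen I) (r : ℝ) :
    MeasurableSet (innerCore r I) :=
  hI.measurableSet.diff (measurableSet_innerBoundary hI r)

/-- A bad set that takes up length at most `5ε/8` on every line of a family costs only a fraction
of the boundary layer, which has length at least `2r` on every such line that meets the core. -/
lemma volume_slice_le {I B : Set Plane} (hI : IsOpen I) (hIb : Bornology.IsBounded I)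
    {ℓ : ℝ → Plane} (hℓ : Isometry ℓ) {r ε : ℝ} (hr : 0 < r)
    (hB : (∃ s, ℓ s ∈ innerCore r I) →
      volume (ℓ ⁻¹' (innerCore r I ∩ B)) ≤ ENNReal.ofReal (5 / 8 * ε)) :
    volume (ℓ ⁻¹' (innerCore r I ∩ B)) ≤
      ENNReal.ofReal (5 / 16 * ε / r) * volume (ℓ ⁻¹' innerBoundary r I) := by
  by_cases h : ∃ s, ℓ s ∈ innerCore r I
  · obtain ⟨s₀, hs₀⟩ := h
    have h1 := ofReal_le_volume_preimage_innerBoundary hI hIb hℓ hr hs₀.1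
      (lt_infEDist_of_mem_innerCore hs₀)
    calc volume (ℓ ⁻¹' (innerCore r I ∩ B)) ≤ ENNReal.ofReal (5 / 8 * ε) := hB ⟨s₀, hs₀⟩
      _ = ENNReal.ofReal (5 / 16 * ε / r) * ENNReal.ofReal (2 * r) := by
          rw [← ENNReal.ofReal_mul' (by positivity)]
          congr 1
          field_simp
          ring
      _ ≤ _ := by gcongr
  · have : ℓ ⁻¹' (innerCore r I ∩ B) = ∅ := by
      rw [eq_empty_iff_forall_notMem]
      exact fun s hs => h ⟨s, hs.1⟩
    rw [this, measure_empty]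
    exact zero_le

lemma exists_volume_core_inter_planeLineBad_le (hu : IsAdmissible γ u) : ∃ ε₁ : ℝ, 0 < ε₁ ∧
    ∀ ε₀ ε r : ℝ, ε₀ ≤ ε₁ → 0 < ε → ε < ε₀ → 0 < r → ∀ I : Set Plane, IsOpen I →
    I ⊆ Y γ u → Metric.diam I ≤ ε₀ →
    volume (innerCore r I ∩ planeLineBad γ u ε) ≤
      ENNReal.ofReal (5 / 16 * ε / r) * volume (innerBoundary r I) := by
  obtain ⟨ε₁, hε₁, h⟩ := exists_volume_lineBad_iUnion_le hu
  refine ⟨ε₁, hε₁, ?_⟩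
  intro ε₀ ε r hε₀ hε hεε hr I hI hIY hdiam
  have hIb : Bornology.IsBounded I := isBounded_Y.subset hIY
  have hB := measurableSet_planeLineBad hu ε
  rw [volume_eq_lintegral_horizontal ((measurableSet_innerCore hI r).inter hB),
    volume_eq_lintegral_horizontal (measurableSet_innerBoundary hI r),
    ← lintegral_const_mul' _ _ ENNReal.ofReal_ne_top]
  refine lintegral_mono fun θ => volume_slice_le hI hIb (isometry_horizontal θ) hr fun _ => ?_
  refine le_trans (measure_mono ?_) (h ε₀ ε θ hε₀ hε hεε
    ((fun y : ℝ => (!₂[y, θ] : Plane)) ⁻¹' innerCore r I) ?_)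
  · rintro y ⟨hy, hy'⟩
    refine ⟨hy, ?_⟩
    obtain ⟨k, hk⟩ := mem_iUnion.1 hy'
    exact mem_iUnion.2 ⟨k, by simpa using hk⟩
  · intro y hy y' hy'
    rw [← Real.dist_eq, ← (isometry_horizontal θ).dist_eq]
    exact (Metric.dist_le_diam_of_mem hIb hy.1 hy'.1).trans hdiam

lemma exists_volume_core_inter_planeAngleBad_le (hu : IsAdmissible γ u) : ∃ ε₁ : ℝ, 0 < ε₁ ∧
    ∀ ε₀ ε r : ℝ, ε₀ ≤ ε₁ → 0 < ε → ε < ε₀ → 0 < r → ∀ I : Set Plane, IsOpen I →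
    I ⊆ Y γ u → Metric.diam I ≤ ε₀ →
    volume (innerCore r I ∩ planeAngleBad γ u ε) ≤
      ENNReal.ofReal (5 / 16 * ε / r) * volume (innerBoundary r I) := by
  obtain ⟨ε₁, hε₁, h⟩ := exists_volume_angleBad_iUnion_le hu
  refine ⟨ε₁, hε₁, ?_⟩
  intro ε₀ ε r hε₀ hε hεε hr I hI hIY hdiam
  have hIb : Bornology.IsBounded I := isBounded_Y.subset hIY
  have hB := measurableSet_planeAngleBad hu ε
  rw [volume_eq_lintegral_vertical ((measurableSet_innerCore hI r).inter hB),
    volume_eq_lintegral_vertical (measurableSet_innerBoundary hI r),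
    ← lintegral_const_mul' _ _ ENNReal.ofReal_ne_top]
  refine lintegral_mono fun y => volume_slice_le hI hIb (isometry_vertical y) hr ?_
  rintro ⟨s, hs⟩
  have hy : 3 / 4 < y := by
    simpa using lt_fst_of_mem_interior_Y (interior_maximal hIY hI hs.1)
  refine le_trans (measure_mono ?_) (h ε₀ ε y hε₀ hε hεε hy
    ((fun θ : ℝ => (!₂[y, θ] : Plane)) ⁻¹' innerCore r I) ?_)
  · rintro θ ⟨hθ, hθ'⟩
    refine ⟨hθ, ?_⟩
    obtain ⟨k, hk⟩ := mem_iUnion.1 hθ'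
    exact mem_iUnion.2 ⟨k, by simpa using hk⟩
  · intro θ hθ θ' hθ'
    rw [← Real.dist_eq, ← (isometry_vertical y).dist_eq]
    exact (Metric.dist_le_diam_of_mem hIb hθ.1 hθ'.1).trans hdiam

lemma pairwise_disjoint_partitionY (hu : IsAdmissible γ u)
    (hX : MapsTo (f γ u) (X γ u) (X γ u)) :
    Pairwise (Function.onFun Disjoint fun a : partitionY γ u => (a : Set Plane)) := by
  rintro ⟨a, ha⟩ ⟨b, hb⟩ hab
  obtain ⟨k, j, rfl⟩ := exists_eq_cell ha
  obtain ⟨k', j', rfl⟩ := exists_eq_cell hb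
  rw [Function.onFun, Set.disjoint_left]
  intro w hw hw'
  have h1 : φ γ u w = k + 1 := (interior_subset hw).1.2
  have h2 : φ γ u w = k' + 1 := (interior_subset hw').1.2
  obtain rfl : k = k' := by omega
  apply hab
  have h3 := ((mem_cell_iff hu hX).1 hw).2.2.2
  have h3' := ((mem_cell_iff hu hX).1 hw').2.2.2
  have h4 : (0 : ℝ) < 4 ^ (k + 1) := by positivity
  rw [mem_Ioo, div_lt_iff₀' h4, lt_div_iff₀' h4] at h3 h3'
  have e1 : (j : ℝ) < j' + 1 := by linarith
  have e2 : (j' : ℝ) < j + 1 := by linarith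
  norm_cast at e1 e2
  obtain rfl : j = j' := by omega
  rfl

/-- The part of `I` that is counted by the complexity sum, outside the boundary layer of `I`, lies
in the union of the two bad sets. -/
lemma branchInv_image_diff_subset (hu : IsAdmissible γ u)
    (hX : MapsTo (f γ u) (X γ u) (X γ u)) {Λ ε : ℝ} (hΛ : 1 / 4 ≤ Λ) (hε : 0 < ε) {I : Set Plane}
    (hI : IsOpen I) (hIY : I ⊆ Y γ u) {a : Set Plane} (ha : a ∈ partitionY γ u) :
    branchInv γ u a '' innerBoundary ε (F γ u '' (I ∩ a)) \ innerBoundary (ε * Λ) I ⊆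
      a ∩ (innerCore (ε * Λ) I ∩ (planeLineBad γ u ε ∪ planeAngleBad γ u ε)) := by
  obtain ⟨k, j, rfl⟩ := exists_eq_cell ha
  rintro _ ⟨⟨z, hz, rfl⟩, hzΛ⟩
  obtain ⟨w, ⟨hwI, hw⟩, rfl⟩ := hz.1
  rw [branchInv_F hu hX hw] at hzΛ ⊢
  obtain ⟨hY, h1, h2, -⟩ := (mem_cell_iff hu hX).1 hw
  have hw0 := lt_fst_of_mem_interior_Y hY
  refine ⟨hw, ⟨hwI, hzΛ⟩, ?_⟩
  rcases near_side_of_mem_innerBoundary hu hX hΛ hε hI hIY hwI hw hz hzΛ with h | h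
  · exact Or.inl (mem_iUnion.2 ⟨k, ⟨hw0, h1, h2.le⟩, h⟩)
  · exact Or.inr (mem_iUnion.2 ⟨k, h1, h2.le, h⟩)

theorem exists_controlledComplexity (hu : IsAdmissible γ u)
    (hX : MapsTo (f γ u) (X γ u) (X γ u)) {Λ : ℝ} (hΛ : Λ ∈ Ioo (1 / 4 : ℝ) (1 / 3)) :
    ∃ ε₁ : ℝ, 0 < ε₁ ∧ ∀ ε₀ ≤ ε₁, ControlledComplexity γ u Λ ε₀ := by
  obtain ⟨ε₁, hε₁, h1⟩ := exists_volume_core_inter_planeLineBad_le hu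
  obtain ⟨ε₂, hε₂, h2⟩ := exists_volume_core_inter_planeAngleBad_le hu
  refine ⟨min ε₁ ε₂, lt_min hε₁ hε₂, ?_⟩
  intro ε₀ hε₀ I hI hIY hdiam ε hε hεε
  have hΛ0 : 0 < Λ := by linarith [hΛ.1]
  have hr : 0 < ε * Λ := mul_pos hε hΛ0
  set core := innerCore (ε * Λ) I with hcore
  set bad := planeLineBad γ u ε ∪ planeAngleBad γ u ε with hbad
  have hmeas : MeasurableSet (core ∩ bad) := (measurableSet_innerCore hI _).inter
    ((measurableSet_planeLineBad hu ε).union (measurableSet_planeAngleBad hu ε))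
  have hsum : ∑' a : partitionY γ u,
      volume (branchInv γ u a '' innerBoundary ε (F γ u '' (I ∩ a)) \ innerBoundary (ε * Λ) I) ≤
      ENNReal.ofReal (5 / 8 / Λ) * volume (innerBoundary (ε * Λ) I) := by
    calc ∑' a : partitionY γ u,
          volume (branchInv γ u a '' innerBoundary ε (F γ u '' (I ∩ a)) \ innerBoundary (ε * Λ) I)
        ≤ ∑' a : partitionY γ u, volume ((a : Set Plane) ∩ (core ∩ bad)) :=
          ENNReal.tsum_le_tsum fun a => measure_mono
            (branchInv_image_diff_subset hu hX hΛ.1.le hε hI hIY a.2)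
      _ ≤ volume (⋃ a : partitionY γ u, (a : Set Plane) ∩ (core ∩ bad)) := by
          refine tsum_meas_le_meas_iUnion_of_disjoint _ (fun a => ?_) fun a b hab => ?_
          · obtain ⟨k, j, h⟩ := exists_eq_cell a.2
            rw [h]
            exact (isOpen_cell _ _).measurableSet.inter hmeas
          · exact (pairwise_disjoint_partitionY hu hX hab).mono inter_subset_left
              inter_subset_left
      _ ≤ volume ((core ∩ planeLineBad γ u ε) ∪ (core ∩ planeAngleBad γ u ε)) := by
          refine measure_mono (iUnion_subset fun a => ?_)
          rw [← inter_union_distrib_left]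
          exact inter_subset_right
      _ ≤ _ := measure_union_le _ _
      _ ≤ ENNReal.ofReal (5 / 16 * ε / (ε * Λ)) * volume (innerBoundary (ε * Λ) I) +
          ENNReal.ofReal (5 / 16 * ε / (ε * Λ)) * volume (innerBoundary (ε * Λ) I) :=
          add_le_add
            (h1 ε₀ ε _ (hε₀.trans (min_le_left _ _)) hε hεε hr I hI hIY hdiam)
            (h2 ε₀ ε _ (hε₀.trans (min_le_right _ _)) hε hεε hr I hI hIY hdiam)
      _ = ENNReal.ofReal (5 / 8 / Λ) * volume (innerBoundary (ε * Λ) I) := by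
          rw [← add_mul, ← ENNReal.ofReal_add (by positivity) (by positivity)]
          congr 2
          field_simp
          norm_num
  have htsum : ∑' a : partitionY γ u,
      volume (branchInv γ u a '' innerBoundary ε (F γ u '' (I ∩ a)) \ innerBoundary (ε * Λ) I) /
        volume (innerBoundary (ε * Λ) I) ≤ ENNReal.ofReal (5 / 8 / Λ) := by
    simp only [div_eq_mul_inv _ (volume (innerBoundary (ε * Λ) I))]
    rw [ENNReal.tsum_mul_right, ← div_eq_mul_inv]
    exact ENNReal.div_le_of_le_mul hsum
  refine htsum.trans_lt ?_
  have hlt : 5 / 8 / Λ < Λ⁻¹ - 1 := by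
    have h3 : Λ * Λ⁻¹ = 1 := mul_inv_cancel₀ hΛ0.ne'
    rw [div_lt_iff₀ hΛ0]
    nlinarith [hΛ.2]
  exact (ENNReal.ofReal_lt_ofReal_iff ((by positivity : 0 < 5 / 8 / Λ).trans hlt)).2 hlt

/-! ### The interior of `Y` -/

lemma mem_Y_of_le (hu : IsAdmissible γ u) {z : Plane} {i : ℕ} (hi : i < 4) (h0 : 3 / 4 ≤ z 0)
    (h1 : z 1 ∈ Ico (0 : ℝ) 1) (h : z 0 ≤ leftFst γ u (3 / 4) ((i + z 1) / 4)) : z ∈ Y γ u := by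
  have hle : z 0 ≤ 1 := h.trans (hu.le_one _ ⟨by norm_num, le_rfl⟩ _)
  refine ⟨⟨h0, hle⟩, mem_iUnion₂.2 ⟨i, Finset.mem_range.2 hi, ⟨⟨by linarith, hle⟩, h1⟩, ?_⟩⟩
  rwa [f₁, if_pos le_rfl]

lemma exists_le_of_mem_Y {z : Plane} (hz : z ∈ Y γ u) :
    ∃ i : ℕ, i < 4 ∧ z 0 ≤ leftFst γ u (3 / 4) ((i + z 1) / 4) := by
  obtain ⟨i, hi, -, h⟩ := mem_iUnion₂.1 hz.2
  rw [f₁, if_pos le_rfl] at h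
  exact ⟨i, Finset.mem_range.1 hi, h⟩

lemma continuous_leftFst_three_quarters (hu : IsAdmissible γ u) :
    Continuous fun θ => leftFst γ u (3 / 4) θ :=
  (leftFst_continuousOn hu).comp_continuous (f := fun θ : ℝ => ((3 / 4 : ℝ), θ)) (by fun_prop)
    fun _ => mem_strip.2 ⟨by norm_num, le_rfl⟩

lemma mem_interior_Y_of_lt (hu : IsAdmissible γ u) {z : Plane} {i : ℕ} (hi : i < 4)
    (h0 : 3 / 4 < z 0) (h1 : z 1 ∈ Ioo (0 : ℝ) 1)
    (h : z 0 < leftFst γ u (3 / 4) ((i + z 1) / 4)) : z ∈ interior (Y γ u) := by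
  have c0 : Continuous fun z : Plane => z 0 := by fun_prop
  have c1 : Continuous fun z : Plane => z 1 := by fun_prop
  have c2 : Continuous fun z : Plane => leftFst γ u (3 / 4) ((i + z 1) / 4) :=
    (continuous_leftFst_three_quarters hu).comp (by fun_prop)
  rw [mem_interior_iff_mem_nhds]
  filter_upwards [c0.continuousAt.eventually_const_lt h0, c1.continuousAt (isOpen_Ioo.mem_nhds h1),
    c0.continuousAt.eventually_lt c2.continuousAt h] with w w0 w1 w2
  exact mem_Y_of_le hu hi w0.le (Ioo_subset_Ico_self w1) w2.le

lemma mem_interior_Y_of_lt_const (hu : IsAdmissible γ u) {z : Plane} (h0 : 3 / 4 < z 0)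
    (h0' : z 0 < 15 / 16) (h1 : z 1 ∈ Ioo (0 : ℝ) 1) : z ∈ interior (Y γ u) :=
  mem_interior_Y_of_lt hu (i := 0) (by norm_num) h0 h1 (h0'.trans (hu.image_large _))

lemma exists_lt_of_mem_interior_Y {z : Plane} (hz : z ∈ interior (Y γ u)) :
    ∃ i : ℕ, i < 4 ∧ z 0 < leftFst γ u (3 / 4) ((i + z 1) / 4) := by
  obtain ⟨s, hs, hsY⟩ := exists_pos_of_eventually (eventually_shift_fst_mem hz)
  obtain ⟨i, hi, h⟩ := exists_le_of_mem_Y hsY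
  simp only [Matrix.cons_val_zero, Matrix.cons_val_one, Matrix.cons_val_fin_one] at h
  exact ⟨i, hi, by linarith⟩

lemma volume_graph_eq_zero {g : ℝ → ℝ} (hg : Continuous g) :
    volume {z : Plane | z 0 = g (z 1)} = 0 := by
  have hc : Continuous fun z : Plane => g (z 1) := hg.comp (by fun_prop)
  rw [volume_eq_lintegral_horizontal
    (isClosed_eq (by fun_prop : Continuous fun z : Plane => z 0) hc).measurableSet]
  refine lintegral_eq_zero_of_ae_eq_zero (Eventually.of_forall fun θ => ?_)
  have : (fun y : ℝ => (!₂[y, θ] : Plane)) ⁻¹' {z | z 0 = g (z 1)} = {g θ} := by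
    ext y; simp
  exact (congrArg volume this).trans Real.volume_singleton

lemma volume_horizontal_eq_zero (c : ℝ) : volume {z : Plane | z 1 = c} = 0 := by
  rw [volume_eq_lintegral_vertical
    (isClosed_eq (by fun_prop : Continuous fun z : Plane => z 1) continuous_const).measurableSet]
  refine lintegral_eq_zero_of_ae_eq_zero (Eventually.of_forall fun y => ?_)
  have : (fun θ : ℝ => (!₂[y, θ] : Plane)) ⁻¹' {z | z 1 = c} = {c} := by
    ext θ; simp
  exact (congrArg volume this).trans Real.volume_singleton

/-- A point of `Y` outside the interior lies on the left side, on the angle `0`, or on one of the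
four graphs that bound `X`. -/
lemma volume_Y_diff_interior (hu : IsAdmissible γ u) : volume (Y γ u \ interior (Y γ u)) = 0 := by
  have hsub : Y γ u \ interior (Y γ u) ⊆ {z | z 0 = (fun _ => 3 / 4) (z 1)} ∪ ({z | z 1 = 0} ∪
      ⋃ i : ℕ, {z | z 0 = (fun t => leftFst γ u (3 / 4) ((i + t) / 4)) (z 1)}) := by
    rintro z ⟨hz, hzi⟩
    by_contra hcon
    simp only [mem_union, mem_iUnion, mem_ofPred_eq, not_or, not_exists] at hcon
    obtain ⟨c1, c2, c3⟩ := hcon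
    obtain ⟨i, hi, h⟩ := exists_le_of_mem_Y hz
    have h1 := (X_subset_M hz.2).2
    exact hzi (mem_interior_Y_of_lt hu hi (lt_of_le_of_ne hz.1.1 (Ne.symm c1))
      ⟨lt_of_le_of_ne h1.1 (Ne.symm c2), h1.2⟩ (lt_of_le_of_ne h (c3 i)))
  refine measure_mono_null hsub (measure_union_null (volume_graph_eq_zero continuous_const)
    (measure_union_null (volume_horizontal_eq_zero 0) (measure_iUnion_null fun i =>
      volume_graph_eq_zero ((continuous_leftFst_three_quarters hu).comp
        (f := fun t : ℝ => ((i : ℝ) + t) / 4) (by fun_prop)))))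

/-! ### Small rectangles -/

/-- On the line at height `θ`, the points of return time `k + 2` are mapped over the whole interval
from `3/4` to the image of `3/4` under the last step of the left branch. -/
lemma exists_orb_preimage (hu : IsAdmissible γ u) {k : ℕ} {θ v : ℝ} (hv : 3 / 4 < v)
    (hv' : v < leftFst γ u (3 / 4) (4 ^ (k + 1) * θ)) : ∃ y, 3 / 4 < y ∧
      (∀ i < k + 1, orb γ u i y θ < 3 / 4) ∧ orb γ u (k + 1) y θ = v := by
  obtain ⟨y, -, hy⟩ := exists_orb_eq hu (k + 1) θ (v := v) (by linarith)
  have hy0 : 3 / 4 < y := (orb_pos_iff hu (k + 1)).1 (by linarith)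
  refine ⟨y, hy0, fun i hi => ?_, hy⟩
  refine (orb_mono hu hy0.le θ (Nat.lt_succ_iff.1 hi)).trans_lt ?_
  by_contra! h
  have h1 := ext_mono hu h (4 ^ (k + 1) * θ)
  rw [ext_of_mem ⟨by norm_num, le_rfl⟩, ← orb_succ, hy] at h1
  linarith

/-- Points with a long return time lie close to the left side of `Y`. -/
lemma exists_lt_of_return (hu : IsAdmissible γ u) {δ : ℝ} (hδ : 0 < δ) :
    ∃ N : ℕ, ∀ k y θ, N < k → (∀ i < k, orb γ u i y θ < 3 / 4) → y < 3 / 4 + δ := by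
  obtain ⟨N, hN⟩ := exists_reach hu (r := 4 * δ) (by linarith)
  refine ⟨N, fun k y θ hk h => ?_⟩
  by_contra! hy
  have h1 := hN 0 y θ (by simp only [orb]; linarith)
  rw [zero_add] at h1
  linarith [h N hk]

/-- The open square with lower left corner `(3/4, 1/4)` and side `s`. -/
def cornerSquare (s : ℝ) : Set Plane :=
  {z | z 0 ∈ Ioo (3 / 4) (3 / 4 + s) ∧ z 1 ∈ Ioo (1 / 4) (1 / 4 + s)}

lemma isRectangle_cornerSquare {s : ℝ} (hs : 0 < s) : IsRectangle (cornerSquare s) :=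
  ⟨_, _, _, _, by linarith, by linarith, rfl⟩

lemma volume_cornerSquare (s : ℝ) :
    volume (cornerSquare s) = ENNReal.ofReal s * ENNReal.ofReal s := by
  have h0 : Continuous fun z : Plane => z 0 := by fun_prop
  have h1 : Continuous fun z : Plane => z 1 := by fun_prop
  have hm : MeasurableSet (cornerSquare s) :=
    ((isOpen_Ioo.preimage h0).inter (isOpen_Ioo.preimage h1)).measurableSet
  have : (fun p : ℝ × ℝ => (!₂[p.1, p.2] : Plane)) ⁻¹' cornerSquare s =
      Ioo (3 / 4) (3 / 4 + s) ×ˢ Ioo (1 / 4) (1 / 4 + s) := by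
    ext p; simp [cornerSquare]
  rw [← measurePreserving_mk.measure_preimage hm.nullMeasurableSet, this, Measure.volume_eq_prod,
    Measure.prod_prod, Real.volume_Ioo, Real.volume_Ioo, add_sub_cancel_left, add_sub_cancel_left]

lemma diam_cornerSquare_le {s : ℝ} (hs : 0 < s) : Metric.diam (cornerSquare s) ≤ 2 * s := by
  refine Metric.diam_le_of_forall_dist_le (by linarith) fun z hz w hw => ?_
  refine abs_le_of_sq_le_sq' ?_ (by linarith) |>.2
  rw [dist_sq_eq]
  have h0 : |z 0 - w 0| ≤ s := abs_le.2 ⟨by linarith [hz.1.1, hw.1.2], by linarith [hz.1.2, hw.1.1]⟩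
  have h1 : |z 1 - w 1| ≤ s := abs_le.2 ⟨by linarith [hz.2.1, hw.2.2], by linarith [hz.2.2, hw.2.1]⟩
  have h0' := pow_le_pow_left₀ (abs_nonneg _) h0 2
  have h1' := pow_le_pow_left₀ (abs_nonneg _) h1 2
  rw [sq_abs] at h0' h1'
  nlinarith

lemma cornerSquare_subset_interior_Y (hu : IsAdmissible γ u) {s : ℝ} (hs : s < 1 / 8) :
    cornerSquare s ⊆ interior (Y γ u) := fun _ hz =>
  mem_interior_Y_of_lt_const hu hz.1.1 (by linarith [hz.1.2])
    ⟨by linarith [hz.2.1], by linarith [hz.2.2]⟩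

/-- The cell of return time `k + 2` whose angles start at `1/4` is mapped over corner squares of a
definite size: its image reaches from `3/4` to the right of `15/16` at every angle. -/
lemma cornerSquare_subset_image_cell (hu : IsAdmissible γ u)
    (hX : MapsTo (f γ u) (X γ u) (X γ u)) {s t : ℝ} (hs : s < 1 / 8) (ht : t < 1 / 8) {k : ℕ}
    (hk : ∀ y θ, (∀ i < k + 1, orb γ u i y θ < 3 / 4) → y < 3 / 4 + t) :
    cornerSquare s ⊆ F γ u '' cell γ u (k + 2) (4 ^ (k + 1) + 1) := by
  intro v hv
  have h4 : (0 : ℝ) < 4 ^ (k + 1) := by positivity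
  have h44 : (4 : ℝ) ^ (k + 2) = 4 * 4 ^ (k + 1) := by ring
  have h41 : (4 : ℝ) ≤ 4 ^ (k + 1) := by
    have : (1 : ℝ) ≤ 4 ^ k := one_le_pow₀ (by norm_num)
    rw [pow_succ]; linarith
  set θ := (4 ^ (k + 1) + v 1) / 4 ^ (k + 2) with hθ
  have hθ' : 4 ^ (k + 2) * θ = 4 ^ (k + 1) + v 1 := by rw [hθ]; field_simp
  have hv1 : v 1 ∈ Ioo (0 : ℝ) 1 := ⟨by linarith [hv.2.1], by linarith [hv.2.2]⟩
  obtain ⟨y, hy, hy1, hy2⟩ := exists_orb_preimage hu (k := k) (θ := θ) hv.1.1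
    ((by linarith [hv.1.2] : v 0 < 15 / 16).trans (hu.image_large _))
  have hyt := hk y θ hy1
  have hcell : (!₂[y, θ] : Plane) ∈ cell γ u (k + 2) (4 ^ (k + 1) + 1) := by
    refine (mem_cell_iff hu hX).2 ⟨mem_interior_Y_of_lt_const hu ?_ ?_ ?_, ?_, ?_, ?_⟩
    · simpa using hy
    · simp only [Matrix.cons_val_zero]; linarith
    · simp only [Matrix.cons_val_one, Matrix.cons_val_fin_one]
      constructor
      · rw [hθ]; have := hv1.1; positivity
      · rw [hθ, div_lt_one (by positivity), h44]; linarith [hv1.2]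
    · simpa using hy1
    · simpa [hy2] using hv.1.1
    · simp only [Matrix.cons_val_one, Matrix.cons_val_fin_one, hθ]
      push_cast
      constructor
      · exact div_lt_div_of_pos_right (by linarith [hv1.1]) (by positivity)
      · exact div_lt_div_of_pos_right (by linarith [hv1.2]) (by positivity)
  refine ⟨_, hcell, ?_⟩
  rw [F_eq_branchMap hu hX hcell]
  ext i
  fin_cases i
  · simpa [branchMap] using hy2
  · simp only [branchMap, Fin.mk_one, Matrix.cons_val_one, Matrix.cons_val_fin_one]
    rw [hθ']; push_cast; ring

lemma cell_subset_cornerSquare (hu : IsAdmissible γ u) (hX : MapsTo (f γ u) (X γ u) (X γ u))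
    {t : ℝ} {k : ℕ} (hk : ∀ y θ, (∀ i < k + 1, orb γ u i y θ < 3 / 4) → y < 3 / 4 + t)
    (hkt : 1 / 4 ^ (k + 1) < t) :
    cell γ u (k + 2) (4 ^ (k + 1) + 1) ⊆ cornerSquare t := by
  intro w hw
  obtain ⟨hY, h1, -, h3⟩ := (mem_cell_iff hu hX).1 hw
  have h4 : (0 : ℝ) < 4 ^ (k + 1) := by positivity
  have h44 : (4 : ℝ) ^ (k + 1 + 1) = 4 * 4 ^ (k + 1) := by ring
  refine ⟨⟨lt_fst_of_mem_interior_Y hY, hk _ _ h1⟩, ?_⟩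
  rw [mem_Ioo, h44, div_lt_iff₀ (by positivity), lt_div_iff₀ (by positivity)] at h3
  rw [div_lt_iff₀ h4] at hkt
  push_cast at h3
  constructor
  · by_contra! h
    nlinarith [h3.1]
  · by_contra! h
    nlinarith [h3.2]

/-- A thin strip of angles already covers the circle after `k + 1` steps, so the part of a corner
square with return time `k + 2` is mapped over all of `Int Y`. -/
lemma interior_Y_subset_image (hu : IsAdmissible γ u) (hX : MapsTo (f γ u) (X γ u) (X γ u))
    {t : ℝ} (ht : t < 1 / 8) {k : ℕ}
    (hk : ∀ y θ, (∀ i < k + 1, orb γ u i y θ < 3 / 4) → y < 3 / 4 + t)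
    (hkt : 1 / 4 ^ (k + 1) < t) :
    interior (Y γ u) ⊆ F γ u '' (cornerSquare t ∩ interior (level γ u (k + 2))) := by
  intro v hv
  obtain ⟨i, hi, hvi⟩ := exists_lt_of_mem_interior_Y hv
  have hv0 := lt_fst_of_mem_interior_Y hv
  have hv1 := snd_mem_of_mem_interior_Y hv
  set τ := ((i : ℝ) + v 1) / 4 with hτ
  have hτ1 : τ ∈ Ioo (0 : ℝ) 1 := by
    have hi' : (i : ℝ) ≤ 3 := by exact_mod_cast Nat.lt_succ_iff.1 hi
    have hi0 : (0 : ℝ) ≤ i := Nat.cast_nonneg i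
    constructor <;> linarith [hv1.1, hv1.2]
  have h4 : (0 : ℝ) < 4 ^ (k + 1) := by positivity
  -- the angle `θ > 1/4` with `4 ^ (k + 1) θ = τ` modulo one
  set θ := 1 / 4 + τ / 4 ^ (k + 1) with hθ
  have hθ4 : 4 ^ (k + 1) * θ = τ + ((4 ^ k : ℕ) : ℝ) := by
    rw [hθ]; push_cast; field_simp; ring
  have hθ5 : 4 ^ (k + 2) * θ = v 1 + ((i + 4 ^ (k + 1) : ℕ) : ℝ) := by
    rw [show (4 : ℝ) ^ (k + 2) * θ = 4 * (4 ^ (k + 1) * θ) by ring, hθ4, hτ]; push_cast; ring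
  have hθ1 : 1 / 4 < θ := by have := hτ1.1; rw [hθ]; linarith [div_pos this h4]
  have hθ2 : θ < 1 / 4 + t := by
    have : τ / 4 ^ (k + 1) < 1 / 4 ^ (k + 1) := div_lt_div_of_pos_right hτ1.2 h4
    rw [hθ]; linarith
  have hlt : v 0 < leftFst γ u (3 / 4) (4 ^ (k + 1) * θ) := by
    rw [← leftFst_fract hu ⟨by norm_num, le_rfl⟩, hθ4, Int.fract_add_natCast,
      leftFst_fract hu ⟨by norm_num, le_rfl⟩]
    exact hvi
  obtain ⟨y, hy, hy1, hy2⟩ := exists_orb_preimage hu hv0 hlt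
  have hyt := hk y θ hy1
  have hY : (!₂[y, θ] : Plane) ∈ interior (Y γ u) :=
    mem_interior_Y_of_lt_const hu (by simpa using hy)
      (by simp only [Matrix.cons_val_zero]; linarith)
      (by simp only [Matrix.cons_val_one, Matrix.cons_val_fin_one]; constructor <;> linarith)
  refine ⟨!₂[y, θ], ⟨⟨⟨by simpa using hy, by simpa using hyt⟩, ⟨by simpa using hθ1,
    by simpa using hθ2⟩⟩, mem_interior_level_of hu hX hY (by simpa using hy1)
      (by simpa [hy2] using hv0)⟩, ?_⟩
  rw [F_eq hu hX (interior_subset hY) (by simpa using hy) (k := k + 1) (by simpa using hy1)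
    (by simpa [hy2] using hv0.le)]
  ext i
  fin_cases i
  · simpa using hy2
  · simp only [Fin.mk_one, Matrix.cons_val_one, Matrix.cons_val_fin_one]
    rw [hθ5, Int.fract_add_natCast, Int.fract_eq_self.2 ⟨hv1.1.le, hv1.2⟩]

theorem smallRectangles (hu : IsAdmissible γ u) (hX : MapsTo (f γ u) (X γ u) (X γ u)) :
    SmallRectangles γ u := by
  refine ⟨1 / 8, by norm_num, fun δ hδ hδ' => ?_⟩
  obtain ⟨N, hN⟩ := exists_lt_of_return hu (δ := δ / 4) (by linarith)
  obtain ⟨N', hN'⟩ : ∃ N' : ℕ, 1 / (δ / 4) < 4 ^ N' := pow_unbounded_of_one_lt _ (by norm_num)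
  have hk : ∀ k ≥ N, ∀ y θ, (∀ i < k + 1, orb γ u i y θ < 3 / 4) → y < 3 / 4 + δ / 4 :=
    fun k hkN y θ h => hN (k + 1) y θ (by omega) h
  have hkt : ∀ k ≥ N', 1 / 4 ^ (k + 1) < δ / 4 := by
    intro k hkN
    rw [div_lt_comm₀ (by positivity) (by linarith)]
    exact hN'.trans_le (pow_le_pow_right₀ (by norm_num) (by omega))
  have hZY : cornerSquare (δ / 4) ⊆ interior (Y γ u) :=
    cornerSquare_subset_interior_Y hu (by linarith)
  have hZY' : cornerSquare (δ / 2) ⊆ interior (Y γ u) :=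
    cornerSquare_subset_interior_Y hu (by linarith)
  refine ⟨cornerSquare (δ / 4), cornerSquare (δ / 2), isRectangle_cornerSquare (by linarith),
    isRectangle_cornerSquare (by linarith), hZY.trans interior_subset,
    hZY'.trans interior_subset, ?_, ?_, ?_, ?_⟩
  · rw [volume_cornerSquare, volume_cornerSquare, ← ENNReal.ofReal_mul (by linarith),
      ← ENNReal.ofReal_mul (by linarith), ENNReal.ofReal_lt_ofReal_iff (by positivity)]
    nlinarith
  · exact (diam_cornerSquare_le (by linarith)).trans (by linarith)
  · filter_upwards [eventually_ge_atTop (N + N' + 2)] with n hn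
    obtain ⟨k, rfl⟩ : ∃ k, n = k + 2 := ⟨n - 2, by omega⟩
    have h1 : F γ u '' (cornerSquare (δ / 4) ∩ interior (level γ u (k + 2))) ⊆ Y γ u := by
      rintro _ ⟨w, ⟨hw, -⟩, rfl⟩
      exact F_mem_Y hu hX (interior_subset (hZY hw)) (lt_fst_of_mem_interior_Y (hZY hw))
    have h2 := interior_Y_subset_image hu hX (t := δ / 4) (by linarith) (hk k (by omega))
      (hkt k (by omega))
    refine ⟨h1, h2, h1.eventuallyLE.antisymm ?_⟩
    refine ae_le_set.2 (measure_mono_null ?_ (volume_Y_diff_interior hu))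
    exact sdiff_subset_sdiff_right h2
  · have hmem : ∀ k, cell γ u (k + 2) (4 ^ (k + 1) + 1) ∈ partitionY γ u := fun k =>
      ⟨k + 2, 4 ^ (k + 1) + 1, by omega, Nat.le_add_left _ _, by
        have : 1 ≤ 4 ^ (k + 1) := Nat.one_le_pow _ _ (by norm_num)
        rw [show k + 2 = k + 1 + 1 by rfl, pow_succ 4 (k + 1)]; omega, rfl⟩
    have hsub : ∀ k ≥ N + N', cell γ u (k + 2) (4 ^ (k + 1) + 1) ⊆ cornerSquare (δ / 4) :=
      fun k hkN => cell_subset_cornerSquare hu hX (hk k (by omega)) (hkt k (by omega))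
    have himg : ∀ k ≥ N + N',
        cornerSquare (δ / 2) ⊆ F γ u '' cell γ u (k + 2) (4 ^ (k + 1) + 1) :=
      fun k hkN => cornerSquare_subset_image_cell hu hX (t := δ / 4) (by linarith) (by linarith)
        (hk k (by omega))
    refine ⟨_, hmem (N + N'), _, hmem (N + N' + 1), hsub _ le_rfl, hsub _ (by omega),
      himg _ le_rfl, himg _ (by omega), fun w₁ hw₁ w₂ hw₂ => ?_⟩
    have h1 : φ γ u w₁ = N + N' + 2 := (interior_subset hw₁).1.2
    have h2 : φ γ u w₂ = N + N' + 1 + 2 := (interior_subset hw₂).1.2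
    rw [h1, h2]
    push_cast
    ring

end EMV

end

theorem theoremA1 (γ : ℝ) (u : ℝ → ℝ → ℝ) (hu : EMV.IsAdmissible γ u)
    (hX : Set.MapsTo (EMV.f γ u) (EMV.X γ u) (EMV.X γ u))
    (Λ : ℝ) (hΛ : Λ ∈ Set.Ioo (1 / 4 : ℝ) (1 / 3)) :
    (∀ a ∈ EMV.partitionY γ u, EMV.IsDiffeoBranch γ u a) ∧
    ∃ ε₀ ∈ Set.Ioo (0 : ℝ) 1, ∃ C : ℝ, 0 < C ∧
      EMV.UniformExpansion γ u Λ ε₀ ∧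
      EMV.BoundedDistortion γ u C ∧
      EMV.ControlledComplexity γ u Λ ε₀ ∧
      EMV.SmallRectangles γ u := by
  obtain ⟨C, hC, hdist⟩ := EMV.exists_boundedDistortion hu hX
  obtain ⟨ε₁, hε₁, hcomp⟩ := EMV.exists_controlledComplexity hu hX hΛ
  have hmin : min ε₁ (1 / 2) ≤ 1 / 2 := min_le_right _ _
  exact ⟨fun a ha => EMV.isDiffeoBranch hu hX ha, min ε₁ (1 / 2),
    ⟨lt_min hε₁ (by norm_num), by linarith⟩, C, hC,
    EMV.uniformExpansion hu hX hΛ.1.le _, hdist, hcomp _ (min_le_left _ _),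
    EMV.smallRectangles hu hX⟩
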